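/- **Setting.** Let $G$ be an $n$-dimensional real Lie group (Hausdorff, second countable) with Lie algebra $\mathfrak g$, exponential map $\exp$, and a left Haar measure $m$. Assume that there is an open neighbourhood $\mathcal O$ of $0$ in $\mathfrak g$, fixed from now on, such that: $tX\in\mathcal O$ for $X\in\mathcal O$, $-1\le t\le 1$; $\exp|_{\mathcal O}$ is a diffeomorphism onto an open set $\mathcal U=\exp(\mathcal O)\subset G$; $G\setminus\mathcal U$ has measure zero; and if $S\subset\mathcal U$ has compact closure in $G$, then $\exp^{-1}(S)\subset\mathcal O$ has compact closure in $\mathfrak g$ (here and below $\exp^{-1}:\mathcal U\to\mathcal O$). Let $\hbar\in\mathbb R\setminus\{0\}$. Let $dX$ be the Lebesgue measure on $\mathfrak g=T_eG$ given by the value at $e$ of the left invariant volume form defining $m$, let $dp$ be the dual Lebesgue measure on $\mathfrak g^*$ (parallelepipeds of dual bases have reciprocal volumes), and put $M=G\times\mathfrak g^*$, $dl=|2\pi\hbar|^{-n}\,dm(q)\,dp$, $dn=dm(q)\,dX$; $\|\cdot\|_2$ is the norm of $L^2(M,dl)$. Put $V_a(b)=\exp^{-1}(a^{-1}b)$ for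 $a^{-1}b\in\mathcal U$; $X\diamond Y=\exp^{-1}(\exp X\exp Y)$; $\phi(x)=\sum_{k\ge0}\frac{(-1)^k}{(k+1)!}x^k$; $F(X)=\sqrt{|\det\phi(\mathrm{ad}_X)\det\mathrm{Ad}_{\exp(X/2)}|}$; $L(X,Y)=\frac{F(X)F(Y)}{F(X\diamond Y)}$ if $X,Y\in\mathcal O$ and $\exp X\exp Y\in\mathcal U$, and $L(X,Y)=0$ otherwise. The inverse momentum Fourier transform of $\tilde f$ on $G\times\mathfrak g$ is $f(q,p)=\int_{\mathfrak g}\tilde f(q,X)e^{-\frac i\hbar\langle p,X\rangle}\,dX$. Let $L^2(G\times\mathcal O,dn)$ be the space of complex square integrable functions on $G\times\mathfrak g$ vanishing outside $G\times\mathcal O$, and $\widetilde{\mathcal F}(M)$ the set of those $\tilde f$ in it for which $(a,b)\mapsto\tilde f\bigl(a\exp(\tfrac12V_a(b)),V_a(b)\bigr)F(V_a(b))^{-1}$, defined for $a^{-1}b\in\mathcal U$, extends to an element of $C_c^\infty(G\times G)$. Let $\mathcal F(M)$ be the image of $\widetilde{\mathcal F}(M)$ under the inverse momentum Fourier transform,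 and $\mathcal L(M)\subset L^2(M,dl)$ the image of $L^2(G\times\mathcal O,dn)$ under its $L^2$-version ($f$ is the $L^2(M,dl)$-limit, as $R\to\infty$, of the integrals over $|X|\le R$). For $f\in\mathcal F(M)$ let $\tilde f\in\widetilde{\mathcal F}(M)$ be the function with inverse transform $f$. The star-product of $f,g\in\mathcal F(M)$ is $$(f\star g)(q,p)=\int_{\mathfrak g\times\mathfrak g}\tilde f\bigl(q\exp(-\tfrac12(X\diamond Y))\exp(\tfrac12X),X\bigr)\,\tilde g\bigl(q\exp(\tfrac12(X\diamond Y))\exp(-\tfrac12Y),Y\bigr)e^{-\frac i\hbar\langle p,X\diamond Y\rangle}L(X,Y)\,dX\,dY.$$ **Theorem.** For all $f,g\in\mathcal F(M)$, the functions $f$, $g$, $f\star g$ are square integrable with respect to $dl$, $f\star g\in\mathcal F(M)$, and $$\|f\star g\|_2\le\|f\|_2\,\|g\|_2 .$$ Moreover $\mathcal L(M)$ is complete, $\mathcal F(M)$ is contained in $\mathcal L(M)$ and dense in it, and $\star$ extends uniquely to a continuous bilinear map $\mathcal L(M)\times\mathcal L(M)\to\mathcal L(M)$. The extension satisfies the same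 inequality, $\mathcal L(M)$ is closed under complex conjugation, and $\mathcal L(M)$ is a Hilbert algebra, that is, for the inner product $(f,g)=\int_M\bar f g\,dl$ and all $f,g,h\in\mathcal L(M)$: $\star$ is associative; $f\mapsto\bar f$ is a conjugate-linear involution with $\overline{f\star g}=\bar g\star\bar f$; the maps $g\mapsto f\star g$ and $g\mapsto g\star f$ are bounded; $(f\star g,h)=(g,\bar f\star h)$ and $(g\star f,h)=(g,h\star\bar f)$; $(f,g)=(\bar g,\bar f)$; and the linear span of $\mathcal L(M)\star\mathcal L(M)$ is dense in $\mathcal L(M)$. -/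

import Mathlib

open scoped Manifold ContDiff NNReal ENNReal
open MeasureTheory Filter Topology

noncomputable section

namespace LieStar

/-! Throughout, `G` is a Lie group modelled on a finite dimensional real normed space `E`.  In
Mathlib the Lie algebra `GroupLieAlgebra 𝓘(ℝ, E) G = TangentSpace 𝓘(ℝ, E) (1 : G)` is a type
synonym of `E`, so elements of the Lie algebra are written `X : E`, elements of its dual
`p : E →L[ℝ] ℝ`, and the phase space is `M = G × (E →L[ℝ] ℝ)`. The Lie bracket and everything
built from it comes from the group structure of `G`. -/

section LieGroupBasics

variable {E : Type*} [NormedAddCommGroup E] [NormedSpace ℝ E]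
variable (G : Type*) [TopologicalSpace G] [ChartedSpace E G] [Group G]

open Classical in
/-- The exponential map: `exp X = γ 1`, where `γ` is the integral curve of the left invariant
vector field of `X` with `γ 0 = 1`. -/
def lieExp (X : E) : G :=
  if h : ∃ γ : ℝ → G, γ 0 = 1 ∧
      IsMIntegralCurve (I := 𝓘(ℝ, E)) γ
        (mulInvariantVectorField (I := 𝓘(ℝ, E)) (G := G) X)
  then h.choose 1 else 1

/-- `Ad_q`, the derivative at the unit element of `h ↦ q h q⁻¹`. -/
def Ad {G : Type*} [TopologicalSpace G] [ChartedSpace E G] [Group G] (q : G) : E →L[ℝ] E :=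
  mfderiv 𝓘(ℝ, E) 𝓘(ℝ, E) (fun h : G => q * h * q⁻¹) 1

/-- `ad_X Y = [X, Y]`. -/
def ad [FiniteDimensional ℝ E] [LieGroup 𝓘(ℝ, E) ∞ G] (X : E) : E →L[ℝ] E :=
  haveI : CompleteSpace E := FiniteDimensional.complete ℝ E
  haveI : LieGroup 𝓘(ℝ, E) (minSmoothness ℝ 3) G :=
    LieGroup.of_le (n := ∞) (by
      rw [minSmoothness_of_isRCLikeNormedField]; exact ENat.LEInfty.out)
  LinearMap.toContinuousLinearMap (E := E) (F' := E)
    (LieAlgebra.ad ℝ (GroupLieAlgebra 𝓘(ℝ, E) G) X : E →ₗ[ℝ] E)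

/-- `φ(A) = ∑ (-1)ⁿ / (n+1)! Aⁿ`, i.e. `φ(x) = (1 - e⁻ˣ) / x`. -/
def phi (A : E →L[ℝ] E) : E →L[ℝ] E :=
  ∑' n : ℕ, ((-1 : ℝ) ^ n / ((n + 1).factorial : ℝ)) • A ^ n

/-- `F(X) = √|det φ(ad_X) · det Ad_{exp(X/2)}|`. -/
def F [FiniteDimensional ℝ E] [LieGroup 𝓘(ℝ, E) ∞ G] (X : E) : ℝ :=
  √|(phi (ad G X)).det * (Ad (E := E) (lieExp G ((1 / 2 : ℝ) • X))).det|

/-- `G` is weakly exponential with respect to the neighbourhood `O` of `0` in its Lie algebra, and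
`exp⁻¹ : U → O` maps precompact sets to precompact sets. Here `U = lieExp G '' O`. -/
structure IsWeaklyExponential [MeasurableSpace G] (m : Measure G) (O : Set E) : Prop where
  isOpen : IsOpen O
  zero_mem : (0 : E) ∈ O
  smul_mem : ∀ X ∈ O, ∀ t ∈ Set.Icc (-1 : ℝ) 1, t • X ∈ O
  injOn : Set.InjOn (lieExp G) O
  isOpen_image : IsOpen (lieExp G '' O)
  contMDiffOn : ContMDiffOn 𝓘(ℝ, E) 𝓘(ℝ, E) ∞ (lieExp G) O
  contMDiffOn_inv :
    ContMDiffOn 𝓘(ℝ, E) 𝓘(ℝ, E) ∞ (Function.invFunOn (lieExp G) O) (lieExp G '' O)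
  null_compl : m (lieExp G '' O)ᶜ = 0
  precompact : ∀ S : Set G, S ⊆ lieExp G '' O → IsCompact (closure S) →
    IsCompact (closure (Function.invFunOn (lieExp G) O '' S))

variable {G}

/-- `exp⁻¹ : U → O`. -/
def lieLog (O : Set E) (a : G) : E := Function.invFunOn (lieExp G) O a

/-- `V_a(b) = exp⁻¹(a⁻¹ b)`. -/
def V (O : Set E) (a b : G) : E := lieLog O (a⁻¹ * b)

variable (G)

/-- The Baker-Campbell-Hausdorff product `X ⋄ Y = exp⁻¹(exp X exp Y)`. -/
def bch (O : Set E) (X Y : E) : E := lieLog O (lieExp G X * lieExp G Y)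

open Classical in
/-- `L(X, Y) = F(X) F(Y) / F(X ⋄ Y)` for `X, Y ∈ O` with `exp X exp Y ∈ U`, and `0` otherwise. -/
def L [FiniteDimensional ℝ E] [LieGroup 𝓘(ℝ, E) ∞ G] (O : Set E) (X Y : E) : ℝ :=
  if X ∈ O ∧ Y ∈ O ∧ lieExp G X * lieExp G Y ∈ lieExp G '' O then
    F G X * F G Y / F G (bch G O X Y)
  else 0

end LieGroupBasics

section Measures

variable {E : Type*} [NormedAddCommGroup E] [NormedSpace ℝ E] [FiniteDimensional ℝ E]
  [MeasurableSpace E] [BorelSpace E]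
variable {G : Type*} [TopologicalSpace G] [ChartedSpace E G] [Group G] [MeasurableSpace G]

variable (E) in
/-- The dual of the reference basis `Module.finBasis ℝ E`. -/
def dualBasis : Module.Basis (Fin (Module.finrank ℝ E)) ℝ (E →L[ℝ] ℝ) :=
  (Module.finBasis ℝ E).dualBasis.map
    (LinearMap.toContinuousLinearMap : (E →ₗ[ℝ] ℝ) ≃ₗ[ℝ] (E →L[ℝ] ℝ))

variable (E) in
/-- The value at the unit element of the density of `m` with respect to the Lebesgue measure for
which the reference basis of the Lie algebra spans a parallelepiped of volume one. -/
def density (m : Measure G) : ℝ≥0 :=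
  Real.toNNReal (limUnder (𝓝[>] (0 : ℝ)) fun r : ℝ =>
    (m (lieExp G '' Metric.ball (0 : E) r)).toReal /
      ((Module.finBasis ℝ E).addHaar (Metric.ball (0 : E) r)).toReal)

variable (E) in
/-- The Lebesgue measure `dX` on the Lie algebra induced by the Haar measure `m`: if `m` is the
measure of the left invariant volume form `ω`, then `dX` is the measure of `ω(e)`. -/
def measX (m : Measure G) : Measure E := density E m • (Module.finBasis ℝ E).addHaar

variable (E) in
/-- The measure `dp` on the dual of the Lie algebra which is dual to `dX`: the parallelepipeds
of a basis and of its dual basis have reciprocal volumes. -/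
def measP (m : Measure G) : Measure (E →L[ℝ] ℝ) := (density E m)⁻¹ • (dualBasis E).addHaar

instance (m : Measure G) : IsFiniteMeasureOnCompacts (measX E m) := by
  unfold measX; infer_instance

instance (m : Measure G) : SFinite (measX E m) := by
  unfold measX; infer_instance

instance (m : Measure G) : SFinite (measP E m) := by
  unfold measP; infer_instance

variable (E) in
/-- The measure `dn = dm × dX` on `G × 𝔤`. -/
def measN (m : Measure G) : Measure (G × E) := m.prod (measX E m)

variable (E) in
/-- The normalized Liouville measure `dl = |2πħ|⁻ⁿ dm × dp` on `M = G × 𝔤*`. -/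
def measL (ħ : ℝ) (m : Measure G) : Measure (G × (E →L[ℝ] ℝ)) :=
  ENNReal.ofReal ((|2 * Real.pi * ħ| ^ Module.finrank ℝ E)⁻¹) • m.prod (measP E m)

/-- The inverse Fourier transform in the momentum variable,
`f(q, p) = ∫ f̃(q, X) e^{-i⟨p, X⟩/ħ} dX`. -/
def invFourier (ħ : ℝ) (m : Measure G) (φ : G × E → ℂ) (x : G × (E →L[ℝ] ℝ)) : ℂ :=
  ∫ X, φ (x.1, X) * Complex.exp (-(Complex.I / (ħ : ℂ)) * ((x.2 X : ℝ) : ℂ)) ∂(measX E m)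

/-- The restriction of `φ` to `G × {|X| ≤ R}`, extended by zero. -/
def trunc (R : ℝ) (φ : G × E → ℂ) : G × E → ℂ :=
  (Set.univ ×ˢ Metric.closedBall (0 : E) R).indicator φ

/-- `f` is the inverse momentum Fourier transform of `φ` in the `L²` (Plancherel) sense: it is the
limit in the mean of the integrals over `{|X| ≤ R}` as `R → ∞`. -/
def IsInvFourierL2 (ħ : ℝ) (m : Measure G) (φ : G × E → ℂ) (f : G × (E →L[ℝ] ℝ) → ℂ) : Prop :=
  Tendsto (fun R : ℝ => eLpNorm (f - invFourier ħ m (trunc R φ)) 2 (measL E ħ m)) atTop (𝓝 0)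

end Measures

section Spaces

variable {E : Type*} [NormedAddCommGroup E] [NormedSpace ℝ E] [FiniteDimensional ℝ E]
  [MeasurableSpace E] [BorelSpace E]
variable {G : Type*} [TopologicalSpace G] [ChartedSpace E G] [Group G]
  [LieGroup 𝓘(ℝ, E) ∞ G] [MeasurableSpace G]

/-- The space `F̃(M)`: square integrable functions on `G × 𝔤`, vanishing outside `G × O`, for which
`(a, b) ↦ f̃(a exp(V_a(b)/2), V_a(b)) F(V_a(b))⁻¹`, defined for `a⁻¹ b ∈ U`, extends to a smooth
compactly supported function on `G × G`. -/
def FTilde (m : Measure G) (O : Set E) : Set (G × E → ℂ) :=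
  {φ | MemLp φ 2 (measN E m) ∧ (∀ q X, X ∉ O → φ (q, X) = 0) ∧
    ∃ k : G × G → ℂ, ContMDiff (𝓘(ℝ, E).prod 𝓘(ℝ, E)) 𝓘(ℝ, ℂ) ∞ k ∧ HasCompactSupport k ∧
      ∀ a b : G, a⁻¹ * b ∈ lieExp G '' O →
        k (a, b) = φ (a * lieExp G ((1 / 2 : ℝ) • V O a b), V O a b) *
          ((F G (V O a b) : ℝ) : ℂ)⁻¹}

/-- The space `F(M)`: the inverse momentum Fourier transforms of the elements of `F̃(M)`. -/
def FSpace (ħ : ℝ) (m : Measure G) (O : Set E) : Set (G × (E →L[ℝ] ℝ) → ℂ) :=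
  invFourier ħ m '' FTilde m O

/-- For `f ∈ F(M)`, its momentum Fourier transform: the element `f̃` of `F̃(M)` whose inverse
momentum Fourier transform is `f`. -/
def fourier (ħ : ℝ) (m : Measure G) (O : Set E) (f : G × (E →L[ℝ] ℝ) → ℂ) : G × E → ℂ :=
  Function.invFunOn (invFourier ħ m) (FTilde m O) f

/-- The star-product on `F(M)`. -/
def starProd (ħ : ℝ) (m : Measure G) (O : Set E) (f g : G × (E →L[ℝ] ℝ) → ℂ)
    (x : G × (E →L[ℝ] ℝ)) : ℂ :=
  ∫ Z : E × E,
    fourier ħ m O f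
        (x.1 * lieExp G (-(1 / 2 : ℝ) • bch G O Z.1 Z.2) * lieExp G ((1 / 2 : ℝ) • Z.1), Z.1) *
      fourier ħ m O g
        (x.1 * lieExp G ((1 / 2 : ℝ) • bch G O Z.1 Z.2) * lieExp G (-(1 / 2 : ℝ) • Z.2), Z.2) *
      Complex.exp (-(Complex.I / (ħ : ℂ)) * ((x.2 (bch G O Z.1 Z.2) : ℝ) : ℂ)) *
      ((L G O Z.1 Z.2 : ℝ) : ℂ)
    ∂((measX E m).prod (measX E m))

end Spaces

section LSpace

variable {E : Type*} [NormedAddCommGroup E] [NormedSpace ℝ E] [FiniteDimensional ℝ E]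
  [MeasurableSpace E] [BorelSpace E]
variable {G : Type*} [TopologicalSpace G] [ChartedSpace E G] [Group G] [MeasurableSpace G]

/-- Square integrable functions have, for almost every `q`, integrable truncated slices. -/
lemma ae_integrable_slice (m : Measure G) [SFinite m] {φ : G × E → ℂ}
    (hφ : MemLp φ 2 (measN E m)) (R : ℝ) :
    ∀ᵐ q ∂m, Integrable (fun X => trunc R φ (q, X)) (measX E m) := by
  have h1 : Integrable (fun x => ‖φ x‖ ^ 2) (m.prod (measX E m)) := hφ.integrable_norm_pow (by simp)
  have h2 := h1.prod_right_ae
  have h3 := hφ.1.prodMk_left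
  filter_upwards [h2, h3] with q hq hm
  have hm2 : MemLp (fun X => φ (q, X)) 2 (measX E m) :=
    (memLp_two_iff_integrable_sq_norm hm).2 hq
  have : (fun X => trunc R φ (q, X)) =
      (Metric.closedBall (0 : E) R).indicator fun X => φ (q, X) := by
    ext X
    by_cases hX : X ∈ Metric.closedBall (0 : E) R
    · rw [Set.indicator_of_mem hX, trunc, Set.indicator_of_mem (by simpa using hX)]
    · rw [Set.indicator_of_notMem hX, trunc, Set.indicator_of_notMem (by simpa using hX)]
  rw [this, integrable_indicator_iff Metric.isClosed_closedBall.measurableSet]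
  have : IsFiniteMeasure ((measX E m).restrict (Metric.closedBall (0 : E) R)) :=
    ⟨by simpa using (isCompact_closedBall (0 : E) R).measure_lt_top⟩
  exact (hm2.restrict _).integrable (by norm_num)

lemma norm_phase (ħ t : ℝ) : ‖Complex.exp (-(Complex.I / (ħ : ℂ)) * (t : ℂ))‖ = 1 := by
  have : -(Complex.I / (ħ : ℂ)) * (t : ℂ) = ((-(t / ħ) : ℝ) : ℂ) * Complex.I := by
    push_cast; ring
  rw [this, Complex.norm_exp_ofReal_mul_I]

lemma integrable_mul_phase (ħ : ℝ) (μ : Measure E) (p : E →L[ℝ] ℝ) {u : E → ℂ}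
    (hu : Integrable u μ) :
    Integrable (fun X => u X * Complex.exp (-(Complex.I / (ħ : ℂ)) * ((p X : ℝ) : ℂ))) μ := by
  refine hu.mul_bdd (c := 1) ?_ (Eventually.of_forall fun X => (norm_phase ħ (p X)).le)
  exact Continuous.aestronglyMeasurable (by fun_prop)

lemma aestronglyMeasurable_invFourier (ħ : ℝ) (m : Measure G) [SFinite m] {φ : G × E → ℂ}
    (hφ : MemLp φ 2 (measN E m)) (R : ℝ) :
    AEStronglyMeasurable (invFourier ħ m (trunc R φ)) (measL E ħ m) := by
  have h1 : AEStronglyMeasurable (trunc R φ) (m.prod (measX E m)) :=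
    hφ.1.indicator (MeasurableSet.univ.prod Metric.isClosed_closedBall.measurableSet)
  have h2 : AEStronglyMeasurable (fun y : (G × (E →L[ℝ] ℝ)) × E => trunc R φ (y.1.1, y.2))
      ((m.prod (measP E m)).prod (measX E m)) := by
    refine h1.comp_quasiMeasurePreserving (f := fun y : (G × (E →L[ℝ] ℝ)) × E => (y.1.1, y.2)) ?_
    exact QuasiMeasurePreserving.prodMap Measure.quasiMeasurePreserving_fst
      (Measure.QuasiMeasurePreserving.id _)
  have h3 : AEStronglyMeasurable (fun y : (G × (E →L[ℝ] ℝ)) × E =>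
      Complex.exp (-(Complex.I / (ħ : ℂ)) * ((y.1.2 y.2 : ℝ) : ℂ)))
      ((m.prod (measP E m)).prod (measX E m)) := by
    have : Continuous fun z : (E →L[ℝ] ℝ) × E =>
        Complex.exp (-(Complex.I / (ħ : ℂ)) * ((z.1 z.2 : ℝ) : ℂ)) := by fun_prop
    exact (this.measurable.comp (measurable_snd.comp measurable_fst |>.prodMk
      measurable_snd)).aestronglyMeasurable
  exact ((h2.mul h3).integral_prod_right').smul_measure _

lemma invFourier_add (ħ : ℝ) (m : Measure G) [SFinite m] {φ ψ : G × E → ℂ}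
    (hφ : MemLp φ 2 (measN E m)) (hψ : MemLp ψ 2 (measN E m)) (R : ℝ) :
    invFourier ħ m (trunc R (φ + ψ)) =ᵐ[measL E ħ m]
      invFourier ħ m (trunc R φ) + invFourier ħ m (trunc R ψ) := by
  refine Measure.ae_smul_measure ?_ _
  have h := (ae_integrable_slice m hφ R).and (ae_integrable_slice m hψ R)
  have h' := (Measure.quasiMeasurePreserving_fst (μ := m) (ν := measP E m)).ae h
  filter_upwards [h'] with x hx
  simp only [invFourier, Pi.add_apply]
  rw [← integral_add (integrable_mul_phase ħ _ x.2 hx.1) (integrable_mul_phase ħ _ x.2 hx.2)]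
  congr 1
  ext X
  simp only [trunc, Set.indicator_add', Pi.add_apply]
  ring

lemma invFourier_smul (ħ : ℝ) (m : Measure G) (c : ℂ) (φ : G × E → ℂ) (R : ℝ) :
    invFourier ħ m (trunc R (c • φ)) = c • invFourier ħ m (trunc R φ) := by
  ext x
  simp only [invFourier, Pi.smul_apply, smul_eq_mul]
  rw [← integral_const_mul]
  congr 1
  ext X
  have : trunc R (c • φ) (x.1, X) = c * trunc R φ (x.1, X) :=
    Set.indicator_const_smul_apply _ c φ _
  rw [this, mul_assoc]

/-- The space `𝓛(M)`, a subspace of `L²(M, dl)`: the image of `L²(G × O, dn)` under the inverse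
momentum Fourier transform. -/
def LSpace (ħ : ℝ) (m : Measure G) [SFinite m] (O : Set E) :
    Submodule ℂ (Lp ℂ 2 (measL E ħ m)) where
  carrier := {f | ∃ φ : G × E → ℂ, MemLp φ 2 (measN E m) ∧ (∀ q X, X ∉ O → φ (q, X) = 0) ∧
    IsInvFourierL2 ħ m φ f}
  zero_mem' := by
    refine ⟨0, MemLp.zero, fun _ _ _ => rfl, ?_⟩
    refine tendsto_const_nhds.congr fun R => ?_
    have : invFourier ħ m (trunc R (0 : G × E → ℂ)) = 0 := by
      ext x; simp [invFourier, trunc]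
    rw [this, sub_zero, eLpNorm_congr_ae (Lp.coeFn_zero _ _ _), eLpNorm_zero]
  add_mem' := by
    rintro f g ⟨φ, hφ, hφ0, hf⟩ ⟨ψ, hψ, hψ0, hg⟩
    refine ⟨φ + ψ, hφ.add hψ, fun q X hX => by simp [hφ0 q X hX, hψ0 q X hX], ?_⟩
    have hlim := hf.add hg
    rw [add_zero] at hlim
    refine tendsto_of_tendsto_of_tendsto_of_le_of_le tendsto_const_nhds hlim
      (fun _ => zero_le) fun R => ?_
    have h1 : (↑(f + g) - invFourier ħ m (trunc R (φ + ψ)) : G × (E →L[ℝ] ℝ) → ℂ)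
        =ᵐ[measL E ħ m] (f - invFourier ħ m (trunc R φ)) + (g - invFourier ħ m (trunc R ψ)) := by
      filter_upwards [Lp.coeFn_add f g, invFourier_add ħ m hφ hψ R] with x h1 h2
      simp only [Pi.sub_apply, Pi.add_apply] at h1 h2 ⊢
      rw [h1, h2]; ring
    dsimp only
    rw [eLpNorm_congr_ae h1]
    exact eLpNorm_add_le ((Lp.aestronglyMeasurable f).sub (aestronglyMeasurable_invFourier ħ m hφ R))
      ((Lp.aestronglyMeasurable g).sub (aestronglyMeasurable_invFourier ħ m hψ R)) (by norm_num)
  smul_mem' := by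
    rintro c f ⟨φ, hφ, hφ0, hf⟩
    refine ⟨c • φ, hφ.const_smul c, fun q X hX => by simp [hφ0 q X hX], ?_⟩
    have hlim := ENNReal.Tendsto.const_mul (a := ‖c‖ₑ) hf (Or.inr (by simp))
    rw [mul_zero] at hlim
    refine hlim.congr fun R => ?_
    rw [← eLpNorm_const_smul, invFourier_smul]
    refine eLpNorm_congr_ae ?_
    filter_upwards [Lp.coeFn_smul c f] with x hx
    simp only [Pi.sub_apply, Pi.smul_apply, hx, smul_sub]

end LSpace

/-- A Hilbert algebra with multiplication `mul` and involution `conj` on an inner product space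
(the inner product is conjugate linear in its first argument). -/
structure IsHilbertAlgebra {H : Type*} [NormedAddCommGroup H] [InnerProductSpace ℂ H]
    (mul : H →ₗ[ℂ] H →ₗ[ℂ] H) (conj : H → H) : Prop where
  mul_assoc : ∀ f g h, mul (mul f g) h = mul f (mul g h)
  conj_add : ∀ f g, conj (f + g) = conj f + conj g
  conj_smul : ∀ (c : ℂ) f, conj (c • f) = (starRingEnd ℂ c) • conj f
  conj_conj : ∀ f, conj (conj f) = f
  conj_mul : ∀ f g, conj (mul f g) = mul (conj g) (conj f)
  bounded_left : ∀ f, ∃ C : ℝ, ∀ g, ‖mul f g‖ ≤ C * ‖g‖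
  bounded_right : ∀ f, ∃ C : ℝ, ∀ g, ‖mul g f‖ ≤ C * ‖g‖
  inner_mul_left : ∀ f g h, inner ℂ (mul f g) h = inner ℂ g (mul (conj f) h)
  inner_mul_right : ∀ f g h, inner ℂ (mul g f) h = inner ℂ g (mul h (conj f))
  inner_conj : ∀ f g, inner ℂ f g = inner ℂ (conj g) (conj f)
  dense_mul : Dense (Submodule.span ℂ {h : H | ∃ f g, h = mul f g} : Set H)

end LieStar

end

set_option linter.unusedSectionVars false

/-! The star-product is composition of integral kernels in disguise. A kernel `k` on `G × G` has the
symbol `F(X) k(q exp(-X/2), q exp(X/2))` on `G × O`, and the inverse Fourier transform in `X` makes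
it a function on `M`. Writing `b = a exp X` and moving the base point to the midpoint `q` between
`a` and `b` turns `dm(a) dm(b)` into `ρ(X) δ(exp(X/2)) dm(q) dX = F(X)² dn`, where `ρ = |det φ(ad)|`
is the Haar density in exponential coordinates and `δ = |det Ad|` is the modular function. Since the
complement of `exp O` is null, the symbol map is an isometry of `L²(G × G)` onto `L²(G × O, dn)`
(`lintegral_prod_eq`, `exists_symbol_eq`), and Plancherel carries the latter isometrically onto
`LSpace` (`exists_isInvFourierL2`). The composite is `weylEquiv`.

Under this correspondence the smooth compactly supported kernels are exactly the elements of
`FSpace` (`mem_FSpace_iff`), the star-product is composition of kernels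
(`starProd_invFourier_symbol`), the weight `L` being what the two changes of variables require, and
complex conjugation is the adjoint kernel because `F` is even (`weylIsometry_kconj`). The assertions
then concern Hilbert-Schmidt kernels: the inequality is Cauchy-Schwarz (`eLpNorm_kcomp_le`),
associativity and the adjoint relations are Fubini (`integral_mul_integral_swap`), density of the
products comes from indicators of rectangles (`dense_kmul`), and test kernels are dense and closed
under composition (`dense_testKernels`, `isTestKernel_kcomp`).

What remains is Lie theory: an abstract Haar measure must be shown to be `ρ(X) dX` in exponential
coordinates. The left trivialized derivative of `exp` is `φ(dAd)` (`dExp_eq_phi_dAd`), and `dAd` is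
the Lie bracket of left invariant fields (`bracket_eq_dAd`). Hence `ρ(X) dX` is left invariant as
far as the chart permits (`setLIntegral_expMeasure_mul_left`), and the Fubini argument for
uniqueness of Haar measure identifies it with `m` up to a constant
(`lintegral_expMeasure_mul_measure`). Comparing small balls shows that the constant is `density`
(`coe_density`) and that the modular character is `|det Ad|` (`modularCharacterFun_eq_delta`). -/

namespace LieStar

/-! ### Derivatives of maps between manifolds, as operators between the model spaces -/

section HasD

variable {E₁ E₂ E₃ : Type*} [NormedAddCommGroup E₁] [NormedSpace ℝ E₁]
  [NormedAddCommGroup E₂] [NormedSpace ℝ E₂] [NormedAddCommGroup E₃] [NormedSpace ℝ E₃]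
  {M₁ M₂ M₃ : Type*} [TopologicalSpace M₁] [ChartedSpace E₁ M₁]
  [TopologicalSpace M₂] [ChartedSpace E₂ M₂] [TopologicalSpace M₃] [ChartedSpace E₃ M₃]

/-- `HasMFDerivAt` for manifolds modelled on normed spaces, the derivative being regarded as a
continuous linear map between the model spaces. -/
def HasD (f : M₁ → M₂) (x : M₁) (A : E₁ →L[ℝ] E₂) : Prop :=
  HasMFDerivAt 𝓘(ℝ, E₁) 𝓘(ℝ, E₂) f x A

lemma HasD.comp {g : M₂ → M₃} {f : M₁ → M₂} {x : M₁} {y : M₂} {B : E₂ →L[ℝ] E₃}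
    {A : E₁ →L[ℝ] E₂} (hg : HasD g y B) (hf : HasD f x A) (hy : f x = y) :
    HasD (g ∘ f) x (B ∘L A) := by
  subst hy
  exact HasMFDerivAt.comp x hg hf

lemma HasD.comp_curve {g : M₂ → M₃} {γ : ℝ → M₂} {t : ℝ} {y : M₂} {B : E₂ →L[ℝ] E₃} {v : E₂}
    (hg : HasD g y B) (hf : HasD γ t ((1 : ℝ →L[ℝ] ℝ).smulRight v)) (hy : γ t = y) :
    HasD (fun s => g (γ s)) t ((1 : ℝ →L[ℝ] ℝ).smulRight (B v)) := by
  have h := hg.comp hf hy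
  have h2 : B ∘L (1 : ℝ →L[ℝ] ℝ).smulRight v = (1 : ℝ →L[ℝ] ℝ).smulRight (B v) :=
    ContinuousLinearMap.ext_ring (by simp)
  rwa [h2] at h

lemma HasD.unique {f : M₁ → M₂} {x : M₁} {A B : E₁ →L[ℝ] E₂} (h : HasD f x A) (h' : HasD f x B) :
    A = B :=
  hasMFDerivAt_unique h h'

lemma HasD.congr {f g : M₁ → M₂} {x : M₁} {A : E₁ →L[ℝ] E₂} (h : HasD f x A) (h' : g =ᶠ[𝓝 x] f) :
    HasD g x A :=
  HasMFDerivAt.congr_of_eventuallyEq h h'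

lemma hasD_id (x : M₁) : HasD (fun y => y) x (ContinuousLinearMap.id ℝ E₁) :=
  hasMFDerivAt_id x

lemma hasD_const (c : M₂) (x : M₁) : HasD (fun _ => c) x (0 : E₁ →L[ℝ] E₂) :=
  hasMFDerivAt_const c x

lemma hasD_iff_hasFDerivAt {f : E₁ → E₂} {x : E₁} {A : E₁ →L[ℝ] E₂} :
    HasD f x A ↔ HasFDerivAt f A x :=
  hasMFDerivAt_iff_hasFDerivAt

/-- `mfderiv` as a continuous linear map between the model spaces. -/
noncomputable def mder (f : M₁ → M₂) (x : M₁) : E₁ →L[ℝ] E₂ := mfderiv 𝓘(ℝ, E₁) 𝓘(ℝ, E₂) f x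

lemma hasD_mder {f : M₁ → M₂} {x : M₁} (h : MDifferentiableAt 𝓘(ℝ, E₁) 𝓘(ℝ, E₂) f x) :
    HasD f x (mder f x : E₁ →L[ℝ] E₂) :=
  h.hasMFDerivAt

end HasD

/-! ### One-parameter subgroups and the global exponential map -/

section Exponential

variable {E : Type*} [NormedAddCommGroup E] [NormedSpace ℝ E]
variable {G : Type*} [TopologicalSpace G] [ChartedSpace E G] [Group G]

section

variable [LieGroup 𝓘(ℝ, E) ∞ G]

lemma lieGroup_minSmoothness : LieGroup 𝓘(ℝ, E) (minSmoothness ℝ 3) G :=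
  LieGroup.of_le (n := ∞) (by
    rw [minSmoothness_of_isRCLikeNormedField]; exact ENat.LEInfty.out)

lemma contMDiff_leftInvariant (X : E) :
    ContMDiff 𝓘(ℝ, E) 𝓘(ℝ, E).tangent 1 (fun g : G =>
      (⟨g, mulInvariantVectorField (I := 𝓘(ℝ, E)) (G := G) X g⟩ : TangentBundle 𝓘(ℝ, E) G)) := by
  have := lieGroup_minSmoothness (E := E) (G := G)
  refine (contMDiff_mulInvariantVectorField (I := 𝓘(ℝ, E)) (G := G) X).of_le ?_
  rw [minSmoothness_of_isRCLikeNormedField]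
  norm_num

lemma contMDiff_mul_left' (g : G) : ContMDiff 𝓘(ℝ, E) 𝓘(ℝ, E) ∞ (fun h : G => g * h) :=
  contMDiff_mul_left

lemma contMDiff_mul_right' (g : G) : ContMDiff 𝓘(ℝ, E) 𝓘(ℝ, E) ∞ (fun h : G => h * g) :=
  contMDiff_mul_right

lemma mdifferentiable_mul_left (g : G) : MDifferentiable 𝓘(ℝ, E) 𝓘(ℝ, E) (fun h : G => g * h) :=
  (contMDiff_mul_left' g).mdifferentiable (by simp)

/-- The derivative of left translation by `g` at the unit element. -/
noncomputable def dMulLeft (g : G) : E →L[ℝ] E := mder (fun h : G => g * h) 1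

lemma hasD_mul_left (g : G) : HasD (fun h : G => g * h) 1 (dMulLeft (E := E) g) :=
  (mdifferentiable_mul_left g 1).hasMFDerivAt

lemma hasD_mul_left_mul (g h : G) :
    HasD (fun x : G => g * x) h
      (mder (fun x : G => g * x) h : E →L[ℝ] E) :=
  hasD_mder (mdifferentiable_mul_left g h)

lemma dMulLeft_mul (g h : G) :
    dMulLeft (E := E) (g * h) =
      (mder (fun x : G => g * x) h : E →L[ℝ] E) ∘L dMulLeft h := by
  refine (hasD_mul_left (g * h)).unique ?_
  simpa only [Function.comp_def, mul_assoc] using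
    (hasD_mul_left_mul (E := E) g h).comp (hasD_mul_left (E := E) h) (mul_one h)

@[simp] lemma dMulLeft_one : dMulLeft (E := E) (1 : G) = ContinuousLinearMap.id ℝ E := by
  refine (hasD_mul_left (1 : G)).unique ?_
  simpa only [one_mul] using hasD_id (1 : G)

/-- By definition, the left invariant field at `g` is the derivative of left translation by `g`
applied to its value at the unit element. -/
lemma hasD_curve_iff {γ : ℝ → G} {X : E} {t : ℝ} :
    HasMFDerivAt 𝓘(ℝ, ℝ) 𝓘(ℝ, E) γ t ((1 : ℝ →L[ℝ] ℝ).smulRight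
      (mulInvariantVectorField (I := 𝓘(ℝ, E)) (G := G) X (γ t))) ↔
    HasD γ t ((1 : ℝ →L[ℝ] ℝ).smulRight (dMulLeft (γ t) X)) := Iff.rfl

lemma isMIntegralCurve_mul_left {γ : ℝ → G} {X : E}
    (hγ : IsMIntegralCurve γ (mulInvariantVectorField (I := 𝓘(ℝ, E)) (G := G) X)) (g : G) :
    IsMIntegralCurve (fun t => g * γ t) (mulInvariantVectorField (I := 𝓘(ℝ, E)) (G := G) X) := by
  intro t
  refine hasD_curve_iff.2 ?_
  rw [dMulLeft_mul]
  exact (hasD_mul_left_mul (E := E) g (γ t)).comp_curve (hasD_curve_iff.1 (hγ t)) rfl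

lemma isMIntegralCurveOn_mul_left {γ : ℝ → G} {X : E} {s : Set ℝ} (hs : IsOpen s)
    (hγ : IsMIntegralCurveOn γ (mulInvariantVectorField (I := 𝓘(ℝ, E)) (G := G) X) s) (g : G) :
    IsMIntegralCurveOn (fun t => g * γ t)
      (mulInvariantVectorField (I := 𝓘(ℝ, E)) (G := G) X) s := by
  intro t ht
  refine HasMFDerivAt.hasMFDerivWithinAt (hasD_curve_iff.2 ?_)
  rw [dMulLeft_mul]
  exact (hasD_mul_left_mul (E := E) g (γ t)).comp_curve
    (hasD_curve_iff.1 ((hγ t ht).hasMFDerivAt (hs.mem_nhds ht))) rfl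

variable [FiniteDimensional ℝ E] [T2Space G]

/-- Left translates of one local integral curve through `1` give curves through every point with the
same existence time `ε`, and a uniform existence time implies completeness of the field. -/
lemma exists_isMIntegralCurve_leftInvariant (X : E) : ∃ γ : ℝ → G, γ 0 = 1 ∧
    IsMIntegralCurve γ (mulInvariantVectorField (I := 𝓘(ℝ, E)) (G := G) X) := by
  have : CompleteSpace E := FiniteDimensional.complete ℝ E
  have : IsManifold 𝓘(ℝ, E) ∞ G := inferInstance
  have : IsManifold 𝓘(ℝ, E) 1 G := IsManifold.of_le (n := ∞) (by simp)
  obtain ⟨γ, h0, h1⟩ := exists_isMIntegralCurveAt_of_contMDiffAt_boundaryless (t₀ := 0)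
    ((contMDiff_leftInvariant (E := E) (G := G) X) 1)
  rw [isMIntegralCurveAt_iff'] at h1
  obtain ⟨ε, hε, h1⟩ := h1
  refine exists_isMIntegralCurve_of_isMIntegralCurveOn (contMDiff_leftInvariant X) hε
    (fun x => ⟨fun t => x * γ t, by simp [h0], ?_⟩) 1
  rw [Real.ball_eq_Ioo, zero_sub, zero_add] at h1
  exact isMIntegralCurveOn_mul_left isOpen_Ioo h1 x

lemma isMIntegralCurve_unique {X : E} {γ γ' : ℝ → G} {t₀ : ℝ}
    (h : IsMIntegralCurve γ (mulInvariantVectorField (I := 𝓘(ℝ, E)) (G := G) X))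
    (h' : IsMIntegralCurve γ' (mulInvariantVectorField (I := 𝓘(ℝ, E)) (G := G) X))
    (h0 : γ t₀ = γ' t₀) : γ = γ' := by
  have : CompleteSpace E := FiniteDimensional.complete ℝ E
  have : IsManifold 𝓘(ℝ, E) 1 G := IsManifold.of_le (n := ∞) (by simp)
  exact isMIntegralCurve_Ioo_eq_of_contMDiff_boundaryless (contMDiff_leftInvariant X) h h' h0

lemma lieExp_eq_of_isMIntegralCurve {X : E} {γ : ℝ → G} (h0 : γ 0 = 1)
    (h : IsMIntegralCurve γ (mulInvariantVectorField (I := 𝓘(ℝ, E)) (G := G) X)) :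
    lieExp G X = γ 1 := by
  have hex : ∃ γ : ℝ → G, γ 0 = 1 ∧
      IsMIntegralCurve γ (mulInvariantVectorField (I := 𝓘(ℝ, E)) (G := G) X) := ⟨γ, h0, h⟩
  rw [lieExp, dif_pos hex]
  rw [isMIntegralCurve_unique (t₀ := 0) hex.choose_spec.2 h (by rw [hex.choose_spec.1, h0])]

lemma leftInvariant_smul (c : ℝ) (X : E) :
    mulInvariantVectorField (I := 𝓘(ℝ, E)) (G := G) (c • X : E) =
      c • mulInvariantVectorField (I := 𝓘(ℝ, E)) (G := G) X := by
  have := lieGroup_minSmoothness (E := E) (G := G)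
  exact mulInvariantVectorField_smul c X

lemma lieExp_smul_eq {X : E} {γ : ℝ → G} (h0 : γ 0 = 1)
    (h : IsMIntegralCurve γ (mulInvariantVectorField (I := 𝓘(ℝ, E)) (G := G) X)) (t : ℝ) :
    lieExp G (t • X) = γ t := by
  rw [lieExp_eq_of_isMIntegralCurve (γ := γ ∘ (· * t)) (X := t • X) (by simp [h0])]
  · simp
  · have := h.comp_mul t
    rw [leftInvariant_smul]
    exact this

lemma isMIntegralCurve_lieExp (X : E) :
    IsMIntegralCurve (fun t : ℝ => lieExp G (t • X))
      (mulInvariantVectorField (I := 𝓘(ℝ, E)) (G := G) X) := by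
  obtain ⟨γ, h0, h⟩ := exists_isMIntegralCurve_leftInvariant (G := G) X
  have : (fun t : ℝ => lieExp G (t • X)) = γ := funext (lieExp_smul_eq h0 h)
  rwa [this]

@[simp] lemma lieExp_zero : lieExp G (0 : E) = 1 := by
  obtain ⟨γ, h0, h⟩ := exists_isMIntegralCurve_leftInvariant (G := G) (0 : E)
  have := lieExp_smul_eq h0 h 0
  rwa [zero_smul, h0] at this

/-- As functions of `t` both sides are integral curves, one a time shift and the other a left
translate, and they agree at `t = 0`. -/
lemma lieExp_add_smul (X : E) (s t : ℝ) :
    lieExp G ((s + t) • X) = lieExp G (s • X) * lieExp G (t • X) := by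
  have h1 := isMIntegralCurve_mul_left (isMIntegralCurve_lieExp (G := G) X) (lieExp G (s • X))
  have h2 := (isMIntegralCurve_lieExp (G := G) X).comp_add s
  have := congrFun (isMIntegralCurve_unique (t₀ := 0) h2 h1 (by simp)) t
  simp only [Function.comp_apply] at this
  rw [← this, add_comm]

lemma lieExp_neg (X : E) : lieExp G (-X) = (lieExp G X)⁻¹ := by
  have := lieExp_add_smul (G := G) X (-1) 1
  simp only [neg_add_cancel, zero_smul, lieExp_zero, neg_smul, one_smul] at this
  exact eq_inv_of_mul_eq_one_left this.symm

lemma lieExp_half_mul_half (X : E) :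
    lieExp G ((1 / 2 : ℝ) • X) * lieExp G ((1 / 2 : ℝ) • X) = lieExp G X := by
  rw [← lieExp_add_smul]; norm_num

lemma hasD_lieExp_smul (X : E) (t : ℝ) :
    HasD (fun t : ℝ => lieExp G (t • X)) t
      ((1 : ℝ →L[ℝ] ℝ).smulRight (dMulLeft (lieExp G (t • X)) X)) :=
  isMIntegralCurve_lieExp (G := G) X t

lemma hasD_lieExp_smul_zero (X : E) :
    HasD (fun t : ℝ => lieExp G (t • X)) 0 ((1 : ℝ →L[ℝ] ℝ).smulRight X) := by
  simpa using hasD_lieExp_smul (G := G) X 0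

end

end Exponential

/-! ### The product rule at the unit element and the adjoint representation -/

section Adjoint

variable {E : Type*} [NormedAddCommGroup E] [NormedSpace ℝ E]
variable {G : Type*} [TopologicalSpace G] [ChartedSpace E G] [Group G] [LieGroup 𝓘(ℝ, E) ∞ G]

lemma HasD.mul_of_hasMFDerivAt {E' M : Type*} [NormedAddCommGroup E'] [NormedSpace ℝ E']
    [TopologicalSpace M] [ChartedSpace E' M] {C : (E × E) →L[ℝ] E}
    (hC : HasMFDerivAt (𝓘(ℝ, E).prod 𝓘(ℝ, E)) 𝓘(ℝ, E) (fun p : G × G => p.1 * p.2) (1, 1) C)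
    {f g : M → G} {x : M} {A B : E' →L[ℝ] E} (hf : HasD f x A)
    (hg : HasD g x B) (hfx : f x = 1) (hgx : g x = 1) :
    HasD (fun y => f y * g y) x (C ∘L (A.prod B)) := by
  have h2 : HasMFDerivAt 𝓘(ℝ, E') (𝓘(ℝ, E).prod 𝓘(ℝ, E)) (fun y => (f y, g y)) x (A.prod B) :=
    HasMFDerivAt.prodMk hf hg
  have h3 : ∀ p : G × G, p = (1, 1) →
      HasMFDerivAt (𝓘(ℝ, E).prod 𝓘(ℝ, E)) 𝓘(ℝ, E) (fun p : G × G => p.1 * p.2) p C := by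
    rintro _ rfl
    exact hC
  exact HasMFDerivAt.comp x (h3 _ (by simp [hfx, hgx])) h2

/-- Multiplication by `1` on either side is the identity, so the derivative `C` of the product at
`(1, 1)` is the identity on each factor; linearity makes it addition. -/
lemma HasD.mul {E' M : Type*} [NormedAddCommGroup E'] [NormedSpace ℝ E'] [TopologicalSpace M]
    [ChartedSpace E' M] {f g : M → G} {x : M} {A B : E' →L[ℝ] E} (hf : HasD f x A)
    (hg : HasD g x B) (hfx : f x = 1) (hgx : g x = 1) : HasD (fun y => f y * g y) x (A + B) := by
  have hm : MDifferentiableAt (𝓘(ℝ, E).prod 𝓘(ℝ, E)) 𝓘(ℝ, E) (fun p : G × G => p.1 * p.2) (1, 1) :=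
    (contMDiff_mul 𝓘(ℝ, E) ∞).mdifferentiableAt (by simp)
  obtain ⟨C, hC⟩ : ∃ C : (E × E) →L[ℝ] E, HasMFDerivAt (𝓘(ℝ, E).prod 𝓘(ℝ, E)) 𝓘(ℝ, E)
    (fun p : G × G => p.1 * p.2) (1, 1) C := ⟨_, hm.hasMFDerivAt⟩
  have h1 : ∀ u, C (u, 0) = u := by
    intro u
    have a := HasD.mul_of_hasMFDerivAt hC (hasD_id (1 : G))
      (hasD_const (1 : G) (1 : G) (E₂ := E) (E₁ := E)) rfl rfl
    simp only [mul_one] at a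
    simpa using congrArg (fun L => L u) (a.unique (hasD_id (1 : G)))
  have h2 : ∀ u, C (0, u) = u := by
    intro u
    have a := HasD.mul_of_hasMFDerivAt hC (hasD_const (1 : G) (1 : G) (E₂ := E) (E₁ := E))
      (hasD_id (1 : G)) rfl rfl
    simp only [one_mul] at a
    simpa using congrArg (fun L => L u) (a.unique (hasD_id (1 : G)))
  have h3 : C ∘L (A.prod B) = A + B := by
    ext v
    have : ((A v, B v) : E × E) = (A v, 0) + (0, B v) := by rw [Prod.mk_add_mk, add_zero, zero_add]
    rw [ContinuousLinearMap.comp_apply, ContinuousLinearMap.prod_apply, this, map_add, h1, h2,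
      add_apply]
  rw [← h3]
  exact HasD.mul_of_hasMFDerivAt hC hf hg hfx hgx

lemma hasD_conj (q : G) : HasD (fun h : G => q * h * q⁻¹) 1 (Ad (E := E) q) := by
  have : ContMDiff 𝓘(ℝ, E) 𝓘(ℝ, E) ∞ (fun h : G => q * h * q⁻¹) :=
    (contMDiff_mul_right' q⁻¹).comp (contMDiff_mul_left' q)
  exact (this.mdifferentiableAt (by simp)).hasMFDerivAt

lemma Ad_mul (g h : G) : Ad (E := E) (g * h) = Ad g ∘L Ad h := by
  refine (hasD_conj (g * h)).unique ?_
  have := (hasD_conj (E := E) g).comp (hasD_conj (E := E) h) (by simp)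
  simpa [Function.comp_def, mul_assoc] using this

@[simp] lemma Ad_one : Ad (E := E) (1 : G) = ContinuousLinearMap.id ℝ E := by
  refine (hasD_conj 1).unique ?_
  simpa using hasD_id (1 : G)

end Adjoint

/-! ### Exponential coordinates on `O` and the left trivialized derivative of `exp` -/

section Exponential

variable {E : Type*} [NormedAddCommGroup E] [NormedSpace ℝ E] [FiniteDimensional ℝ E]
variable {G : Type*} [TopologicalSpace G] [T2Space G] [ChartedSpace E G] [Group G]
  [LieGroup 𝓘(ℝ, E) ∞ G] [MeasurableSpace G] {m : Measure G} {O : Set E}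

namespace IsWeaklyExponential

variable (hO : IsWeaklyExponential G m O)
include hO

lemma lieLog_lieExp {X : E} (hX : X ∈ O) : lieLog O (lieExp G X) = X :=
  hO.injOn.leftInvOn_invFunOn hX

omit [FiniteDimensional ℝ E] [T2Space G] [LieGroup 𝓘(ℝ, E) ∞ G] hO in
lemma lieExp_lieLog {a : G} (ha : a ∈ lieExp G '' O) : lieExp G (lieLog O a) = a :=
  Function.invFunOn_eq ha

omit [FiniteDimensional ℝ E] [T2Space G] [LieGroup 𝓘(ℝ, E) ∞ G] hO in
lemma lieLog_mem {a : G} (ha : a ∈ lieExp G '' O) : lieLog O a ∈ O :=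
  Function.invFunOn_mem ha

lemma one_mem_image : (1 : G) ∈ lieExp G '' O := ⟨0, hO.zero_mem, lieExp_zero⟩

lemma neg_mem {X : E} (hX : X ∈ O) : -X ∈ O := by
  simpa using hO.smul_mem X hX (-1) (by norm_num)

lemma smul_mem' {X : E} (hX : X ∈ O) {t : ℝ} (h0 : 0 ≤ t) (h1 : t ≤ 1) : t • X ∈ O :=
  hO.smul_mem X hX t ⟨by linarith, h1⟩

lemma inv_mem_image {a : G} (ha : a ∈ lieExp G '' O) : a⁻¹ ∈ lieExp G '' O := by
  obtain ⟨X, hX, rfl⟩ := ha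
  exact ⟨-X, hO.neg_mem hX, lieExp_neg X⟩

lemma contMDiffAt_lieExp {X : E} (hX : X ∈ O) :
    ContMDiffAt 𝓘(ℝ, E) 𝓘(ℝ, E) ∞ (lieExp G) X :=
  hO.contMDiffOn.contMDiffAt (hO.isOpen.mem_nhds hX)

lemma contMDiffAt_lieLog {a : G} (ha : a ∈ lieExp G '' O) :
    ContMDiffAt 𝓘(ℝ, E) 𝓘(ℝ, E) ∞ (lieLog O : G → E) a :=
  hO.contMDiffOn_inv.contMDiffAt (hO.isOpen_image.mem_nhds ha)

lemma continuousAt_lieExp {X : E} (hX : X ∈ O) : ContinuousAt (lieExp G) X :=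
  (hO.contMDiffAt_lieExp hX).continuousAt

lemma continuousAt_lieLog {a : G} (ha : a ∈ lieExp G '' O) : ContinuousAt (lieLog O : G → E) a :=
  (hO.contMDiffAt_lieLog ha).continuousAt

/-- Smoothness on `O` provides some derivative; along each line `t ↦ t X` it must be the initial
velocity `X` of the one-parameter subgroup. -/
lemma hasD_lieExp_zero : HasD (lieExp G) (0 : E) (ContinuousLinearMap.id ℝ E) := by
  have h := hasD_mder ((hO.contMDiffAt_lieExp hO.zero_mem).mdifferentiableAt (by simp))
  have h2 : mder (lieExp G) (0 : E) = ContinuousLinearMap.id ℝ E := by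
    ext X
    have hc : HasD (fun t : ℝ => t • X) 0 ((1 : ℝ →L[ℝ] ℝ).smulRight X) := by
      rw [hasD_iff_hasFDerivAt]
      exact ((1 : ℝ →L[ℝ] ℝ).smulRight X).hasFDerivAt
    have := (h.comp_curve hc (by simp)).unique (hasD_lieExp_smul_zero X)
    simpa using congrArg (fun L => L 1) this
  rwa [h2] at h

lemma hasD_lieLog_one : HasD (lieLog O : G → E) 1 (ContinuousLinearMap.id ℝ E) := by
  have h := hasD_mder ((hO.contMDiffAt_lieLog hO.one_mem_image).mdifferentiableAt (by simp))
  have h2 := h.comp hO.hasD_lieExp_zero lieExp_zero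
  have h3 : HasD (lieLog O ∘ lieExp G) (0 : E) (ContinuousLinearMap.id ℝ E) := by
    refine (hasD_id (0 : E)).congr ?_
    filter_upwards [hO.isOpen.mem_nhds hO.zero_mem] with X hX using hO.lieLog_lieExp hX
  rw [ContinuousLinearMap.comp_id] at h2
  rwa [h2.unique h3] at h

end IsWeaklyExponential

omit [FiniteDimensional ℝ E] in
lemma det_comp (A B : E →L[ℝ] E) : (A ∘L B).det = A.det * B.det :=
  LinearMap.det_comp _ _

variable (G) in
/-- The left trivialized derivative of the exponential map. -/
noncomputable def dExp (X : E) : E →L[ℝ] E := mder (fun Y : E => (lieExp G X)⁻¹ * lieExp G Y) X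

namespace IsWeaklyExponential

variable (hO : IsWeaklyExponential G m O)
include hO

lemma hasD_dExp {X : E} (hX : X ∈ O) :
    HasD (fun Y : E => (lieExp G X)⁻¹ * lieExp G Y) X (dExp G X) := by
  refine hasD_mder (ContMDiffAt.mdifferentiableAt (n := ∞) ?_ (by simp))
  exact ((contMDiff_mul_left' (lieExp G X)⁻¹) _).comp X (hO.contMDiffAt_lieExp hX)

lemma hasD_lieExp {X : E} (hX : X ∈ O) :
    HasD (lieExp G) X (dMulLeft (lieExp G X) ∘L dExp G X) := by
  have := (hasD_mul_left (E := E) (lieExp G X)).comp (hO.hasD_dExp hX) (by simp)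
  simpa [Function.comp_def] using this

/-- Composing with the logarithm, whose derivative at `1` is the identity, exhibits `dExp` as a
Fréchet derivative between vector spaces. Its smooth dependence on `X` then follows from joint
smoothness of `(X, Y) ↦ log(exp(-X) exp Y)`. -/
lemma hasFDerivAt_log_mul {X : E} (hX : X ∈ O) :
    HasFDerivAt (fun Y : E => lieLog O ((lieExp G X)⁻¹ * lieExp G Y)) (dExp G X) X := by
  rw [← hasD_iff_hasFDerivAt]
  exact hO.hasD_lieLog_one.comp (hO.hasD_dExp hX) (by simp)

lemma contDiffAt_log_mul {X : E} (hX : X ∈ O) :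
    ContDiffAt ℝ ∞ (fun p : E × E => lieLog O ((lieExp G p.1)⁻¹ * lieExp G p.2)) (X, X) := by
  rw [← contMDiffAt_iff_contDiffAt]
  have h1 : ContMDiffAt 𝓘(ℝ, E × E) 𝓘(ℝ, E) ∞ (fun p : E × E => lieExp G p.1) (X, X) :=
    (hO.contMDiffAt_lieExp hX).comp (X, X) contDiff_fst.contMDiff.contMDiffAt
  have h2 : ContMDiffAt 𝓘(ℝ, E × E) 𝓘(ℝ, E) ∞ (fun p : E × E => lieExp G p.2) (X, X) :=
    (hO.contMDiffAt_lieExp hX).comp (X, X) contDiff_snd.contMDiff.contMDiffAt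
  exact (hO.contMDiffAt_lieLog (by simpa using hO.one_mem_image)).comp (X, X) (h1.inv.mul h2)

lemma contDiffAt_dExp {X : E} (hX : X ∈ O) : ContDiffAt ℝ ∞ (dExp G : E → E →L[ℝ] E) X := by
  have h := ContDiffAt.fderiv (m := ∞) (n := ∞) (x₀ := X) (g := fun X : E => X)
    (f := fun X Y : E => lieLog O ((lieExp G X)⁻¹ * lieExp G Y))
    (hO.contDiffAt_log_mul hX) contDiffAt_id (by simp)
  refine h.congr_of_eventuallyEq ?_
  filter_upwards [hO.isOpen.mem_nhds hX] with Y hY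
  exact (hO.hasFDerivAt_log_mul hY).fderiv.symm

/-- The left inverse is the derivative at `1` of `a ↦ log(exp X · a)`, since following `Y ↦ exp(-X)
exp Y` by this map gives the identity near `X`. -/
lemma exists_leftInverse_dExp {X : E} (hX : X ∈ O) :
    ∃ B : E →L[ℝ] E, B ∘L dExp G X = ContinuousLinearMap.id ℝ E := by
  have h : MDifferentiableAt 𝓘(ℝ, E) 𝓘(ℝ, E) (fun a : G => lieLog O (lieExp G X * a)) 1 := by
    refine ContMDiffAt.mdifferentiableAt (n := ∞) ?_ (by simp)
    exact (hO.contMDiffAt_lieLog (by simpa using ⟨X, hX, rfl⟩)).comp 1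
      ((contMDiff_mul_left' (lieExp G X)) 1)
  refine ⟨mder (fun a : G => lieLog O (lieExp G X * a)) 1, ?_⟩
  refine ((hasD_mder h).comp (hO.hasD_dExp hX) (by simp)).unique ((hasD_id X).congr ?_)
  filter_upwards [hO.isOpen.mem_nhds hX] with Y hY
  simp [hO.lieLog_lieExp hY]

lemma isUnit_dExp {X : E} (hX : X ∈ O) : IsUnit (dExp G X) := by
  obtain ⟨B, hB⟩ := hO.exists_leftInverse_dExp hX
  have h2 : (B : E →ₗ[ℝ] E) * (dExp G X : E →ₗ[ℝ] E) = 1 := by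
    ext v; simpa using congrArg (fun L => L v) hB
  have h3 := mul_eq_one_comm.1 h2
  exact ⟨⟨dExp G X, B, by ext v; simpa using congrArg (fun L => L v) h3, by
    ext v; simpa using congrArg (fun L => L v) hB⟩, rfl⟩

lemma det_dExp_ne_zero {X : E} (hX : X ∈ O) : (dExp G X).det ≠ 0 := by
  obtain ⟨B, hB⟩ := hO.exists_leftInverse_dExp hX
  have h : B.det * (dExp G X).det = 1 := by
    rw [← det_comp, hB]
    exact LinearMap.det_id
  exact right_ne_zero_of_mul_eq_one h

lemma hasFDerivAt_log_conj (q : G) :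
    HasFDerivAt (fun Y : E => lieLog O (q * lieExp G Y * q⁻¹)) (Ad q) 0 := by
  rw [← hasD_iff_hasFDerivAt]
  have := hO.hasD_lieLog_one.comp ((hasD_conj (E := E) q).comp hO.hasD_lieExp_zero lieExp_zero)
    (by simp)
  simpa [Function.comp_def] using this

lemma contDiffAt_Ad_lieExp {X : E} (hX : X ∈ O) :
    ContDiffAt ℝ ∞ (fun X : E => Ad (E := E) (lieExp G X)) X := by
  have h0 : ContDiffAt ℝ ∞
      (fun p : E × E => lieLog O (lieExp G p.1 * lieExp G p.2 * (lieExp G p.1)⁻¹)) (X, 0) := by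
    rw [← contMDiffAt_iff_contDiffAt]
    have h1 : ContMDiffAt 𝓘(ℝ, E × E) 𝓘(ℝ, E) ∞ (fun p : E × E => lieExp G p.1) (X, 0) :=
      (hO.contMDiffAt_lieExp hX).comp (X, 0) contDiff_fst.contMDiff.contMDiffAt
    have h2 : ContMDiffAt 𝓘(ℝ, E × E) 𝓘(ℝ, E) ∞ (fun p : E × E => lieExp G p.2) (X, 0) :=
      (hO.contMDiffAt_lieExp hO.zero_mem).comp (X, 0) contDiff_snd.contMDiff.contMDiffAt
    exact (hO.contMDiffAt_lieLog (by simpa using hO.one_mem_image)).comp (X, 0)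
      ((h1.mul h2).mul h1.inv)
  have h := ContDiffAt.fderiv (m := ∞) (n := ∞) (x₀ := X) (g := fun _ : E => (0 : E))
    (f := fun X Y : E => lieLog O (lieExp G X * lieExp G Y * (lieExp G X)⁻¹))
    h0 contDiffAt_const (by simp)
  refine h.congr_of_eventuallyEq (Eventually.of_forall fun Y => ?_)
  exact (hO.hasFDerivAt_log_conj _).fderiv.symm

end IsWeaklyExponential

end Exponential

/-! ### The entire function `φ` as an integral of exponentials -/

section Phi

variable {E : Type*} [NormedAddCommGroup E] [NormedSpace ℝ E] [CompleteSpace E]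

lemma continuous_exp_smul (A : E →L[ℝ] E) : Continuous fun t : ℝ => NormedSpace.exp (t • A) :=
  continuous_iff_continuousAt.2 fun t => (hasDerivAt_exp_smul_const (𝕂 := ℝ) A t).continuousAt

lemma exp_add_smul (A : E →L[ℝ] E) (s t : ℝ) :
    NormedSpace.exp ((s + t) • A) = NormedSpace.exp (s • A) * NormedSpace.exp (t • A) := by
  rw [add_smul]
  let _ : NormedAlgebra ℚ (E →L[ℝ] E) := NormedAlgebra.restrictScalars ℚ ℝ (E →L[ℝ] E)
  exact NormedSpace.exp_add_of_commute (((Commute.refl A).smul_left s).smul_right t)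

/-- Integrate the exponential series term by term: `∫₀¹ (-t)ⁿ / n! dt = (-1)ⁿ / (n+1)!`, with
domination by `‖Aⁿ / n!‖`. -/
lemma phi_eq_integral (A : E →L[ℝ] E) :
    phi A = ∫ t in (0 : ℝ)..1, NormedSpace.exp ((-t) • A) := by
  let F' : ℕ → ℝ → E →L[ℝ] E := fun n t => ((-t) ^ n / (n.factorial : ℝ)) • A ^ n
  have h : HasSum (fun n => ∫ t in (0 : ℝ)..1, F' n t)
      (∫ t in (0 : ℝ)..1, NormedSpace.exp ((-t) • A)) := by
    refine intervalIntegral.hasSum_integral_of_dominated_convergence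
      (fun n _ => ‖((n.factorial : ℝ))⁻¹ • A ^ n‖) ?_ ?_ ?_ ?_ ?_
    · intro n
      exact Continuous.aestronglyMeasurable (by fun_prop)
    · intro n
      refine Eventually.of_forall fun t ht => ?_
      rw [Set.uIoc_of_le zero_le_one] at ht
      simp only [F']
      rw [div_eq_mul_inv, mul_smul, norm_smul]
      have : ‖(-t) ^ n‖ ≤ 1 := by
        rw [norm_pow, norm_neg, Real.norm_eq_abs, abs_of_pos ht.1]
        exact pow_le_one₀ ht.1.le ht.2
      exact mul_le_of_le_one_left (norm_nonneg _) this
    · exact Eventually.of_forall fun t _ => NormedSpace.norm_expSeries_summable' (𝕂 := ℝ) A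
    · simp
    · refine Eventually.of_forall fun t _ => ?_
      have := NormedSpace.exp_series_hasSum_exp' (𝕂 := ℝ) ((-t) • A)
      refine this.congr_fun fun n => ?_
      simp only [F', smul_pow, smul_smul, div_eq_inv_mul]
  rw [← h.tsum_eq, phi]
  congr 1
  ext1 n
  simp only [F', intervalIntegral.integral_smul_const]
  congr 1
  have : ∀ t : ℝ, (-t) ^ n / (n.factorial : ℝ) = ((-1) ^ n / (n.factorial : ℝ)) * t ^ n := by
    intro t; rw [neg_pow]; ring
  rw [intervalIntegral.integral_congr fun t _ => this t, intervalIntegral.integral_const_mul, integral_pow, Nat.factorial_succ]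
  push_cast
  have : (n.factorial : ℝ) ≠ 0 := by positivity
  rw [one_pow, zero_pow (Nat.succ_ne_zero n), sub_zero]
  field_simp

/-- Multiplying the integral of `e^{-tA}` by `e^A` gives the integral of `e^{(1-t)A}`; then
substitute `1 - t` for `t`. -/
lemma phi_neg (A : E →L[ℝ] E) : phi (-A) = NormedSpace.exp A * phi A := by
  rw [phi_eq_integral, phi_eq_integral, ← ContinuousLinearMap.mul_apply' ℝ,
    ← ContinuousLinearMap.intervalIntegral_comp_comm]
  · simp only [ContinuousLinearMap.mul_apply']
    have h1 : ∀ t : ℝ, NormedSpace.exp A * NormedSpace.exp ((-t) • A) =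
        NormedSpace.exp ((1 - t) • A) := by
      intro t
      rw [sub_eq_add_neg, exp_add_smul, one_smul]
    simp_rw [h1]
    rw [intervalIntegral.integral_comp_sub_left (fun t => NormedSpace.exp (t • A)) 1]
    simp
  · exact ((continuous_exp_smul A).comp continuous_neg).intervalIntegrable _ _

end Phi

/-! ### The derivative of the exponential map: `dExp X = φ(dAd X)` -/

section Exponential

variable {E : Type*} [NormedAddCommGroup E] [NormedSpace ℝ E] [FiniteDimensional ℝ E]
variable {G : Type*} [TopologicalSpace G] [T2Space G] [ChartedSpace E G] [Group G]
  [LieGroup 𝓘(ℝ, E) ∞ G] [MeasurableSpace G] {m : Measure G} {O : Set E}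

variable (G) in
/-- The derivative of `Ad` at the unit element, in exponential coordinates. -/
noncomputable def dAd : E →L[ℝ] E →L[ℝ] E := fderiv ℝ (fun X : E => Ad (E := E) (lieExp G X)) 0

namespace IsWeaklyExponential

variable (hO : IsWeaklyExponential G m O)
include hO

lemma hasFDerivAt_Ad_lieExp_zero :
    HasFDerivAt (fun X : E => Ad (E := E) (lieExp G X)) (dAd G) 0 :=
  ((hO.contDiffAt_Ad_lieExp hO.zero_mem).differentiableAt (by simp)).hasFDerivAt

lemma hasDerivAt_Ad_lieExp_smul_zero (X : E) :
    HasDerivAt (fun t : ℝ => Ad (E := E) (lieExp G (t • X))) (dAd G X) 0 := by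
  have h1 : HasDerivAt (fun t : ℝ => t • X) X 0 := by
    simpa using (hasDerivAt_id (0 : ℝ)).smul_const X
  have h2 : HasFDerivAt (fun X : E => Ad (E := E) (lieExp G X)) (dAd G) ((0 : ℝ) • X) := by
    rw [zero_smul]; exact hO.hasFDerivAt_Ad_lieExp_zero
  exact h2.comp_hasDerivAt 0 h1

lemma hasDerivAt_Ad_lieExp_smul (X : E) (t : ℝ) :
    HasDerivAt (fun t : ℝ => Ad (E := E) (lieExp G (t • X)))
      (Ad (E := E) (lieExp G (t • X)) * dAd G X) t := by
  have h2 : HasDerivAt (fun t : ℝ => Ad (E := E) (lieExp G (t • X))) (dAd G X) (t - t) := by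
    rw [sub_self]; exact hO.hasDerivAt_Ad_lieExp_smul_zero X
  have h3 := (HasDerivAt.comp_sub_const t t h2).const_mul (Ad (E := E) (lieExp G (t • X)))
  refine h3.congr_of_eventuallyEq (Eventually.of_forall fun s => ?_)
  dsimp only
  rw [ContinuousLinearMap.mul_def, ← Ad_mul, ← lieExp_add_smul, add_sub_cancel]

/-- The homomorphism `t ↦ Ad(exp tX)` solves `A' = A · dAd X`, so its product with `e^{-t dAd X}`
has zero derivative. -/
lemma Ad_lieExp_smul (X : E) (t : ℝ) :
    Ad (E := E) (lieExp G (t • X)) = NormedSpace.exp (t • dAd G X) := by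
  have : CompleteSpace E := FiniteDimensional.complete ℝ E
  have hd : ∀ t : ℝ, HasDerivAt (fun t : ℝ => Ad (E := E) (lieExp G (t • X)) *
      NormedSpace.exp ((-t) • dAd G X)) 0 t := by
    intro t
    have h1 := (hasDerivAt_exp_smul_const' (𝕂 := ℝ) (dAd G X) (-t)).scomp t (hasDerivAt_neg t)
    have h2 := (hO.hasDerivAt_Ad_lieExp_smul X t).mul h1
    refine h2.congr_deriv ?_
    rw [neg_one_smul, mul_neg, mul_assoc, Function.comp_apply, add_neg_cancel]
  have h0 := is_const_of_deriv_eq_zero (fun t => (hd t).differentiableAt) (fun t => (hd t).deriv) t 0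
  simp only [zero_smul, lieExp_zero, Ad_one, neg_zero, NormedSpace.exp_zero, mul_one] at h0
  have h3 := congrArg (fun L => L * NormedSpace.exp (t • dAd G X)) h0
  simp only [mul_assoc, ← exp_add_smul, neg_add_cancel, zero_smul, NormedSpace.exp_zero,
    mul_one] at h3
  rw [h3]
  rfl

lemma Ad_lieExp (X : E) : Ad (E := E) (lieExp G X) = NormedSpace.exp (dAd G X) := by
  simpa using hO.Ad_lieExp_smul X 1

lemma Ad_lieExp_smul_self (X : E) (t : ℝ) : Ad (E := E) (lieExp G (t • X)) X = X := by
  have h1 := (hasD_conj (E := E) (lieExp G (t • X))).comp_curve (hasD_lieExp_smul_zero X) (by simp)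
  refine ?_
  have h2 : (fun s : ℝ => lieExp G (t • X) * lieExp G (s • X) * (lieExp G (t • X))⁻¹) =
      fun s : ℝ => lieExp G (s • X) := by
    ext s
    rw [← lieExp_add_smul, add_comm, lieExp_add_smul, mul_inv_cancel_right]
  rw [h2] at h1
  simpa using congrArg (fun L => L 1) (h1.unique (hasD_lieExp_smul_zero X))

lemma dAd_self (X : E) : dAd G X X = 0 := by
  have h1 := (hO.hasDerivAt_Ad_lieExp_smul_zero X).clm_apply (hasDerivAt_const 0 X)
  simp only [hO.Ad_lieExp_smul_self] at h1
  simpa using h1.unique (hasDerivAt_const 0 X)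

/-- Polarization of `dAd X X = 0`, which itself holds because `exp(tX)` commutes with its own
one-parameter subgroup. -/
lemma dAd_swap (X Y : E) : dAd G X Y = - dAd G Y X := by
  have h := hO.dAd_self (X + Y)
  simp only [map_add, add_apply, hO.dAd_self] at h
  rw [zero_add, add_zero] at h
  exact eq_neg_of_add_eq_zero_right h

lemma hasD_curve_dExp (X Y : E) {s : ℝ} (hs : s • X ∈ O) :
    HasD (fun r : ℝ => (lieExp G (s • X))⁻¹ * lieExp G (s • (X + r • Y))) 0
      ((1 : ℝ →L[ℝ] ℝ).smulRight (s • dExp G (s • X) Y)) := by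
  have h1 : HasD (fun r : ℝ => s • (X + r • Y)) 0 ((1 : ℝ →L[ℝ] ℝ).smulRight (s • Y)) := by
    rw [hasD_iff_hasFDerivAt]
    have : HasDerivAt (fun r : ℝ => s • (X + r • Y)) (s • Y) 0 := by
      have h := (((hasDerivAt_id (0 : ℝ)).smul_const Y).const_add X).const_smul s
      rwa [one_smul] at h
    exact this.hasFDerivAt
  rw [← map_smul]
  exact (hO.hasD_dExp hs).comp_curve h1 (by simp)

/-- The vector `t · dExp(tX) Y` is the left logarithmic derivative of `r ↦ exp(t(X + rY))` at `0`.
The product rule for `exp((s+t)Z) = exp(sZ) exp(tZ)` gives a cocycle identity, the first factor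
being conjugated by `exp(-tX)`. -/
lemma smul_dExp_add (X Y : E) {s t : ℝ} (hs : s • X ∈ O) (ht : t • X ∈ O)
    (hst : (s + t) • X ∈ O) :
    (s + t) • dExp G ((s + t) • X) Y =
      Ad (E := E) (lieExp G (-t • X)) (s • dExp G (s • X) Y) + t • dExp G (t • X) Y := by
  have h1 := hO.hasD_curve_dExp X Y hst
  have h2 := ((hasD_conj (E := E) (lieExp G (-t • X))).comp_curve
    (hO.hasD_curve_dExp X Y hs) (by simp)).mul (hO.hasD_curve_dExp X Y ht) (by simp) (by simp)
  have h3 : (fun r : ℝ => (lieExp G ((s + t) • X))⁻¹ * lieExp G ((s + t) • (X + r • Y))) =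
      fun r => lieExp G (-t • X) * ((lieExp G (s • X))⁻¹ * lieExp G (s • (X + r • Y))) *
        (lieExp G (-t • X))⁻¹ * ((lieExp G (t • X))⁻¹ * lieExp G (t • (X + r • Y))) := by
    ext r
    rw [lieExp_add_smul, lieExp_add_smul, neg_smul, lieExp_neg]
    group
  rw [h3] at h1
  simpa using congrArg (fun L => L 1) (h1.unique h2)

lemma dExp_zero : dExp G (0 : E) = ContinuousLinearMap.id ℝ E := by
  refine (hO.hasD_dExp hO.zero_mem).unique ?_
  simpa using hO.hasD_lieExp_zero

/-- The cocycle identity with increment `s - t` reduces the derivative at `t` to the one at `0`,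
where it is `Y`, followed by `Ad(exp(-tX)) = e^{-t dAd X}`. It is taken from the right, for `t ≤ s ≤
1`, where star-shapedness of `O` keeps all three multiples of `X` inside `O`. -/
lemma hasDerivWithinAt_smul_dExp {X : E} (hX : X ∈ O) (Y : E) {t : ℝ} (ht : t ∈ Set.Ico (0 : ℝ) 1) :
    HasDerivWithinAt (fun t : ℝ => t • dExp G (t • X) Y)
      (NormedSpace.exp ((-t) • dAd G X) Y) (Set.Ici t) t := by
  have h0 : HasDerivAt (fun t : ℝ => t • dExp G (t • X) Y) Y (t - t) := by
    obtain ⟨D, hD⟩ : ∃ D, HasFDerivAt (fun Z : E => dExp G Z) D ((0 : ℝ) • X) := by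
      rw [zero_smul]
      exact (hO.contDiffAt_dExp hO.zero_mem).differentiableAt (by simp)
    have h1 : HasDerivAt (fun t : ℝ => t • X) X 0 := by
      simpa using (hasDerivAt_id (0 : ℝ)).smul_const X
    have ha := hD.comp_hasDerivAt 0 h1
    have hb : HasDerivAt (fun t : ℝ => dExp G (t • X) Y) (D X Y) 0 := by
      simpa using ha.clm_apply (hasDerivAt_const 0 Y)
    have h2 := (hasDerivAt_id (0 : ℝ)).smul hb
    rw [sub_self]
    refine h2.congr_deriv ?_
    simp [hO.dExp_zero]
  have h3 := ((Ad (E := E) (lieExp G (-t • X))).hasFDerivAt.comp_hasDerivAt t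
    (HasDerivAt.comp_sub_const t t h0)).add_const (t • dExp G (t • X) Y)
  rw [← hO.Ad_lieExp_smul]
  refine (h3.hasDerivWithinAt (s := Set.Ici t)).congr_of_eventuallyEq_of_mem ?_ Set.self_mem_Ici
  filter_upwards [Icc_mem_nhdsGE ht.2] with s hs
  have := hO.smul_dExp_add X Y (s := s - t) (t := t)
    (hO.smul_mem' hX (by linarith [hs.1]) (by linarith [hs.2, ht.1]))
    (hO.smul_mem' hX ht.1 ht.2.le)
    (hO.smul_mem' hX (by linarith [hs.1, ht.1]) (by linarith [hs.2]))
  rw [sub_add_cancel] at this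
  exact this

lemma dExp_eq_phi_dAd {X : E} (hX : X ∈ O) : dExp G X = phi (dAd G X) := by
  have : CompleteSpace E := FiniteDimensional.complete ℝ E
  ext Y
  have hcont : Continuous fun t : ℝ => NormedSpace.exp ((-t) • dAd G X) :=
    (continuous_exp_smul (dAd G X)).comp continuous_neg
  have h1 := intervalIntegral.integral_eq_sub_of_hasDeriv_right_of_le (a := 0) (b := 1)
    (f := fun t : ℝ => t • dExp G (t • X) Y) (f' := fun t => NormedSpace.exp ((-t) • dAd G X) Y)
    zero_le_one ?_ ?_ ?_
  · simp only [one_smul, zero_smul, sub_zero] at h1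
    rw [← h1, phi_eq_integral, ContinuousLinearMap.intervalIntegral_apply]
    exact hcont.intervalIntegrable _ _
  · intro t ht
    have hc : ContinuousAt (dExp G : E → E →L[ℝ] E) (t • X) :=
      (hO.contDiffAt_dExp (hO.smul_mem' hX ht.1 ht.2)).continuousAt
    have h2 : ContinuousAt (fun t : ℝ => dExp G (t • X)) t :=
      ContinuousAt.comp (f := fun t : ℝ => t • X) hc (by fun_prop)
    exact (continuousAt_id.smul (h2.clm_apply continuousAt_const)).continuousWithinAt
  · intro t ht
    exact (hO.hasDerivWithinAt_smul_dExp hX Y ⟨ht.1.le, ht.2⟩).mono Set.Ioi_subset_Ici_self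
  · exact (hcont.clm_apply continuous_const).intervalIntegrable _ _

lemma dExp_neg {X : E} (hX : X ∈ O) : dExp G (-X) = Ad (E := E) (lieExp G X) * dExp G X := by
  have : CompleteSpace E := FiniteDimensional.complete ℝ E
  rw [hO.dExp_eq_phi_dAd hX, hO.dExp_eq_phi_dAd (hO.neg_mem hX), map_neg, phi_neg, hO.Ad_lieExp]

/-- Differentiating `dExp(-Z) = Ad(exp Z) dExp(Z)` at `0` gives `-D = dAd + D`, so `D = -dAd / 2`
with no need to differentiate the series. -/
lemma fderiv_dExp_zero (X : E) :
    fderiv ℝ (dExp G : E → E →L[ℝ] E) 0 X = -((1 / 2 : ℝ) • dAd G X) := by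
  set D := fderiv ℝ (dExp G : E → E →L[ℝ] E) 0
  have hc : HasFDerivAt (dExp G : E → E →L[ℝ] E) D 0 :=
    ((hO.contDiffAt_dExp hO.zero_mem).differentiableAt (by simp)).hasFDerivAt
  have h1 : HasFDerivAt (fun Z : E => dExp G (-Z)) (-D) 0 := by
    have h := hc
    rw [← neg_zero] at h
    have h2 := h.comp 0 (hasFDerivAt_id (0 : E)).neg
    rwa [ContinuousLinearMap.comp_neg, ContinuousLinearMap.comp_id] at h2
  have h2 := hO.hasFDerivAt_Ad_lieExp_zero.mul' hc
  have h3 := h1.congr_of_eventuallyEq (f₁ := fun Z : E => Ad (E := E) (lieExp G Z) * dExp G Z) (by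
    filter_upwards [hO.isOpen.mem_nhds hO.zero_mem] with Z hZ using (hO.dExp_neg hZ).symm)
  have h4 := congrArg (fun L => L X) (h2.unique h3)
  simp only [lieExp_zero, Ad_one, hO.dExp_zero] at h4
  have h5 : D X + dAd G X = - D X := by
    ext Y
    simpa using congrArg (fun L => L Y) h4
  have h6 : (2 : ℝ) • D X = - dAd G X := by
    rw [two_smul, eq_neg_iff_add_eq_zero, add_right_comm, h5, neg_add_cancel]
  rw [← smul_neg, ← h6, smul_smul]
  norm_num

end IsWeaklyExponential

end Exponential

/-! ### The Lie bracket of left invariant fields in exponential coordinates -/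

section Bracket

variable {E : Type*} [NormedAddCommGroup E] [NormedSpace ℝ E] [FiniteDimensional ℝ E]
variable {G : Type*} [TopologicalSpace G] [T2Space G] [ChartedSpace E G] [Group G]
  [LieGroup 𝓘(ℝ, E) ∞ G] [MeasurableSpace G] {m : Measure G} {O : Set E}

omit [FiniteDimensional ℝ E] [T2Space G] [MeasurableSpace G] in
lemma exists_leftInverse_dMulLeft (g : G) :
    ∃ B : E →L[ℝ] E, B ∘L dMulLeft g = ContinuousLinearMap.id ℝ E := by
  refine ⟨mder (fun x : G => g⁻¹ * x) g, ?_⟩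
  have h := (hasD_mul_left_mul (E := E) g⁻¹ g).comp (hasD_mul_left (E := E) g) (mul_one g)
  refine h.unique ?_
  simpa [Function.comp_def] using hasD_id (1 : G)

omit [T2Space G] [MeasurableSpace G] in
lemma inverse_comp_apply {A D : E →L[ℝ] E} {B : E →L[ℝ] E}
    (hB : B ∘L A = ContinuousLinearMap.id ℝ E) (hD : IsUnit D) (X : E) :
    (A ∘L D).inverse (A X) = Ring.inverse D X := by
  obtain ⟨u, rfl⟩ := hD
  have h2 : (A : E →ₗ[ℝ] E) * (B : E →ₗ[ℝ] E) = 1 := by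
    refine mul_eq_one_comm.1 ?_
    ext v; simpa using congrArg (fun L => L v) hB
  have h3 : A ∘L B = ContinuousLinearMap.id ℝ E := by
    ext v; simpa using congrArg (fun L => L v) h2
  have h4 : (A ∘L (u : E →L[ℝ] E)).inverse = ((u⁻¹ : (E →L[ℝ] E)ˣ) : E →L[ℝ] E) ∘L B := by
    refine ContinuousLinearMap.inverse_eq ?_ ?_
    · calc (A ∘L (u : E →L[ℝ] E)) ∘L (((u⁻¹ : (E →L[ℝ] E)ˣ) : E →L[ℝ] E) ∘L B)
          = A ∘L (((u : E →L[ℝ] E) * ((u⁻¹ : (E →L[ℝ] E)ˣ) : E →L[ℝ] E)) ∘L B) := rfl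
        _ = _ := by rw [Units.mul_inv]; exact h3
    · calc (((u⁻¹ : (E →L[ℝ] E)ˣ) : E →L[ℝ] E) ∘L B) ∘L (A ∘L (u : E →L[ℝ] E))
          = ((u⁻¹ : (E →L[ℝ] E)ˣ) : E →L[ℝ] E) ∘L ((B ∘L A) ∘L (u : E →L[ℝ] E)) := rfl
        _ = _ := by rw [hB]; exact Units.inv_mul u
  rw [h4, Ring.inverse_unit, ContinuousLinearMap.comp_apply]
  congr 1
  simpa using congrArg (fun L => L X) hB

namespace IsWeaklyExponential

variable (hO : IsWeaklyExponential G m O)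
include hO

/-- The derivative of `exp` at `Z` is left translation after `dExp Z`, and the left invariant field
is left translation of `X`; the translations cancel. -/
lemma mpullback_lieExp_leftInvariant {Z : E} (hZ : Z ∈ O) (X : E) :
    VectorField.mpullback 𝓘(ℝ, E) 𝓘(ℝ, E) (lieExp G)
      (mulInvariantVectorField (I := 𝓘(ℝ, E)) (G := G) X) Z =
      Ring.inverse (dExp G Z) X := by
  have h1 : (mfderiv 𝓘(ℝ, E) 𝓘(ℝ, E) (lieExp G) Z : E →L[ℝ] E) =
      dMulLeft (lieExp G Z) ∘L dExp G Z := (hO.hasD_lieExp hZ).mfderiv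
  obtain ⟨B, hB⟩ := exists_leftInverse_dMulLeft (E := E) (lieExp G Z)
  have h2 := inverse_comp_apply hB (hO.isUnit_dExp hZ) X
  rw [← h1] at h2
  exact h2

lemma fderiv_inverse_dExp (X Y : E) :
    fderiv ℝ (fun Z : E => Ring.inverse (dExp G Z) Y) 0 X = (1 / 2 : ℝ) • dAd G X Y := by
  have : CompleteSpace E := FiniteDimensional.complete ℝ E
  have h1 : HasFDerivAt (fun Z : E => dExp G Z) (fderiv ℝ (dExp G : E → E →L[ℝ] E) 0) 0 :=
    ((hO.contDiffAt_dExp hO.zero_mem).differentiableAt (by simp)).hasFDerivAt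
  have h2 := hasFDerivAt_ringInverse (𝕜 := ℝ) (1 : (E →L[ℝ] E)ˣ)
  have h3 : HasFDerivAt Ring.inverse (-ContinuousLinearMap.mulLeftRight ℝ (E →L[ℝ] E)
    ((1 : (E →L[ℝ] E)ˣ)⁻¹ : (E →L[ℝ] E)ˣ) ((1 : (E →L[ℝ] E)ˣ)⁻¹ : (E →L[ℝ] E)ˣ)) (dExp G (0 : E)) := by
    rw [hO.dExp_zero]; exact h2
  have h4 := (h3.comp 0 h1).clm_apply (hasFDerivAt_const Y (0 : E))
  have h5 := h4.fderiv
  simp only [Function.comp_apply] at h5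
  rw [h5]
  simp [hO.fderiv_dExp_zero]

lemma mpullback_lieExp_zero (W : ∀ x : G, TangentSpace 𝓘(ℝ, E) x) :
    (VectorField.mpullback 𝓘(ℝ, E) 𝓘(ℝ, E) (lieExp G) W (0 : E) : E) = (W 1 : E) := by
  have h2 : (mfderiv 𝓘(ℝ, E) 𝓘(ℝ, E) (lieExp G) (0 : E) : E →L[ℝ] E) =
    ContinuousLinearMap.id ℝ E := HasMFDerivAt.mfderiv hO.hasD_lieExp_zero
  have h3 : ∀ g : G, g = 1 → (W g : E) = (W 1 : E) := by
    rintro _ rfl; rfl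
  have h4 : ∀ (L : E →L[ℝ] E) (v : E), L = ContinuousLinearMap.id ℝ E → L.inverse v = v := by
    rintro _ v rfl
    simp
  exact (h4 _ _ h2).trans (h3 _ lieExp_zero)

omit [FiniteDimensional ℝ E] hO in
lemma mlieBracket_eq_lieBracket [CompleteSpace E] (V W : E → E) (x : E) :
    (VectorField.mlieBracket 𝓘(ℝ, E) (V : ∀ x : E, TangentSpace 𝓘(ℝ, E) x) W x : E) =
      VectorField.lieBracket ℝ V W x := by
  refine (congrFun (VectorField.mlieBracketWithin_univ (I := 𝓘(ℝ, E))
    (V := (V : ∀ x : E, TangentSpace 𝓘(ℝ, E) x)) (W := W)).symm x).trans ?_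
  refine (congrFun (VectorField.mlieBracketWithin_eq_lieBracketWithin (𝕜 := ℝ)
    (V := (V : ∀ x : E, TangentSpace 𝓘(ℝ, E) x)) (W := W) (s := Set.univ)) x).trans ?_
  exact congrFun (VectorField.lieBracketWithin_univ (𝕜 := ℝ) (V := V) (W := W)) x

/-- Pull back along `exp` and take the bracket at `0` of the fields `Z ↦ (dExp Z)⁻¹ X` and `Z ↦
(dExp Z)⁻¹ Y`. Each term contributes half of `dAd`, and antisymmetry makes the two halves add up. -/
lemma bracket_eq_dAd (X Y : E) :
    (VectorField.mlieBracket 𝓘(ℝ, E) (mulInvariantVectorField (I := 𝓘(ℝ, E)) (G := G) X)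
      (mulInvariantVectorField (I := 𝓘(ℝ, E)) (G := G) Y) 1 : E) = dAd G X Y := by
  have : CompleteSpace E := FiniteDimensional.complete ℝ E
  have : LieGroup 𝓘(ℝ, E) (minSmoothness ℝ 3) G := lieGroup_minSmoothness
  have h1 := VectorField.mpullback_mlieBracket (I := 𝓘(ℝ, E)) (I' := 𝓘(ℝ, E))
    (n := minSmoothness ℝ 3) (f := lieExp G) (x₀ := (0 : E))
    (mdifferentiableAt_mulInvariantVectorField (I := 𝓘(ℝ, E)) (G := G) X)
    (mdifferentiableAt_mulInvariantVectorField (I := 𝓘(ℝ, E)) (G := G) Y)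
    ((hO.contMDiffAt_lieExp hO.zero_mem).of_le (by
      rw [minSmoothness_of_isRCLikeNormedField]; exact ENat.LEInfty.out))
    (minSmoothness_monotone (by norm_cast))
  set VX : E → E := fun Z => VectorField.mpullback 𝓘(ℝ, E) 𝓘(ℝ, E) (lieExp G)
        (mulInvariantVectorField (I := 𝓘(ℝ, E)) (G := G) X) Z with hVX
  set VY : E → E := fun Z => VectorField.mpullback 𝓘(ℝ, E) 𝓘(ℝ, E) (lieExp G)
        (mulInvariantVectorField (I := 𝓘(ℝ, E)) (G := G) Y) Z with hVY
  refine (hO.mpullback_lieExp_zero _).symm.trans (h1.trans ?_)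
  refine (mlieBracket_eq_lieBracket VX VY 0).trans ?_
  have h2 : VectorField.lieBracket ℝ VX VY 0 =
      VectorField.lieBracket ℝ (fun Z : E => Ring.inverse (dExp G Z) X)
        (fun Z : E => Ring.inverse (dExp G Z) Y) 0 := by
    refine Filter.EventuallyEq.lieBracket_vectorField_eq ?_ ?_
    · filter_upwards [hO.isOpen.mem_nhds hO.zero_mem] with Z hZ
      exact hO.mpullback_lieExp_leftInvariant hZ X
    · filter_upwards [hO.isOpen.mem_nhds hO.zero_mem] with Z hZ
      exact hO.mpullback_lieExp_leftInvariant hZ Y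
  have h3 : Ring.inverse (dExp G (0 : E)) = ContinuousLinearMap.id ℝ E := by
    rw [hO.dExp_zero]; exact Ring.inverse_one _
  rw [h2, VectorField.lieBracket_eq]
  dsimp only
  rw [h3, ContinuousLinearMap.id_apply, ContinuousLinearMap.id_apply, hO.fderiv_inverse_dExp,
    hO.fderiv_inverse_dExp, hO.dAd_swap Y X, smul_neg, sub_neg_eq_add, ← add_smul,
    add_halves, one_smul]

lemma ad_eq_dAd (X : E) : ad G X = dAd G X := by
  ext Y
  exact hO.bracket_eq_dAd X Y

lemma dExp_eq_phi {X : E} (hX : X ∈ O) : dExp G X = phi (ad G X) := by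
  rw [hO.ad_eq_dAd, hO.dExp_eq_phi_dAd hX]

end IsWeaklyExponential

end Bracket

/-! ### The density `ρ`, the function `δ = |det Ad|` and the weight `F` -/

section Densities

variable {E : Type*} [NormedAddCommGroup E] [NormedSpace ℝ E]

lemma det_id : (ContinuousLinearMap.id ℝ E).det = 1 := LinearMap.det_id

lemma continuous_phi [CompleteSpace E] : Continuous (phi : (E →L[ℝ] E) → E →L[ℝ] E) := by
  have h : (phi : (E →L[ℝ] E) → E →L[ℝ] E) =
      fun A => ∫ t in (0 : ℝ)..1, NormedSpace.exp ((-t) • A) := funext phi_eq_integral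
  rw [h]
  refine intervalIntegral.continuous_parametric_intervalIntegral_of_continuous' ?_ _ _
  let _ : NormedAlgebra ℚ (E →L[ℝ] E) := NormedAlgebra.restrictScalars ℚ ℝ (E →L[ℝ] E)
  exact NormedSpace.exp_continuous.comp (by fun_prop)

variable [FiniteDimensional ℝ E]
variable {G : Type*} [TopologicalSpace G] [T2Space G] [ChartedSpace E G] [Group G]
  [LieGroup 𝓘(ℝ, E) ∞ G] [MeasurableSpace G] {m : Measure G} {O : Set E}

variable (G) in
/-- The density of the Haar measure in exponential coordinates. -/
noncomputable def rho (X : E) : ℝ := |(phi (ad G X)).det|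

variable (E) in
/-- The modular function. -/
noncomputable def delta (q : G) : ℝ := |(Ad (E := E) q).det|

omit [MeasurableSpace G] [T2Space G] in
lemma F_eq (X : E) : F G X = √(rho G X * delta E (lieExp G ((1 / 2 : ℝ) • X))) := by
  rw [F, abs_mul, rho, delta]

omit [MeasurableSpace G] [T2Space G] [FiniteDimensional ℝ E] in
lemma delta_mul (g h : G) : delta E (g * h) = delta E g * delta E h := by
  rw [delta, Ad_mul, det_comp, abs_mul, delta, delta]

omit [MeasurableSpace G] [T2Space G] [FiniteDimensional ℝ E] in
lemma delta_one : delta E (1 : G) = 1 := by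
  rw [delta, Ad_one, det_id, abs_one]

omit [MeasurableSpace G] [T2Space G] [FiniteDimensional ℝ E] in
lemma delta_pos (g : G) : 0 < delta E g := by
  have h : delta E g * delta E g⁻¹ = 1 := by rw [← delta_mul, mul_inv_cancel, delta_one]
  exact lt_of_le_of_ne (abs_nonneg _) (left_ne_zero_of_mul_eq_one h).symm

omit [MeasurableSpace G] [T2Space G] [FiniteDimensional ℝ E] in
lemma delta_inv (g : G) : delta E g⁻¹ = (delta E g)⁻¹ := by
  have h : delta E g * delta E g⁻¹ = 1 := by rw [← delta_mul, mul_inv_cancel, delta_one]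
  exact eq_inv_of_mul_eq_one_right h

omit [MeasurableSpace G] [T2Space G] in
lemma rho_nonneg (X : E) : 0 ≤ rho G X := abs_nonneg _

omit [MeasurableSpace G] [T2Space G] in
lemma F_sq (X : E) : F G X ^ 2 = rho G X * delta E (lieExp G ((1 / 2 : ℝ) • X)) := by
  rw [F_eq, Real.sq_sqrt (mul_nonneg (rho_nonneg X) (delta_pos _).le)]

omit [MeasurableSpace G] [T2Space G] in
lemma F_nonneg (X : E) : 0 ≤ F G X := Real.sqrt_nonneg _

omit [MeasurableSpace G] in
lemma sq_delta_half (X : E) : delta E (lieExp G ((1 / 2 : ℝ) • X)) ^ 2 = delta E (lieExp G X) := by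
  rw [sq, ← delta_mul, lieExp_half_mul_half]

omit [MeasurableSpace G] in
lemma lieExp_natCast_smul (Z : E) (n : ℕ) : lieExp G ((n : ℝ) • Z) = lieExp G Z ^ n := by
  induction n with
  | zero => simp
  | succ n ih =>
    rw [Nat.cast_succ, lieExp_add_smul, ih, one_smul, pow_succ]

lemma continuous_det : Continuous fun A : E →L[ℝ] E => A.det :=
  ContinuousLinearMap.continuous_det

namespace IsWeaklyExponential

variable (hO : IsWeaklyExponential G m O)
include hO

lemma rho_eq {X : E} (hX : X ∈ O) : rho G X = |(dExp G X).det| := by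
  rw [rho, hO.dExp_eq_phi hX]

lemma rho_pos {X : E} (hX : X ∈ O) : 0 < rho G X := by
  rw [hO.rho_eq hX]
  exact abs_pos.2 (hO.det_dExp_ne_zero hX)

lemma rho_zero : rho G (0 : E) = 1 := by
  rw [hO.rho_eq hO.zero_mem, hO.dExp_zero, det_id, abs_one]

lemma F_pos {X : E} (hX : X ∈ O) : 0 < F G X := by
  rw [F_eq]
  exact Real.sqrt_pos.2 (mul_pos (hO.rho_pos hX) (delta_pos _))

lemma continuous_rho : Continuous (rho G : E → ℝ) := by
  have : CompleteSpace E := FiniteDimensional.complete ℝ E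
  have h : (rho G : E → ℝ) = fun X => |(phi (dAd G X)).det| := by
    ext X; rw [rho, hO.ad_eq_dAd]
  rw [h]
  exact (continuous_det.comp (continuous_phi.comp (dAd G).continuous)).abs

lemma rho_neg (X : E) : rho G (-X) = delta E (lieExp G X) * rho G X := by
  have : CompleteSpace E := FiniteDimensional.complete ℝ E
  rw [rho, rho, delta, hO.ad_eq_dAd, hO.ad_eq_dAd, map_neg, phi_neg, ← hO.Ad_lieExp,
    ContinuousLinearMap.mul_def, det_comp, abs_mul]

/-- Reflection multiplies `ρ` by `δ(exp X)` and inverts `δ(exp(X/2))`, whose square is `δ(exp X)`.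
This evenness is what turns the adjoint of a kernel into complex conjugation of its function on `M`.
-/
lemma F_neg (X : E) : F G (-X) = F G X := by
  rw [F_eq, F_eq, hO.rho_neg, smul_neg, lieExp_neg, delta_inv, ← sq_delta_half]
  congr 1
  field_simp [(delta_pos (E := E) (lieExp G ((1 / 2 : ℝ) • X))).ne']

lemma continuous_delta_lieExp : Continuous fun X : E => delta E (lieExp G X) := by
  have : CompleteSpace E := FiniteDimensional.complete ℝ E
  let _ : NormedAlgebra ℚ (E →L[ℝ] E) := NormedAlgebra.restrictScalars ℚ ℝ (E →L[ℝ] E)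
  simp only [delta, hO.Ad_lieExp]
  exact (continuous_det.comp (NormedSpace.exp_continuous.comp (dAd G).continuous)).abs

lemma continuous_F : Continuous (F G : E → ℝ) := by
  have h : (F G : E → ℝ) = fun X => √(rho G X * delta E (lieExp G ((1 / 2 : ℝ) • X))) :=
    funext F_eq
  rw [h]
  have h1 : Continuous fun X : E => (1 / 2 : ℝ) • X := by fun_prop
  exact (hO.continuous_rho.mul (hO.continuous_delta_lieExp.comp h1)).sqrt

/-- The hypotheses give regularity on `O` only. Elsewhere use `exp X = exp(X/(n+1))^(n+1)` with `n`
so large that `X/(n+1)` lies in `O`. -/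
lemma continuous_lieExp [IsTopologicalGroup G] : Continuous (lieExp G : E → G) := by
  refine continuous_iff_continuousAt.2 fun X => ?_
  have h1 : Tendsto (fun n : ℕ => ((1 : ℝ) / ((n : ℝ) + 1)) • X) atTop (𝓝 0) := by
    simpa using (tendsto_one_div_add_atTop_nhds_zero_nat (𝕜 := ℝ)).smul_const X
  obtain ⟨n, hn⟩ := (h1.eventually (hO.isOpen.mem_nhds hO.zero_mem)).exists
  have h2 : (lieExp G : E → G) = fun Y => lieExp G (((1 : ℝ) / ((n : ℝ) + 1)) • Y) ^ (n + 1) := by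
    ext Y
    rw [← lieExp_natCast_smul, smul_smul]
    congr 1
    push_cast
    rw [mul_one_div_cancel (by positivity), one_smul]
  rw [h2]
  refine ContinuousAt.pow ?_ _
  exact ContinuousAt.comp (f := fun Y : E => ((1 : ℝ) / ((n : ℝ) + 1)) • Y)
    (hO.continuousAt_lieExp hn) (by fun_prop)

lemma measurableSet_image [BorelSpace G] : MeasurableSet (lieExp G '' O) :=
  hO.isOpen_image.measurableSet

lemma measurable_lieLog [MeasurableSpace E] [BorelSpace E] [BorelSpace G] :
    Measurable (lieLog O : G → E) := by
  classical
  refine measurable_of_restrict_of_restrict_compl hO.measurableSet_image ?_ ?_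
  · refine Continuous.measurable ?_
    rw [continuous_iff_continuousAt]
    intro x
    exact ContinuousAt.comp (f := Subtype.val) (hO.continuousAt_lieLog x.2)
      continuous_subtype_val.continuousAt
  -- Off the image `Function.invFunOn` takes one fixed junk value, so it is measurable there.
  · have : ∀ x : ((lieExp G '' O)ᶜ : Set G), (lieLog O x.1 : E) = Classical.choice ⟨0⟩ := by
      intro x
      exact Function.invFunOn_neg x.2
    have h2 : ((lieExp G '' O)ᶜ : Set G).domRestrict (lieLog O : G → E) =
      fun _ => Classical.choice ⟨0⟩ := funext this
    rw [h2]
    exact measurable_const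

end IsWeaklyExponential

end Densities

/-! ### Partial left invariance of `ρ(X) dX` -/

section Haar

variable {E : Type*} [NormedAddCommGroup E] [NormedSpace ℝ E] [FiniteDimensional ℝ E]
  [MeasurableSpace E] [BorelSpace E]
variable {G : Type*} [TopologicalSpace G] [T2Space G] [SecondCountableTopology G]
  [ChartedSpace E G] [Group G]
  [LieGroup 𝓘(ℝ, E) ∞ G] [MeasurableSpace G] [BorelSpace G] {m : Measure G} {O : Set E}

variable (G) in
/-- The image under the exponential map of the measure `rho(X) dX` on `O`. -/
noncomputable def expMeasure (μ : Measure E) (O : Set E) : Measure G :=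
  ((μ.restrict O).withDensity fun X => ENNReal.ofReal (rho G X)).map (lieExp G)

variable [IsTopologicalGroup G]

namespace IsWeaklyExponential

variable (hO : IsWeaklyExponential G m O)
include hO

lemma measurableSet_O : MeasurableSet O := hO.isOpen.measurableSet

lemma measurable_rho : Measurable fun X : E => ENNReal.ofReal (rho G X) :=
  ENNReal.measurable_ofReal.comp hO.continuous_rho.measurable

lemma lintegral_expMeasure (μ : Measure E) {f : G → ℝ≥0∞} (hf : Measurable f) :
    ∫⁻ x, f x ∂(expMeasure G μ O) =
      ∫⁻ X in O, ENNReal.ofReal (rho G X) * f (lieExp G X) ∂μ := by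
  have hf' : Measurable fun X : E => f (lieExp G X) := hf.comp hO.continuous_lieExp.measurable
  rw [expMeasure, lintegral_map hf hO.continuous_lieExp.measurable,
    lintegral_withDensity_eq_lintegral_mul _ hO.measurable_rho hf']
  rfl

/-- With `θ(W) = log(y exp W)` and `T = θ(Z)`, the factor `y` cancels in `exp(T)⁻¹ exp(θ(W)) =
exp(Z)⁻¹ exp(W)`. Differentiating at `W = Z` gives `dExp(T) ∘ B = dExp(Z)`; take determinants. -/
lemma rho_mul_det_fderiv {y : G} {Z : E} (hZ : Z ∈ O) (hyZ : y * lieExp G Z ∈ lieExp G '' O) :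
    ∃ B : E →L[ℝ] E, HasFDerivAt (fun W : E => lieLog O (y * lieExp G W)) B Z ∧
      |B.det| * rho G (lieLog O (y * lieExp G Z) : E) = rho G Z := by
  have hd : MDifferentiableAt 𝓘(ℝ, E) 𝓘(ℝ, E) (fun W : E => lieLog O (y * lieExp G W)) Z := by
    refine ContMDiffAt.mdifferentiableAt (n := ∞) ?_ (by simp)
    exact (hO.contMDiffAt_lieLog hyZ).comp Z (((contMDiff_mul_left' y) _).comp Z
      (hO.contMDiffAt_lieExp hZ))
  refine ⟨mder (fun W : E => lieLog O (y * lieExp G W)) Z,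
    hasD_iff_hasFDerivAt.1 (hasD_mder hd), ?_⟩
  set T : E := lieLog O (y * lieExp G Z)
  have hT : T ∈ O := lieLog_mem hyZ
  have hexpT : lieExp G T = y * lieExp G Z := lieExp_lieLog hyZ
  have h1 := (hO.hasD_dExp hT).comp (hasD_mder hd) rfl
  have h2 : dExp G T ∘L mder (fun W : E => lieLog O (y * lieExp G W)) Z = dExp G Z := by
    refine h1.unique ((hO.hasD_dExp hZ).congr ?_)
    have hopen : ∀ᶠ W in 𝓝 Z, y * lieExp G W ∈ lieExp G '' O :=
      ((continuous_const.mul hO.continuous_lieExp).continuousAt).eventually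
        (hO.isOpen_image.mem_nhds hyZ)
    filter_upwards [hopen] with W hW
    simp only [Function.comp_apply]
    rw [lieExp_lieLog hW, hexpT]
    group
  rw [hO.rho_eq hT, hO.rho_eq hZ, ← h2, det_comp, abs_mul, mul_comm]

/-- Left translation by `y` need not preserve `exp O`, so invariance is available only on the part
that stays inside. There it is the change of variables `Z ↦ log(y exp Z)`, whose Jacobian has just
been matched with `ρ`. -/
lemma setLIntegral_expMeasure_mul_left (μ : Measure E) [μ.IsAddHaarMeasure] (y : G)
    {f : G → ℝ≥0∞} (hf : Measurable f) :
    ∫⁻ x in {x | y⁻¹ * x ∈ lieExp G '' O}, f x ∂(expMeasure G μ O) =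
      ∫⁻ z in {z | y * z ∈ lieExp G '' O}, f (y * z) ∂(expMeasure G μ O) := by
  have hU := hO.measurableSet_image
  have hm1 : MeasurableSet {x : G | y⁻¹ * x ∈ lieExp G '' O} := measurable_const_mul y⁻¹ hU
  have hm2 : MeasurableSet {x : G | y * x ∈ lieExp G '' O} := measurable_const_mul y hU
  have hf' : Measurable fun z => f (y * z) := hf.comp (measurable_const_mul y)
  rw [← lintegral_indicator hm1, ← lintegral_indicator hm2,
    hO.lintegral_expMeasure μ (hf.indicator hm1), hO.lintegral_expMeasure μ (hf'.indicator hm2)]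
  have hexp := hO.continuous_lieExp.measurable
  set s : Set E := {Z | Z ∈ O ∧ y * lieExp G Z ∈ lieExp G '' O}
  have hs : MeasurableSet s := hO.measurableSet_O.inter (hexp hm2)
  set t : Set E := {Z | Z ∈ O ∧ y⁻¹ * lieExp G Z ∈ lieExp G '' O}
  have ht : MeasurableSet t := hO.measurableSet_O.inter (hexp hm1)
  set θ : E → E := fun Z => lieLog O (y * lieExp G Z)
  have hθt : θ '' s = t := by
    ext X
    constructor
    · rintro ⟨Z, ⟨hZ, hyZ⟩, rfl⟩
      refine ⟨lieLog_mem hyZ, ?_⟩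
      simp only [θ]
      rw [lieExp_lieLog hyZ, inv_mul_cancel_left]
      exact ⟨Z, hZ, rfl⟩
    · rintro ⟨hX, hyX⟩
      refine ⟨lieLog O (y⁻¹ * lieExp G X), ⟨lieLog_mem hyX, ?_⟩, ?_⟩
      · rw [lieExp_lieLog hyX, mul_inv_cancel_left]
        exact ⟨X, hX, rfl⟩
      · simp only [θ]
        rw [lieExp_lieLog hyX, mul_inv_cancel_left, hO.lieLog_lieExp hX]
  have hinj : Set.InjOn θ s := by
    rintro Z ⟨hZ, hyZ⟩ W ⟨hW, hyW⟩ h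
    have h1 : lieExp G (θ Z) = lieExp G (θ W) := by rw [h]
    simp only [θ] at h1
    rw [lieExp_lieLog hyZ, lieExp_lieLog hyW] at h1
    exact hO.injOn hZ hW (mul_left_cancel h1)
  have hL : ∫⁻ X in O, ENNReal.ofReal (rho G X) *
      ({x : G | y⁻¹ * x ∈ lieExp G '' O}.indicator f) (lieExp G X) ∂μ =
      ∫⁻ X in t, ENNReal.ofReal (rho G X) * f (lieExp G X) ∂μ := by
    rw [← lintegral_indicator hO.measurableSet_O, ← lintegral_indicator ht]
    congr 1 with X
    by_cases h1 : X ∈ O <;> by_cases h2 : y⁻¹ * lieExp G X ∈ lieExp G '' O <;>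
      simp [h1, t, Set.indicator, -Set.mem_image, h2]
  have hR : ∫⁻ X in O, ENNReal.ofReal (rho G X) *
      ({x : G | y * x ∈ lieExp G '' O}.indicator fun z => f (y * z)) (lieExp G X) ∂μ =
      ∫⁻ X in s, ENNReal.ofReal (rho G X) * f (y * lieExp G X) ∂μ := by
    rw [← lintegral_indicator hO.measurableSet_O, ← lintegral_indicator hs]
    congr 1 with X
    by_cases h1 : X ∈ O <;> by_cases h2 : y * lieExp G X ∈ lieExp G '' O <;>
      simp [h1, s, Set.indicator, -Set.mem_image, h2]
  -- The change of variables formula wants a total family of derivatives; off `s` any value will do.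
  have hB : ∀ Z : E, ∃ B : E →L[ℝ] E, Z ∈ s → (HasFDerivAt θ B Z ∧
      |B.det| * rho G (θ Z) = rho G Z) := by
    intro Z
    by_cases hZ : Z ∈ s
    · obtain ⟨B, hB⟩ := hO.rho_mul_det_fderiv hZ.1 hZ.2
      exact ⟨B, fun _ => hB⟩
    · exact ⟨0, fun h => (hZ h).elim⟩
  choose B hB using hB
  rw [hL, hR, ← hθt, lintegral_image_eq_lintegral_abs_det_fderiv_mul μ hs
    (fun Z hZ => (hB Z hZ).1.hasFDerivWithinAt) hinj]
  refine setLIntegral_congr_fun hs fun Z hZ => ?_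
  rw [← mul_assoc, ← ENNReal.ofReal_mul (abs_nonneg _), (hB Z hZ).2]
  simp only [θ]
  rw [lieExp_lieLog hZ.2]

end IsWeaklyExponential

end Haar

/-! ### Identification with Haar measure up to a constant -/

section Haar

variable {E : Type*} [NormedAddCommGroup E] [NormedSpace ℝ E] [FiniteDimensional ℝ E]
  [MeasurableSpace E] [BorelSpace E]
variable {G : Type*} [TopologicalSpace G] [T2Space G] [SecondCountableTopology G]
  [ChartedSpace E G] [Group G]
  [LieGroup 𝓘(ℝ, E) ∞ G] [MeasurableSpace G] [BorelSpace G] {m : Measure G} {O : Set E}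
  [IsTopologicalGroup G] [LocallyCompactSpace G]

omit [T2Space G] in
lemma lintegral_mul_right_eq [SFinite m] [m.IsHaarMeasure] {f : G → ℝ≥0∞} (hf : Measurable f) (z : G) :
    ∫⁻ y, f (y * z) ∂m = (Measure.modularCharacterFun z : ℝ≥0∞) * ∫⁻ y, f y ∂m := by
  rw [← lintegral_map hf (measurable_mul_const z),
    Measure.map_right_mul_eq_modularCharacterFun_smul, lintegral_smul_measure]
  rfl

-- For a relatively compact open neighbourhood of `1`, the modular character is a quotient of
-- translated and untranslated measure, and the numerator is measurable in `z` by Tonelli.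
omit [T2Space G] in
lemma measurable_modularCharacterFun [SFinite m] [m.IsHaarMeasure] :
    Measurable fun z : G => (Measure.modularCharacterFun z : ℝ≥0∞) := by
  obtain ⟨K, hK, hK1⟩ := exists_compact_mem_nhds (1 : G)
  have h0 : m (interior K) ≠ 0 := by
    refine (isOpen_interior.measure_pos m ⟨1, mem_interior_iff_mem_nhds.2 hK1⟩).ne'
  have h1 : m (interior K) ≠ ⊤ := ((measure_mono interior_subset).trans_lt hK.measure_lt_top).ne
  have hm : Measurable ((interior K).indicator (1 : G → ℝ≥0∞)) :=
    measurable_one.indicator isOpen_interior.measurableSet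
  have h2 : (fun z : G => (Measure.modularCharacterFun z : ℝ≥0∞)) =
      fun z => (∫⁻ y, (interior K).indicator 1 (y * z) ∂m) / m (interior K) := by
    ext z
    rw [lintegral_mul_right_eq hm, lintegral_indicator_one isOpen_interior.measurableSet,
      ENNReal.mul_div_cancel_right h0 h1]
  rw [h2]
  refine Measurable.div_const ?_ _
  exact Measurable.lintegral_prod_left' (f := fun p : G × G => (interior K).indicator 1 (p.1 * p.2))
    (hm.comp (measurable_fst.mul measurable_snd))

instance (μ : Measure E) [SFinite μ] : SFinite (expMeasure G μ O) := by
  unfold expMeasure; infer_instance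

namespace IsWeaklyExponential

variable (hO : IsWeaklyExponential G m O)
include hO

/-- This is the classical uniqueness argument. Write the left side as the double integral of `f(x)
1_N(x⁻¹y)`, exchange the integrals, substitute `x = yz`, exchange again and right translate in `y`.
Partial invariance is enough: `N ⊆ exp O` and the symmetry of `exp O` put `y⁻¹x` in `exp O`, while
the support of `f` keeps `yz` there. -/
lemma lintegral_expMeasure_mul_measure [SFinite m] [m.IsHaarMeasure] (μ : Measure E)
    [μ.IsAddHaarMeasure] {f : G → ℝ≥0∞} (hf : Measurable f)
    (hfU : ∀ x, x ∉ lieExp G '' O → f x = 0) {N : Set G} (hN : MeasurableSet N)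
    (hNU : N ⊆ lieExp G '' O) :
    (∫⁻ x, f x ∂(expMeasure G μ O)) * m N =
      (∫⁻ z, N.indicator 1 z⁻¹ * (Measure.modularCharacterFun z : ℝ≥0∞) ∂(expMeasure G μ O)) *
        ∫⁻ y, f y ∂m := by
  set ν := expMeasure G μ O
  have hind : Measurable (N.indicator (1 : G → ℝ≥0∞)) := measurable_one.indicator hN
  have hU := hO.measurableSet_image
  have h1 : (∫⁻ x, f x ∂ν) * m N = ∫⁻ x, ∫⁻ y, f x * N.indicator 1 (x⁻¹ * y) ∂m ∂ν := by
    rw [← lintegral_mul_const _ hf]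
    congr 1 with x
    have hx : Measurable fun y => N.indicator (1 : G → ℝ≥0∞) (x⁻¹ * y) :=
      hind.comp (measurable_const_mul _)
    rw [lintegral_const_mul _ hx,
      lintegral_mul_left_eq_self (fun y => N.indicator 1 y) x⁻¹, lintegral_indicator_one hN]
  have hmeas1 : Measurable fun p : G × G => f p.1 * N.indicator 1 (p.1⁻¹ * p.2) :=
    (hf.comp measurable_fst).mul (hind.comp (measurable_fst.inv.mul measurable_snd))
  have hmeas2 : Measurable fun p : G × G => f (p.1 * p.2) * N.indicator 1 p.2⁻¹ :=
    (hf.comp (measurable_fst.mul measurable_snd)).mul (hind.comp measurable_snd.inv)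
  have h2 : ∀ y, ∫⁻ x, f x * N.indicator 1 (x⁻¹ * y) ∂ν =
      ∫⁻ z, f (y * z) * N.indicator 1 z⁻¹ ∂ν := by
    intro y
    have hm : Measurable fun x => f x * N.indicator 1 (x⁻¹ * y) :=
      hf.mul (hind.comp (measurable_inv.mul_const y))
    have h3 := hO.setLIntegral_expMeasure_mul_left μ y hm
    have hm1 : MeasurableSet {x : G | y⁻¹ * x ∈ lieExp G '' O} := measurable_const_mul y⁻¹ hU
    have hm2 : MeasurableSet {x : G | y * x ∈ lieExp G '' O} := measurable_const_mul y hU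
    rw [← lintegral_indicator hm1, ← lintegral_indicator hm2] at h3
    convert h3 using 1
    · congr 1 with x
      by_cases hx : y⁻¹ * x ∈ lieExp G '' O
      · exact (Set.indicator_of_mem (s := {x : G | y⁻¹ * x ∈ lieExp G '' O}) hx
          (fun x => f x * N.indicator 1 (x⁻¹ * y))).symm
      · refine Eq.trans ?_
          (Set.indicator_of_notMem (s := {x : G | y⁻¹ * x ∈ lieExp G '' O}) hx
            (fun x => f x * N.indicator 1 (x⁻¹ * y))).symm
        have : x⁻¹ * y ∉ N := by
          intro h
          refine hx ?_
          simpa using hO.inv_mem_image (hNU h)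
        rw [Set.indicator_of_notMem (f := (1 : G → ℝ≥0∞)) this, mul_zero]
    · congr 1 with x
      by_cases hx : y * x ∈ lieExp G '' O
      · refine Eq.trans ?_ (Set.indicator_of_mem (s := {x : G | y * x ∈ lieExp G '' O}) hx
          (fun x => f (y * x) * N.indicator 1 ((y * x)⁻¹ * y))).symm
        simp
      · refine Eq.trans ?_
          (Set.indicator_of_notMem (s := {x : G | y * x ∈ lieExp G '' O}) hx
            (fun x => f (y * x) * N.indicator 1 ((y * x)⁻¹ * y))).symm
        rw [hfU _ hx, zero_mul]
  rw [h1, lintegral_lintegral_swap hmeas1.aemeasurable]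
  simp_rw [h2]
  rw [lintegral_lintegral_swap hmeas2.aemeasurable, ← lintegral_mul_const]
  · congr 1 with z
    have hz : Measurable fun y => f (y * z) := hf.comp (measurable_mul_const z)
    rw [lintegral_mul_const _ hz, lintegral_mul_right_eq hf]
    ring
  · exact (hind.comp measurable_inv).mul (measurable_modularCharacterFun (m := m))

lemma exists_lintegral_eq [SFinite m] [m.IsHaarMeasure] (μ : Measure E) [μ.IsAddHaarMeasure] :
    ∃ c : ℝ≥0∞, c ≠ 0 ∧ c ≠ ⊤ ∧ ∀ f : G → ℝ≥0∞, Measurable f →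
      ∫⁻ x, f x ∂m = c * ∫⁻ X in O, ENNReal.ofReal (rho G X) * f (lieExp G X) ∂μ := by
  have hU := hO.measurableSet_image
  obtain ⟨K, hK, hKU⟩ := exists_compact_subset hO.isOpen_image hO.one_mem_image
  obtain ⟨hK1, hKU⟩ := hKU
  set N := interior K
  have hN : MeasurableSet N := isOpen_interior.measurableSet
  have hNU : N ⊆ lieExp G '' O := interior_subset.trans hKU
  have hN0 : m N ≠ 0 := (isOpen_interior.measure_pos m ⟨1, hK1⟩).ne'
  have hN1 : m N ≠ ⊤ := ((measure_mono interior_subset).trans_lt hK.measure_lt_top).ne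
  set C := ∫⁻ z, N.indicator 1 z⁻¹ * (Measure.modularCharacterFun z : ℝ≥0∞) ∂(expMeasure G μ O)
  have key : ∀ f : G → ℝ≥0∞, Measurable f → (∀ x, x ∉ lieExp G '' O → f x = 0) →
      (∫⁻ X in O, ENNReal.ofReal (rho G X) * f (lieExp G X) ∂μ) * m N = C * ∫⁻ y, f y ∂m := by
    intro f hf hfU
    rw [← hO.lintegral_expMeasure μ hf]
    exact hO.lintegral_expMeasure_mul_measure μ hf hfU hN hNU
  -- Test with the indicator of `N`: its `ρ(X) dX`-integral is finite, since `log` maps the compact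
  -- set `K` to a compact set on which `ρ` is bounded.
  have hC1 : C ≠ ⊤ := by
    intro hC
    have h := key (N.indicator 1) (measurable_one.indicator hN)
      (fun x hx => Set.indicator_of_notMem (fun h => hx (hNU h)) _)
    rw [lintegral_indicator_one hN, hC, ENNReal.top_mul hN0] at h
    have h2 : ∫⁻ X in O, ENNReal.ofReal (rho G X) * N.indicator 1 (lieExp G X) ∂μ ≠ ⊤ := by
      have hcomp : IsCompact (lieLog O '' K : Set E) :=
        hK.image_of_continuousOn fun x hx => (hO.continuousAt_lieLog (hKU hx)).continuousWithinAt
      obtain ⟨B, hB⟩ := hcomp.exists_bound_of_continuousOn hO.continuous_rho.continuousOn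
      have hle : ∫⁻ X in O, ENNReal.ofReal (rho G X) * N.indicator 1 (lieExp G X) ∂μ ≤
          ∫⁻ X, (lieLog O '' K).indicator (fun _ => ENNReal.ofReal B) X ∂μ := by
        rw [← lintegral_indicator hO.measurableSet_O]
        refine lintegral_mono fun X => ?_
        by_cases hX : X ∈ O
        · rw [Set.indicator_of_mem hX]
          by_cases hXN : lieExp G X ∈ N
          · have hXK : X ∈ (lieLog O '' K : Set E) :=
              ⟨lieExp G X, interior_subset hXN, hO.lieLog_lieExp hX⟩
            rw [Set.indicator_of_mem hXN, Set.indicator_of_mem hXK, Pi.one_apply, mul_one]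
            exact ENNReal.ofReal_le_ofReal ((le_abs_self _).trans (hB X hXK))
          · rw [Set.indicator_of_notMem hXN, mul_zero]
            exact zero_le
        · rw [Set.indicator_of_notMem hX]
          exact zero_le
      refine (hle.trans_lt ?_).ne
      rw [lintegral_indicator_const hcomp.measurableSet]
      exact ENNReal.mul_lt_top ENNReal.ofReal_lt_top hcomp.measure_lt_top
    exact (ENNReal.mul_lt_top h2.lt_top hN1.lt_top).ne h
  -- Test with the indicator of `exp O`: positivity of `ρ` would force the nonempty open set `O` to
  -- be null.
  have hC0 : C ≠ 0 := by
    intro hC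
    have h := key ((lieExp G '' O).indicator 1) (measurable_one.indicator hU)
      (fun x hx => Set.indicator_of_notMem hx _)
    have hmm : Measurable fun X : E =>
        ENNReal.ofReal (rho G X) * (lieExp G '' O).indicator (1 : G → ℝ≥0∞) (lieExp G X) :=
      hO.measurable_rho.mul
        ((measurable_one.indicator hU).comp hO.continuous_lieExp.measurable)
    rw [hC, zero_mul, mul_eq_zero, or_iff_left hN0, lintegral_eq_zero_iff hmm] at h
    rw [Filter.EventuallyEq, ae_restrict_iff' hO.measurableSet_O] at h
    have h2 : μ O = 0 := by
      refine measure_mono_null (fun X hX => ?_) h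
      simp only [Set.mem_ofPred_eq, Set.mem_compl_iff]
      intro hc
      have := hc hX
      rw [Set.indicator_of_mem (Set.mem_image_of_mem _ hX)] at this
      simp at this
      linarith [hO.rho_pos hX]
    exact (hO.isOpen.measure_pos μ ⟨0, hO.zero_mem⟩).ne' h2
  refine ⟨m N / C, ENNReal.div_ne_zero.2 ⟨hN0, hC1⟩, ENNReal.div_ne_top hN1 hC0, fun f hf => ?_⟩
  have h1 := key ((lieExp G '' O).indicator f) (hf.indicator hU)
    (fun x hx => Set.indicator_of_notMem hx _)
  have h2 : ∫⁻ y, (lieExp G '' O).indicator f y ∂m = ∫⁻ y, f y ∂m := by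
    refine lintegral_congr_ae ?_
    have := hO.null_compl
    filter_upwards [compl_mem_ae_iff.2 this] with y hy
    rw [Set.indicator_of_mem (by simpa using hy)]
  have h3 : ∫⁻ X in O, ENNReal.ofReal (rho G X) * (lieExp G '' O).indicator f (lieExp G X) ∂μ =
      ∫⁻ X in O, ENNReal.ofReal (rho G X) * f (lieExp G X) ∂μ := by
    refine setLIntegral_congr_fun hO.measurableSet_O fun X hX => ?_
    rw [Set.indicator_of_mem (Set.mem_image_of_mem _ hX)]
  rw [h2, h3] at h1
  rw [div_eq_mul_inv, mul_assoc, mul_left_comm, mul_comm (m N), h1, ← mul_assoc,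
    ENNReal.inv_mul_cancel hC0 hC1, one_mul]

end IsWeaklyExponential

end Haar

/-! ### The normalizing constant and the modular function -/

section Haar

/-- The shrinking sets are arbitrary because both balls and their images under `Ad g` are used
below. -/
lemma tendsto_setLIntegral_div_measure {E : Type*} [TopologicalSpace E] [MeasurableSpace E]
    {μ : Measure E} {f : E → ℝ≥0∞} {x : E} (hf : ContinuousAt f x) {ι : Type*} {l : Filter ι}
    {S : ι → Set E} (hS : Tendsto S l (𝓝 x).smallSets) (hm : ∀ i, MeasurableSet (S i))
    (h0 : ∀ᶠ i in l, μ (S i) ≠ 0) (h1 : ∀ᶠ i in l, μ (S i) ≠ ⊤) :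
    Tendsto (fun i => (∫⁻ X in S i, f X ∂μ) / μ (S i)) l (𝓝 (f x)) := by
  rw [tendsto_smallSets_iff] at hS
  refine tendsto_order.2 ⟨fun a ha => ?_, fun b hb => ?_⟩
  · obtain ⟨a', ha', ha''⟩ := exists_between ha
    filter_upwards [h0, h1, hS _ (hf.eventually (lt_mem_nhds ha''))] with i h0 h1 hi
    refine ha'.trans_le ?_
    rw [ENNReal.le_div_iff_mul_le (Or.inl h0) (Or.inl h1), ← setLIntegral_const]
    exact setLIntegral_mono' (hm i) fun y hy => (hi hy).le
  · obtain ⟨b', hb', hb''⟩ := exists_between hb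
    filter_upwards [h0, h1, hS _ (hf.eventually (gt_mem_nhds hb'))] with i h0 h1 hi
    refine lt_of_le_of_lt ?_ hb''
    rw [ENNReal.div_le_iff_le_mul (Or.inl h0) (Or.inl h1), ← setLIntegral_const]
    exact setLIntegral_mono' (hm i) fun y hy => (hi hy).le

variable {E : Type*} [NormedAddCommGroup E] [NormedSpace ℝ E] [FiniteDimensional ℝ E]
  {G : Type*} [TopologicalSpace G] [T2Space G] [ChartedSpace E G] [Group G]
  [LieGroup 𝓘(ℝ, E) ∞ G]

/-- The conjugated one-parameter subgroup has initial velocity `Ad g X`; being a homomorphism, it is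
an integral curve at every time. -/
lemma lieExp_Ad (g : G) (X : E) : lieExp G (Ad g X) = g * lieExp G X * g⁻¹ := by
  have h0 : HasD (fun s : ℝ => g * lieExp G (s • X) * g⁻¹) 0
      ((1 : ℝ →L[ℝ] ℝ).smulRight (Ad g X)) :=
    (hasD_conj (E := E) g).comp_curve (hasD_lieExp_smul_zero X) (by simp)
  rw [lieExp_eq_of_isMIntegralCurve (X := Ad g X)
    (γ := fun t : ℝ => g * lieExp G (t • X) * g⁻¹) (by simp), one_smul]
  intro t
  refine hasD_curve_iff.2 ?_
  have hs : HasD (fun s : ℝ => s - t) t ((1 : ℝ →L[ℝ] ℝ).smulRight (1 : ℝ)) := by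
    rw [hasD_iff_hasFDerivAt]
    exact ((hasDerivAt_id t).sub_const t).hasFDerivAt
  have h1 := h0.comp hs (sub_self t)
  have h2 : ((1 : ℝ →L[ℝ] ℝ).smulRight (Ad g X)) ∘L ((1 : ℝ →L[ℝ] ℝ).smulRight (1 : ℝ)) =
      (1 : ℝ →L[ℝ] ℝ).smulRight (Ad g X : E) := ContinuousLinearMap.ext_ring (by simp)
  rw [h2] at h1
  have h3 := (hasD_mul_left (E := E) (g * lieExp G (t • X) * g⁻¹)).comp_curve h1 (by simp)
  refine h3.congr (Eventually.of_forall fun s => ?_)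
  have : s • X = (t + (s - t)) • X := by congr 1; ring
  simp only [Function.comp_apply]
  rw [this, lieExp_add_smul]
  group

lemma Ad_inv_apply_Ad (g : G) (X : E) : Ad g⁻¹ (Ad g X) = X := by
  have h := Ad_mul (E := E) g⁻¹ g
  rw [inv_mul_cancel, Ad_one] at h
  exact (congrArg (fun A : E →L[ℝ] E => A X) h).symm

lemma Ad_image_eq (g : G) (S : Set E) : Ad g '' S = Ad g⁻¹ ⁻¹' S := by
  refine congrFun (Set.image_eq_preimage_of_inverse (fun X : E => Ad_inv_apply_Ad g X)
    fun X : E => ?_) S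
  simpa using Ad_inv_apply_Ad g⁻¹ X

variable [MeasurableSpace E] [BorelSpace E] [SecondCountableTopology G]
  [MeasurableSpace G] [BorelSpace G] {m : Measure G} {O : Set E}
  [IsTopologicalGroup G] [LocallyCompactSpace G]

namespace IsWeaklyExponential

variable (hO : IsWeaklyExponential G m O)
include hO

lemma measurableSet_lieExp_image {S : Set E} (hS : MeasurableSet S) (hSO : S ⊆ O) :
    MeasurableSet (lieExp G '' S) := by
  have h : lieExp G '' S = lieExp G '' O ∩ lieLog O ⁻¹' S := by
    ext a
    constructor
    · rintro ⟨X, hX, rfl⟩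
      exact ⟨⟨X, hSO hX, rfl⟩, by rwa [Set.mem_preimage, hO.lieLog_lieExp (hSO hX)]⟩
    · rintro ⟨ha, haS⟩
      exact ⟨lieLog O a, haS, lieExp_lieLog ha⟩
  rw [h]
  exact hO.measurableSet_image.inter (hO.measurable_lieLog hS)

lemma measure_lieExp_image {μ : Measure E} {c : ℝ≥0∞}
    (hc : ∀ f : G → ℝ≥0∞, Measurable f →
      ∫⁻ x, f x ∂m = c * ∫⁻ X in O, ENNReal.ofReal (rho G X) * f (lieExp G X) ∂μ)
    {S : Set E} (hS : MeasurableSet S) (hSO : S ⊆ O) :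
    m (lieExp G '' S) = c * ∫⁻ X in S, ENNReal.ofReal (rho G X) ∂μ := by
  have hm := hO.measurableSet_lieExp_image hS hSO
  rw [← lintegral_indicator_one hm, hc _ (measurable_one.indicator hm)]
  congr 1
  rw [← lintegral_indicator hO.measurableSet_O, ← lintegral_indicator hS]
  congr 1 with X
  by_cases hX : X ∈ O
  · rw [Set.indicator_of_mem hX]
    by_cases hXS : X ∈ S
    · rw [Set.indicator_of_mem (Set.mem_image_of_mem _ hXS), Set.indicator_of_mem hXS]
      simp
    · rw [Set.indicator_of_notMem (s := S) hXS, Set.indicator_of_notMem, mul_zero]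
      rintro ⟨Y, hY, hYX⟩
      exact hXS (hO.injOn (hSO hY) hX hYX ▸ hY)
  · rw [Set.indicator_of_notMem hX, Set.indicator_of_notMem fun h => hX (hSO h)]

lemma tendsto_measure_lieExp_image_div {μ : Measure E} {c : ℝ≥0∞} (hc' : c ≠ ⊤)
    (hc : ∀ f : G → ℝ≥0∞, Measurable f →
      ∫⁻ x, f x ∂m = c * ∫⁻ X in O, ENNReal.ofReal (rho G X) * f (lieExp G X) ∂μ)
    {ι : Type*} {l : Filter ι} {S : ι → Set E} (hS : Tendsto S l (𝓝 0).smallSets)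
    (hm : ∀ i, MeasurableSet (S i))
    (h0 : ∀ᶠ i in l, μ (S i) ≠ 0) (h1 : ∀ᶠ i in l, μ (S i) ≠ ⊤) :
    Tendsto (fun i => m (lieExp G '' S i) / μ (S i)) l (𝓝 c) := by
  have hf : Continuous fun X : E => ENNReal.ofReal (rho G X) :=
    ENNReal.continuous_ofReal.comp hO.continuous_rho
  have h := ENNReal.Tendsto.const_mul (a := c)
    (tendsto_setLIntegral_div_measure hf.continuousAt hS hm h0 h1) (Or.inr hc')
  rw [hO.rho_zero, ENNReal.ofReal_one, mul_one] at h
  refine h.congr' ?_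
  filter_upwards [tendsto_smallSets_iff.1 hS _ (hO.isOpen.mem_nhds hO.zero_mem)] with i hi
  rw [hO.measure_lieExp_image hc (hm i) hi, mul_div_assoc]

omit [FiniteDimensional ℝ E] hO in
lemma tendsto_ball_smallSets :
    Tendsto (fun r : ℝ => Metric.ball (0 : E) r) (𝓝[>] 0) (𝓝 0).smallSets := by
  rw [tendsto_smallSets_iff]
  intro t ht
  obtain ⟨ε, hε, hεt⟩ := Metric.mem_nhds_iff.1 ht
  filter_upwards [Ioo_mem_nhdsGT hε] with r hr
  exact (Metric.ball_subset_ball hr.2.le).trans hεt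

/-- Since `ρ` is continuous with `ρ(0) = 1`, the quotients in the definition of `density` converge
to `c`, so its limit is a genuine one. -/
lemma coe_density [SFinite m] [m.IsHaarMeasure] {c : ℝ≥0∞} (hc' : c ≠ ⊤)
    (hc : ∀ f : G → ℝ≥0∞, Measurable f → ∫⁻ x, f x ∂m =
      c * ∫⁻ X in O, ENNReal.ofReal (rho G X) * f (lieExp G X) ∂(Module.finBasis ℝ E).addHaar) :
    (density E m : ℝ≥0∞) = c := by
  have h := hO.tendsto_measure_lieExp_image_div hc' hc (tendsto_ball_smallSets (E := E))
    (fun r => measurableSet_ball)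
    (by
      filter_upwards [self_mem_nhdsWithin] with r hr
      exact (Metric.measure_ball_pos _ _ hr).ne')
    (Eventually.of_forall fun r => measure_ball_lt_top.ne)
  have h2 := (ENNReal.tendsto_toReal hc').comp h
  have h3 : Tendsto (fun r : ℝ => (m (lieExp G '' Metric.ball (0 : E) r)).toReal /
      ((Module.finBasis ℝ E).addHaar (Metric.ball (0 : E) r)).toReal) (𝓝[>] 0) (𝓝 c.toReal) :=
    h2.congr fun r => ENNReal.toReal_div _ _
  rw [density, h3.limUnder_eq]
  exact ENNReal.ofReal_toReal hc'

lemma lintegral_eq [SFinite m] [m.IsHaarMeasure] {f : G → ℝ≥0∞} (hf : Measurable f) :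
    ∫⁻ x, f x ∂m = ∫⁻ X in O, ENNReal.ofReal (rho G X) * f (lieExp G X) ∂(measX E m) := by
  obtain ⟨c, -, h1, hc⟩ := hO.exists_lintegral_eq (Module.finBasis ℝ E).addHaar
  rw [hc f hf, ← hO.coe_density h1 hc, measX, Measure.restrict_smul]
  exact (lintegral_smul_measure (R := ℝ≥0∞) (density E m : ℝ≥0∞) _).symm

lemma density_ne_zero [SFinite m] [m.IsHaarMeasure] : density E m ≠ 0 := by
  obtain ⟨c, h0, h1, hc⟩ := hO.exists_lintegral_eq (Module.finBasis ℝ E).addHaar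
  have := hO.coe_density h1 hc
  intro h
  rw [h] at this
  exact h0 this.symm

/-- Compare a small ball `B` with `Ad g B`. Volume is multiplied by `|det Ad g|`. Since `exp(Ad g B)
= g exp(B) g⁻¹`, Haar measure is multiplied by the modular character. Both ratios of measure to
volume tend to the same `c`, which is neither zero nor infinite. -/
lemma modularCharacterFun_eq_delta [SFinite m] [m.IsHaarMeasure] (g : G) :
    (Measure.modularCharacterFun g : ℝ≥0∞) = ENNReal.ofReal (delta E g) := by
  set μ := (Module.finBasis ℝ E).addHaar
  obtain ⟨c, h0, h1, hc⟩ := hO.exists_lintegral_eq μ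
  have hμ : ∀ r : ℝ, μ (Ad g '' Metric.ball (0 : E) r) =
      ENNReal.ofReal (delta E g) * μ (Metric.ball (0 : E) r) := fun r =>
    Measure.addHaar_image_continuousLinearMap μ (Ad g) _
  have hd0 : ENNReal.ofReal (delta E g) ≠ 0 := by simpa using delta_pos (E := E) g
  have hpos : ∀ᶠ r in 𝓝[>] (0 : ℝ), μ (Metric.ball (0 : E) r) ≠ 0 := by
    filter_upwards [self_mem_nhdsWithin] with r hr
    exact (Metric.measure_ball_pos _ _ hr).ne'
  have hsmall := tendsto_ball_smallSets (E := E)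
  have hsmall' : Tendsto (fun r : ℝ => Ad g '' Metric.ball (0 : E) r) (𝓝[>] 0)
      (𝓝 0).smallSets := by
    rw [tendsto_smallSets_iff] at hsmall ⊢
    intro t ht
    have : Ad g ⁻¹' t ∈ 𝓝 (0 : E) := (Ad (E := E) g).continuous.continuousAt (by simpa using ht)
    filter_upwards [hsmall _ this] with r hr using Set.image_subset_iff.2 hr
  have l1 := hO.tendsto_measure_lieExp_image_div h1 hc hsmall (fun r => measurableSet_ball) hpos
    (Eventually.of_forall fun r => measure_ball_lt_top.ne)
  have l2 := hO.tendsto_measure_lieExp_image_div h1 hc hsmall'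
    (fun r => by
      rw [Ad_image_eq]; exact (Ad g⁻¹).continuous.measurable measurableSet_ball)
    (by filter_upwards [hpos] with r hr; rw [hμ]; exact mul_ne_zero hd0 hr)
    (Eventually.of_forall fun r => by
      rw [hμ]; exact ENNReal.mul_ne_top ENNReal.ofReal_ne_top measure_ball_lt_top.ne)
  have hm : ∀ᶠ r in 𝓝[>] (0 : ℝ), m (lieExp G '' (Ad g '' Metric.ball (0 : E) r)) =
      (Measure.modularCharacterFun g : ℝ≥0∞) * m (lieExp G '' Metric.ball (0 : E) r) := by
    filter_upwards [tendsto_smallSets_iff.1 hsmall _ (hO.isOpen.mem_nhds hO.zero_mem)] with r hr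
    have hB := hO.measurableSet_lieExp_image measurableSet_ball hr
    have h3 := lintegral_mul_right_eq (m := m) (measurable_one.indicator hB) g
    rw [lintegral_indicator_one hB] at h3
    rw [← h3]
    have h4 : (fun y : G => g * y) ⁻¹' (lieExp G '' (Ad g '' Metric.ball (0 : E) r)) =
        (fun y : G => y * g) ⁻¹' (lieExp G '' Metric.ball (0 : E) r) := by
      ext y
      simp only [Set.mem_preimage, Set.mem_image, exists_exists_and_eq_and, lieExp_Ad]
      refine exists_congr fun X => and_congr_right fun _ => ?_
      rw [mul_inv_eq_iff_eq_mul, mul_assoc, mul_right_inj]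
    rw [← measure_preimage_mul m g, h4, ← lintegral_indicator_one (measurable_mul_const g hB)]
    rfl
  have l3 : Tendsto (fun r : ℝ => (Measure.modularCharacterFun g : ℝ≥0∞) *
      (ENNReal.ofReal (delta E g))⁻¹ * (m (lieExp G '' Metric.ball (0 : E) r) /
        μ (Metric.ball (0 : E) r))) (𝓝[>] 0) (𝓝 c) := by
    refine l2.congr' ?_
    filter_upwards [hm, hpos] with r h3 h4
    rw [h3, hμ, div_eq_mul_inv, div_eq_mul_inv, ENNReal.mul_inv (Or.inl hd0)
      (Or.inl ENNReal.ofReal_ne_top)]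
    ring
  have l4 := ENNReal.Tendsto.const_mul (a := (Measure.modularCharacterFun g : ℝ≥0∞) *
      (ENNReal.ofReal (delta E g))⁻¹) l1
      (Or.inr (ENNReal.mul_ne_top ENNReal.coe_ne_top (ENNReal.inv_ne_top.2 hd0)))
  have h5 := tendsto_nhds_unique l4 l3
  have h6 : (Measure.modularCharacterFun g : ℝ≥0∞) * (ENNReal.ofReal (delta E g))⁻¹ = 1 :=
    (ENNReal.mul_eq_right h0 h1).1 h5
  calc (Measure.modularCharacterFun g : ℝ≥0∞)
      = (Measure.modularCharacterFun g : ℝ≥0∞) * ((ENNReal.ofReal (delta E g))⁻¹ *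
        ENNReal.ofReal (delta E g)) := by
        rw [ENNReal.inv_mul_cancel hd0 ENNReal.ofReal_ne_top, mul_one]
    _ = _ := by rw [← mul_assoc, h6, one_mul]

lemma lintegral_mul_right [SFinite m] [m.IsHaarMeasure] {f : G → ℝ≥0∞} (hf : Measurable f)
    (g : G) : ∫⁻ y, f (y * g) ∂m = ENNReal.ofReal (delta E g) * ∫⁻ y, f y ∂m := by
  rw [lintegral_mul_right_eq hf, hO.modularCharacterFun_eq_delta]

end IsWeaklyExponential

end Haar

/-! ### Plancherel for the pairing of the Lie algebra with its dual -/

section Plancherel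

lemma eLpNorm_two_sq {α : Type*} [MeasurableSpace α] (μ : Measure α) (f : α → ℂ) :
    eLpNorm f 2 μ ^ 2 = ∫⁻ x, ‖f x‖ₑ ^ 2 ∂μ := by
  have := eLpNorm_nnreal_pow_eq_lintegral (μ := μ) (f := f) (p := 2) two_ne_zero
  simpa using this

-- The `L²` transform is isometric but abstract. Testing against smooth compactly supported
-- functions, through tempered distributions on one side and Fubini on the other, shows that it
-- agrees almost everywhere with the Fourier integral of `u`.
open FourierTransform SchwartzMap in
lemma eLpNorm_fourier {V : Type*} [NormedAddCommGroup V] [InnerProductSpace ℝ V]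
    [FiniteDimensional ℝ V] [MeasurableSpace V] [BorelSpace V] {u : V → ℂ} (hu : Integrable u)
    (hu2 : MemLp u 2) : eLpNorm (𝓕 u) 2 volume = eLpNorm u 2 volume := by
  set W : Lp ℂ 2 (volume : Measure V) := 𝓕 (hu2.toLp u)
  have hc : Continuous (𝓕 u) :=
    VectorFourier.fourierIntegral_continuous Real.continuous_fourierChar
      (L := innerₗ V) (by exact continuous_inner) hu
  have hW : LocallyIntegrable (W : V → ℂ) volume :=
    (Lp.memLp W).locallyIntegrable (by norm_num)
  have key : ∀ᵐ x, (W : V → ℂ) x = 𝓕 u x := by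
    refine ae_eq_of_integral_contDiff_smul_eq hW hc.locallyIntegrable fun g hg hgs => ?_
    have hgs' : HasCompactSupport fun x => (g x : ℂ) := hgs.comp_left Complex.ofReal_zero
    set s : 𝓢(V, ℂ) := hgs'.toSchwartzMap (Complex.ofRealCLM.contDiff.comp hg)
    have hs : ∀ x, s x = (g x : ℂ) := fun x => rfl
    have h1 := congrArg (fun T => T s) (Lp.fourier_toTemperedDistribution_eq (hu2.toLp u))
    simp only [TemperedDistribution.fourier_apply, Lp.toTemperedDistribution_apply] at h1
    have h2 : ∫ x, (𝓕 s) x • (hu2.toLp u : V → ℂ) x = ∫ x, (𝓕 s) x • u x := by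
      refine integral_congr_ae ?_
      filter_upwards [hu2.coeFn_toLp] with x hx
      rw [hx]
    rw [h2] at h1
    have h3 := VectorFourier.integral_fourierIntegral_smul_eq_flip (μ := volume) (ν := volume)
      (L := innerₗ V) Real.continuous_fourierChar (by exact continuous_inner)
      s.integrable hu
    rw [flip_innerₗ] at h3
    have h4 : ∫ x, g x • (W : V → ℂ) x = ∫ x, s x • (W : V → ℂ) x := by
      simp only [hs, Complex.real_smul, smul_eq_mul]
    have h5 : ∫ x, g x • 𝓕 u x = ∫ x, s x • 𝓕 u x := by
      simp only [hs, Complex.real_smul, smul_eq_mul]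
    rw [h4, h5]
    exact h1.symm.trans h3
  have h6 : ‖W‖ₑ = ‖hu2.toLp u‖ₑ := by
    rw [← ofReal_norm, ← ofReal_norm, Lp.norm_fourier_eq]
  rw [← eLpNorm_congr_ae key, ← eLpNorm_congr_ae hu2.coeFn_toLp, ← Lp.enorm_def, h6, Lp.enorm_def]

lemma lintegral_comp_inv_smul {V : Type*} [NormedAddCommGroup V] [NormedSpace ℝ V]
    [FiniteDimensional ℝ V] [MeasurableSpace V] [BorelSpace V] (μ : Measure V)
    [μ.IsAddHaarMeasure] {c : ℝ} (hc : c ≠ 0) (f : V → ℝ≥0∞) (hf : Measurable f) :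
    ∫⁻ x, f (c⁻¹ • x) ∂μ = ENNReal.ofReal (|c| ^ Module.finrank ℝ V) * ∫⁻ x, f x ∂μ := by
  rw [← lintegral_map hf (measurable_const_smul c⁻¹),
    Measure.map_addHaar_smul μ (inv_ne_zero hc), lintegral_smul_measure]
  simp [abs_pow]

variable {E : Type*} [NormedAddCommGroup E] [NormedSpace ℝ E] [FiniteDimensional ℝ E]
  [MeasurableSpace E] [BorelSpace E]

/-- The coordinates in a basis, with values in Euclidean space. -/
noncomputable def coord {ι : Type*} [Fintype ι] (b : Module.Basis ι ℝ E) :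
    E ≃L[ℝ] EuclideanSpace ℝ ι :=
  (b.equivFun ≪≫ₗ (WithLp.linearEquiv 2 ℝ (ι → ℝ)).symm).toContinuousLinearEquiv

lemma coord_apply {ι : Type*} [Fintype ι] (b : Module.Basis ι ℝ E) (X : E) (i : ι) :
    coord b X i = b.repr X i := rfl

lemma measurePreserving_coord {ι : Type*} [Fintype ι] (b : Module.Basis ι ℝ E) :
    MeasurePreserving (coord b) b.addHaar volume := by
  refine ⟨(coord b).continuous.measurable, ?_⟩
  classical
  rw [Module.Basis.map_addHaar, ← (EuclideanSpace.basisFun ι ℝ).addHaar_eq_volume]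
  congr 1
  refine Module.Basis.eq_of_apply_eq fun i => ?_
  ext j
  simp [coord_apply, Finsupp.single_apply, eq_comm]

lemma inner_coord_dualBasis (p : E →L[ℝ] ℝ) (X : E) :
    inner ℝ (coord (Module.finBasis ℝ E) X) (coord (dualBasis E) p) = p X := by
  have h : ∀ i, (dualBasis E).repr p i = p (Module.finBasis ℝ E i) := by
    intro i
    simp [dualBasis, Module.Basis.dualBasis_repr]
  conv_rhs => rw [← (Module.finBasis ℝ E).sum_repr X]
  rw [PiLp.inner_apply, map_sum]
  refine Finset.sum_congr rfl fun i _ => ?_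
  simp [coord_apply, h, mul_comm]

-- In coordinates of dual bases the pairing is the Euclidean inner product. The kernel `e^{-2πi⟨v,
-- w⟩}` matches the phase at frequency `p / (2πħ)`, the source of the factor `|2πħ|ⁿ`.
open FourierTransform in
lemma integral_mul_phase_eq_fourier {ħ : ℝ} (hħ : ħ ≠ 0) (u : E → ℂ) (p : E →L[ℝ] ℝ) :
    ∫ X, u X * Complex.exp (-(Complex.I / (ħ : ℂ)) * ((p X : ℝ) : ℂ))
        ∂(Module.finBasis ℝ E).addHaar =
      𝓕 (u ∘ (coord (Module.finBasis ℝ E)).symm)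
        ((2 * Real.pi * ħ)⁻¹ • coord (dualBasis E) p) := by
  rw [Real.fourier_eq', ← (measurePreserving_coord (Module.finBasis ℝ E)).integral_comp
    (coord (Module.finBasis ℝ E)).toHomeomorph.measurableEmbedding]
  refine integral_congr_ae (Eventually.of_forall fun X => ?_)
  dsimp only [Function.comp_apply]
  rw [ContinuousLinearEquiv.symm_apply_apply, inner_smul_right, inner_coord_dualBasis, smul_eq_mul,
    mul_comm]
  congr 2
  have h1 : (ħ : ℂ) ≠ 0 := by exact_mod_cast hħ
  have h2 : (Real.pi : ℂ) ≠ 0 := by exact_mod_cast Real.pi_ne_zero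
  push_cast
  field_simp

open FourierTransform in
lemma lintegral_enorm_sq_integral_mul_phase {ħ : ℝ} (hħ : ħ ≠ 0) {u : E → ℂ}
    (hu : Integrable u (Module.finBasis ℝ E).addHaar)
    (hu2 : MemLp u 2 (Module.finBasis ℝ E).addHaar) :
    ∫⁻ p, ‖∫ X, u X * Complex.exp (-(Complex.I / (ħ : ℂ)) * ((p X : ℝ) : ℂ))
        ∂(Module.finBasis ℝ E).addHaar‖ₑ ^ 2 ∂(dualBasis E).addHaar =
      ENNReal.ofReal (|2 * Real.pi * ħ| ^ Module.finrank ℝ E) *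
        ∫⁻ X, ‖u X‖ₑ ^ 2 ∂(Module.finBasis ℝ E).addHaar := by
  set b := Module.finBasis ℝ E
  have hb : MeasurePreserving (coord b).symm volume b.addHaar :=
    (measurePreserving_coord b).symm (coord b).toHomeomorph.toMeasurableEquiv
  have hv : Integrable (u ∘ (coord b).symm) :=
    (hb.integrable_comp_emb (coord b).symm.toHomeomorph.measurableEmbedding).2 hu
  have hv2 : MemLp (u ∘ (coord b).symm) 2 := hu2.comp_measurePreserving hb
  have hc : Continuous (𝓕 (u ∘ (coord b).symm)) :=
    VectorFourier.fourierIntegral_continuous Real.continuous_fourierChar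
      (L := innerₗ _) (by exact continuous_inner) hv
  have hc' : Measurable fun w => ‖𝓕 (u ∘ (coord b).symm) w‖ₑ ^ 2 :=
    ((ENNReal.continuous_pow 2).comp hc.enorm).measurable
  have hπ : 2 * Real.pi * ħ ≠ 0 := mul_ne_zero (by positivity) hħ
  simp_rw [b, integral_mul_phase_eq_fourier hħ u]
  have h1 := (measurePreserving_coord (dualBasis E)).lintegral_comp
    (hc'.comp (measurable_const_smul (2 * Real.pi * ħ)⁻¹))
  simp only [Function.comp_def] at h1
  refine h1.trans ?_
  have h2 := lintegral_comp_inv_smul volume hπ _ hc'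
  rw [finrank_euclideanSpace_fin] at h2
  refine h2.trans ?_
  rw [← eLpNorm_two_sq, ← eLpNorm_two_sq, eLpNorm_fourier hv hv2,
    eLpNorm_comp_measurePreserving hu2.1 hb]

end Plancherel

/-! ### The Fourier transform in the momentum variable on `L²` -/

section PartialFourier

variable {E : Type*} [NormedAddCommGroup E] [NormedSpace ℝ E] [FiniteDimensional ℝ E]
  [MeasurableSpace E] [BorelSpace E]
variable {G : Type*} [TopologicalSpace G] [ChartedSpace E G] [Group G] [MeasurableSpace G]

lemma trunc_sub (R : ℝ) (φ ψ : G × E → ℂ) : trunc R (φ - ψ) = trunc R φ - trunc R ψ :=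
  Set.indicator_sub' _ _ _

lemma trunc_trunc {R T : ℝ} (h : R ≤ T) (φ : G × E → ℂ) : trunc T (trunc R φ) = trunc R φ := by
  rw [trunc, trunc, Set.indicator_indicator, Set.inter_eq_right.2]
  exact Set.prod_mono_right (Metric.closedBall_subset_closedBall h)

lemma measurableSet_truncSet (R : ℝ) :
    MeasurableSet ((Set.univ : Set G) ×ˢ Metric.closedBall (0 : E) R) :=
  MeasurableSet.univ.prod Metric.isClosed_closedBall.measurableSet

lemma memLp_trunc {m : Measure G} {φ : G × E → ℂ} (hφ : MemLp φ 2 (measN E m)) (R : ℝ) :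
    MemLp (trunc R φ) 2 (measN E m) :=
  hφ.indicator (measurableSet_truncSet R)

lemma tendsto_eLpNorm_sub_trunc {m : Measure G} {φ : G × E → ℂ} (hφ : MemLp φ 2 (measN E m)) :
    Tendsto (fun R : ℝ => eLpNorm (φ - trunc R φ) 2 (measN E m)) atTop (𝓝 0) := by
  have h : Tendsto (fun R : ℝ => ∫⁻ x, ‖(φ - trunc R φ) x‖ₑ ^ 2 ∂(measN E m)) atTop
      (𝓝 (∫⁻ _, 0 ∂(measN E m))) := by
    refine tendsto_of_seq_tendsto fun R hR => ?_
    refine tendsto_lintegral_of_dominated_convergence' (fun x => ‖φ x‖ₑ ^ 2)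
      (fun n => (hφ.sub (memLp_trunc hφ (R n))).1.enorm.pow_const 2) (fun n => ?_) ?_ ?_
    · refine Eventually.of_forall fun x => ?_
      by_cases hx : x ∈ (Set.univ : Set G) ×ˢ Metric.closedBall (0 : E) (R n)
      · simp [trunc, Set.indicator_of_mem hx]
      · simp [trunc, Set.indicator_of_notMem hx]
    · rw [← eLpNorm_two_sq]
      exact ENNReal.pow_ne_top hφ.2.ne
    · refine Eventually.of_forall fun x => tendsto_const_nhds.congr' ?_
      filter_upwards [hR.eventually_ge_atTop ‖x.2‖] with n hn
      have hx : x ∈ (Set.univ : Set G) ×ˢ Metric.closedBall (0 : E) (R n) := by simpa using hn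
      simp [trunc, Set.indicator_of_mem hx]
  simp only [← eLpNorm_two_sq, lintegral_zero] at h
  have h2 := ((ENNReal.continuous_rpow_const (y := 1 / 2)).tendsto 0).comp h
  simp only [Function.comp_def] at h2
  have h3 : ∀ a : ℝ≥0∞, (a ^ 2) ^ (1 / 2 : ℝ) = a := fun a => by
    rw [← ENNReal.rpow_natCast, ← ENNReal.rpow_mul]; norm_num
  simp only [h3] at h2
  rwa [ENNReal.zero_rpow_of_pos (by norm_num)] at h2

variable {m : Measure G} {ħ : ℝ}

/-- With `d` the density, the squared inner integral carries `d²` and `dp` carries `d⁻¹`, leaving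
the single `d` of `dX` on the right. Dual normalization is exactly what is needed. -/
lemma lintegral_enorm_sq_slice (hd : density E m ≠ 0) (hħ : ħ ≠ 0) {u : E → ℂ}
    (hu : Integrable u (measX E m)) (hu2 : MemLp u 2 (measX E m)) :
    ∫⁻ p, ‖∫ X, u X * Complex.exp (-(Complex.I / (ħ : ℂ)) * ((p X : ℝ) : ℂ))
        ∂(measX E m)‖ₑ ^ 2 ∂(measP E m) =
      ENNReal.ofReal (|2 * Real.pi * ħ| ^ Module.finrank ℝ E) *
        ∫⁻ X, ‖u X‖ₑ ^ 2 ∂(measX E m) := by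
  have hd' : (density E m : ℝ≥0∞) ≠ 0 := by exact_mod_cast hd
  have h1 : Integrable u (Module.finBasis ℝ E).addHaar :=
    (integrable_smul_measure hd' ENNReal.coe_ne_top).1 hu
  have hle : (Module.finBasis ℝ E).addHaar ≤ (density E m)⁻¹ • measX E m := by
    rw [measX, smul_smul, inv_mul_cancel₀ hd, one_smul]
  have h2 : MemLp u 2 (Module.finBasis ℝ E).addHaar :=
    hu2.of_measure_le_smul (c := ((density E m)⁻¹ : ℝ≥0)) ENNReal.coe_ne_top hle
  have h3 := lintegral_enorm_sq_integral_mul_phase hħ h1 h2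
  have h4 : ∀ g : E → ℝ≥0∞, ∫⁻ X, g X ∂(measX E m) =
      density E m * ∫⁻ X, g X ∂(Module.finBasis ℝ E).addHaar := fun g =>
    lintegral_smul_measure (density E m) g
  have h5 : ∀ g : (E →L[ℝ] ℝ) → ℝ≥0∞, ∫⁻ X, g X ∂(measP E m) =
      (density E m : ℝ≥0∞)⁻¹ * ∫⁻ X, g X ∂(dualBasis E).addHaar := fun g => by
    rw [← ENNReal.coe_inv hd]
    exact lintegral_smul_measure (density E m)⁻¹ g
  have h6 : ∀ g : E → ℂ, ∫ X, g X ∂(measX E m) =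
      (density E m : ℝ) • ∫ X, g X ∂(Module.finBasis ℝ E).addHaar := fun g =>
    integral_smul_nnreal_measure g (density E m)
  have h7 : ‖(density E m : ℝ)‖ₑ = (density E m : ℝ≥0∞) := by
    simp [enorm_eq_nnnorm]
  simp_rw [h4, h5, h6, enorm_smul, h7, mul_pow]
  rw [lintegral_const_mul' _ _ (ENNReal.pow_ne_top ENNReal.coe_ne_top), h3, sq, ← mul_assoc,
    ← mul_assoc, ← mul_assoc, ENNReal.inv_mul_cancel hd' ENNReal.coe_ne_top, one_mul, mul_left_comm, mul_assoc]

variable [SFinite m]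

/-- Plancherel on almost every slice, then Tonelli in `q`; the factor `|2πħ|ⁿ` cancels against the
normalization of `dl`. Truncation makes the slices integrable. -/
lemma eLpNorm_invFourier_trunc (hd : density E m ≠ 0) (hħ : ħ ≠ 0) {φ : G × E → ℂ}
    (hφ : MemLp φ 2 (measN E m)) (R : ℝ) :
    eLpNorm (invFourier ħ m (trunc R φ)) 2 (measL E ħ m) =
      eLpNorm (trunc R φ) 2 (measN E m) := by
  have hpos : 0 < |2 * Real.pi * ħ| ^ Module.finrank ℝ E :=
    pow_pos (abs_pos.2 (mul_ne_zero (by positivity) hħ)) _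
  have hC : ENNReal.ofReal ((|2 * Real.pi * ħ| ^ Module.finrank ℝ E)⁻¹) *
      ENNReal.ofReal (|2 * Real.pi * ħ| ^ Module.finrank ℝ E) = 1 := by
    rw [← ENNReal.ofReal_mul (inv_nonneg.2 hpos.le), inv_mul_cancel₀ hpos.ne', ENNReal.ofReal_one]
  have h0 := aestronglyMeasurable_invFourier ħ m hφ R
  have h0' : AEStronglyMeasurable (invFourier ħ m (trunc R φ)) (m.prod (measP E m)) := by
    refine AEStronglyMeasurable.mono_ac ?_ h0
    refine Measure.absolutelyContinuous_smul ?_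
    simpa using hpos
  have ht := memLp_trunc hφ R
  have h1 : eLpNorm (invFourier ħ m (trunc R φ)) 2 (measL E ħ m) ^ 2 =
      eLpNorm (trunc R φ) 2 (measN E m) ^ 2 := by
    have e1 : ∫⁻ x, ‖invFourier ħ m (trunc R φ) x‖ₑ ^ 2 ∂(measL E ħ m) =
        ENNReal.ofReal ((|2 * Real.pi * ħ| ^ Module.finrank ℝ E)⁻¹) *
          ∫⁻ q, ∫⁻ p, ‖invFourier ħ m (trunc R φ) (q, p)‖ₑ ^ 2 ∂(measP E m) ∂m := by
      rw [← lintegral_prod (fun x => ‖invFourier ħ m (trunc R φ) x‖ₑ ^ 2) (h0'.enorm.pow_const 2)]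
      exact lintegral_smul_measure _ _
    have e2 : ∫⁻ x, ‖trunc R φ x‖ₑ ^ 2 ∂(measN E m) =
        ∫⁻ q, ∫⁻ X, ‖trunc R φ (q, X)‖ₑ ^ 2 ∂(measX E m) ∂m :=
      lintegral_prod (fun x => ‖trunc R φ x‖ₑ ^ 2) (ht.1.enorm.pow_const 2)
    rw [eLpNorm_two_sq, eLpNorm_two_sq, e1, e2]
    have h2 : ∀ᵐ q ∂m, ∫⁻ p, ‖invFourier ħ m (trunc R φ) (q, p)‖ₑ ^ 2 ∂(measP E m) =
        ENNReal.ofReal (|2 * Real.pi * ħ| ^ Module.finrank ℝ E) *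
          ∫⁻ X, ‖trunc R φ (q, X)‖ₑ ^ 2 ∂(measX E m) := by
      have h3 : ∀ᵐ q ∂m, MemLp (fun X => trunc R φ (q, X)) 2 (measX E m) := by
        have h4 : Integrable (fun x => ‖trunc R φ x‖ ^ 2) (m.prod (measX E m)) :=
          ht.integrable_norm_pow (by simp)
        filter_upwards [h4.prod_right_ae, ht.1.prodMk_left] with q hq hm
        exact (memLp_two_iff_integrable_sq_norm hm).2 hq
      filter_upwards [ae_integrable_slice m hφ R, h3] with q hq hq2
      have h5 := lintegral_enorm_sq_slice hd hħ hq hq2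
      simp only [invFourier]
      exact h5
    rw [lintegral_congr_ae h2, lintegral_const_mul' _ _ ENNReal.ofReal_ne_top, ← mul_assoc, hC,
      one_mul]
  exact (ENNReal.pow_right_strictMono two_ne_zero).injective h1

lemma memLp_invFourier_trunc (hd : density E m ≠ 0) (hħ : ħ ≠ 0) {φ : G × E → ℂ}
    (hφ : MemLp φ 2 (measN E m)) (R : ℝ) :
    MemLp (invFourier ħ m (trunc R φ)) 2 (measL E ħ m) :=
  ⟨aestronglyMeasurable_invFourier ħ m hφ R, by
    rw [eLpNorm_invFourier_trunc hd hħ hφ R]; exact (memLp_trunc hφ R).2⟩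

lemma invFourier_trunc_sub {φ ψ : G × E → ℂ}
    (hφ : MemLp φ 2 (measN E m)) (hψ : MemLp ψ 2 (measN E m)) (R : ℝ) :
    invFourier ħ m (trunc R (φ - ψ)) =ᵐ[measL E ħ m]
      invFourier ħ m (trunc R φ) - invFourier ħ m (trunc R ψ) := by
  have h := invFourier_add ħ m hφ (hψ.const_smul (-1 : ℂ)) R
  rw [invFourier_smul] at h
  simpa [sub_eq_add_neg] using h

lemma isInvFourierL2_add {φ ψ : G × E → ℂ} {f g : G × (E →L[ℝ] ℝ) → ℂ}
    (hφ : MemLp φ 2 (measN E m)) (hψ : MemLp ψ 2 (measN E m))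
    (hf : AEStronglyMeasurable f (measL E ħ m)) (hg : AEStronglyMeasurable g (measL E ħ m))
    (h1 : IsInvFourierL2 ħ m φ f) (h2 : IsInvFourierL2 ħ m ψ g) :
    IsInvFourierL2 ħ m (φ + ψ) (f + g) := by
  have hlim := Tendsto.add h1 h2
  rw [add_zero] at hlim
  refine tendsto_of_tendsto_of_tendsto_of_le_of_le tendsto_const_nhds hlim
    (fun _ => zero_le) fun R => ?_
  have h3 : f + g - invFourier ħ m (trunc R (φ + ψ)) =ᵐ[measL E ħ m]
      (f - invFourier ħ m (trunc R φ)) + (g - invFourier ħ m (trunc R ψ)) := by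
    filter_upwards [invFourier_add ħ m hφ hψ R] with x h2
    simp only [Pi.sub_apply, Pi.add_apply] at h2 ⊢
    rw [h2]; ring
  dsimp only
  rw [eLpNorm_congr_ae h3]
  exact eLpNorm_add_le (hf.sub (aestronglyMeasurable_invFourier ħ m hφ R))
    (hg.sub (aestronglyMeasurable_invFourier ħ m hψ R)) (by norm_num)

omit [SFinite m] in
lemma isInvFourierL2_smul {φ : G × E → ℂ} {f : G × (E →L[ℝ] ℝ) → ℂ}
    (h1 : IsInvFourierL2 ħ m φ f) (c : ℂ) : IsInvFourierL2 ħ m (c • φ) (c • f) := by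
  have hlim := ENNReal.Tendsto.const_mul (a := ‖c‖ₑ) h1 (Or.inr (by simp))
  rw [mul_zero] at hlim
  refine hlim.congr fun R => ?_
  rw [← eLpNorm_const_smul, invFourier_smul, smul_sub]

lemma isInvFourierL2_unique {φ : G × E → ℂ} {f g : G × (E →L[ℝ] ℝ) → ℂ}
    (hφ : MemLp φ 2 (measN E m))
    (hf : AEStronglyMeasurable f (measL E ħ m)) (hg : AEStronglyMeasurable g (measL E ħ m))
    (h1 : IsInvFourierL2 ħ m φ f) (h2 : IsInvFourierL2 ħ m φ g) : f =ᵐ[measL E ħ m] g := by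
  have h3 := isInvFourierL2_add (hφ) (hφ.const_smul (-1 : ℂ)) hf (hg.const_smul (-1 : ℂ)) h1
    (isInvFourierL2_smul h2 (-1))
  have h4 : φ + (-1 : ℂ) • φ = 0 := by ext; simp
  have h5 : ∀ R : ℝ, invFourier ħ m (trunc R (0 : G × E → ℂ)) = 0 := fun R => by
    ext x; simp [invFourier, trunc]
  rw [h4] at h3
  simp only [IsInvFourierL2, h5, sub_zero] at h3
  have h6 := tendsto_nhds_unique tendsto_const_nhds h3
  rw [eLpNorm_eq_zero_iff (hf.add (hg.const_smul (-1 : ℂ))) (by norm_num)] at h6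
  filter_upwards [h6] with x hx
  simp only [Pi.add_apply, Pi.smul_apply, Pi.zero_apply] at hx
  linear_combination hx

/-- The isometry on truncations makes the transform insensitive to null sets, as is needed once
kernels become `Lp` classes. -/
lemma isInvFourierL2_congr {φ ψ : G × E → ℂ} {f g : G × (E →L[ℝ] ℝ) → ℂ}
    (hd : density E m ≠ 0) (hħ : ħ ≠ 0)
    (hφ : MemLp φ 2 (measN E m)) (h : φ =ᵐ[measN E m] ψ) (hfg : f =ᵐ[measL E ħ m] g)
    (h1 : IsInvFourierL2 ħ m φ f) : IsInvFourierL2 ħ m ψ g := by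
  refine Tendsto.congr (fun R => ?_) h1
  refine eLpNorm_congr_ae (hfg.sub ?_)
  have hψ : MemLp ψ 2 (measN E m) := (memLp_congr_ae h).1 hφ
  have h2 : eLpNorm (invFourier ħ m (trunc R φ) - invFourier ħ m (trunc R ψ)) 2
      (measL E ħ m) = 0 := by
    rw [← eLpNorm_congr_ae (invFourier_trunc_sub hφ hψ R),
      eLpNorm_invFourier_trunc hd hħ (hφ.sub hψ), trunc_sub]
    rw [eLpNorm_eq_zero_iff ((memLp_trunc hφ R).sub (memLp_trunc hψ R)).1 (by norm_num)]
    filter_upwards [h] with x hx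
    simp only [trunc, Pi.sub_apply, Pi.zero_apply]
    rw [sub_eq_zero]
    by_cases hxR : x ∈ (Set.univ : Set G) ×ˢ Metric.closedBall (0 : E) R
    · rw [Set.indicator_of_mem hxR, Set.indicator_of_mem hxR, hx]
    · rw [Set.indicator_of_notMem hxR, Set.indicator_of_notMem hxR]
  rw [eLpNorm_eq_zero_iff ((memLp_invFourier_trunc hd hħ hφ R).sub
    (memLp_invFourier_trunc hd hħ hψ R)).1 (by norm_num)] at h2
  filter_upwards [h2] with x hx using sub_eq_zero.1 hx

lemma exists_isInvFourierL2 (hd : density E m ≠ 0) (hħ : ħ ≠ 0) {φ : G × E → ℂ}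
    (hφ : MemLp φ 2 (measN E m)) :
    ∃ f : Lp ℂ 2 (measL E ħ m), IsInvFourierL2 ħ m φ f ∧ ‖f‖ₑ = eLpNorm φ 2 (measN E m) := by
  set t : ℝ → Lp ℂ 2 (measN E m) := fun R => (memLp_trunc hφ R).toLp _
  set γ : ℝ → Lp ℂ 2 (measL E ħ m) := fun R => (memLp_invFourier_trunc hd hħ hφ R).toLp _
  have ht : Tendsto t atTop (𝓝 (hφ.toLp φ)) := by
    rw [Lp.tendsto_Lp_iff_tendsto_eLpNorm'']
    refine (tendsto_eLpNorm_sub_trunc hφ).congr fun R => ?_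
    rw [← eLpNorm_neg, neg_sub]
  have hdist : ∀ R S, edist (γ R) (γ S) = edist (t R) (t S) := by
    intro R S
    rw [Lp.edist_toLp_toLp, Lp.edist_toLp_toLp]
    -- Truncating at `max R S` changes neither function, so the isometry for truncated functions
    -- applies to their difference.
    have h1 := invFourier_trunc_sub (ħ := ħ) (memLp_trunc hφ R) (memLp_trunc hφ S) (max R S)
    rw [trunc_trunc (le_max_left R S), trunc_trunc (le_max_right R S)] at h1
    rw [← eLpNorm_congr_ae h1, eLpNorm_invFourier_trunc hd hħ
      ((memLp_trunc hφ R).sub (memLp_trunc hφ S)), trunc_sub, trunc_trunc (le_max_left R S),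
      trunc_trunc (le_max_right R S)]
  have hγ : CauchySeq γ := by
    have := ht.cauchySeq
    rw [EMetric.cauchySeq_iff] at this ⊢
    simpa only [hdist] using this
  obtain ⟨f, hf⟩ := cauchySeq_tendsto_of_complete hγ
  refine ⟨f, ?_, ?_⟩
  · have := (Lp.tendsto_Lp_iff_tendsto_eLpNorm' _ _).1 hf
    refine this.congr fun R => ?_
    rw [← eLpNorm_neg]
    refine eLpNorm_congr_ae ?_
    filter_upwards [(memLp_invFourier_trunc hd hħ hφ R).coeFn_toLp] with x hx
    simp [γ, hx]
  · have h1 : Tendsto (fun R => ‖γ R‖ₑ) atTop (𝓝 ‖f‖ₑ) := (continuous_enorm.tendsto f).comp hf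
    have h2 : Tendsto (fun R => ‖t R‖ₑ) atTop (𝓝 ‖hφ.toLp φ‖ₑ) :=
      (continuous_enorm.tendsto _).comp ht
    have h3 : ∀ R, ‖γ R‖ₑ = ‖t R‖ₑ := fun R => by
      rw [Lp.enorm_toLp, Lp.enorm_toLp, eLpNorm_invFourier_trunc hd hħ hφ R]
    simp only [h3] at h1
    rw [tendsto_nhds_unique h1 h2, Lp.enorm_toLp]

end PartialFourier

/-! ### Kernels on `G × G` and their symbols on `G × 𝔤` -/

section Symbol

variable {E : Type*} [NormedAddCommGroup E] [NormedSpace ℝ E] [FiniteDimensional ℝ E]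
variable {G : Type*} [TopologicalSpace G] [T2Space G] [SecondCountableTopology G]
  [ChartedSpace E G] [Group G]
  [LieGroup 𝓘(ℝ, E) ∞ G]

/-- The map `(q, X) ↦ (q exp(-X/2), q exp(X/2))`. -/
noncomputable def weylMap (x : G × E) : G × G :=
  (x.1 * lieExp G (-(1 / 2 : ℝ) • x.2), x.1 * lieExp G ((1 / 2 : ℝ) • x.2))

/-- The inverse `(a, b) ↦ (a exp(V_a(b)/2), V_a(b))` of `weylMap`. -/
noncomputable def weylInv (O : Set E) (p : G × G) : G × E :=
  (p.1 * lieExp G ((1 / 2 : ℝ) • V O p.1 p.2), V O p.1 p.2)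

open Classical in
/-- The symbol of the integral kernel `k`. -/
noncomputable def symbol (O : Set E) (k : G × G → ℂ) (x : G × E) : ℂ :=
  if x.2 ∈ O then (F G x.2 : ℂ) * k (weylMap x) else 0

variable {O : Set E}

omit [T2Space G] [SecondCountableTopology G] in
lemma symbol_of_mem {k : G × G → ℂ} {x : G × E} (hx : x.2 ∈ O) :
    symbol O k x = (F G x.2 : ℂ) * k (weylMap x) := if_pos hx

omit [T2Space G] [SecondCountableTopology G] in
lemma symbol_of_notMem {k : G × G → ℂ} {x : G × E} (hx : x.2 ∉ O) : symbol O k x = 0 := if_neg hx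

omit [T2Space G] [SecondCountableTopology G] in
lemma symbol_add (k l : G × G → ℂ) : symbol O (k + l) = symbol O k + symbol O l := by
  ext x
  by_cases hx : x.2 ∈ O
  · simp [symbol_of_mem hx, mul_add]
  · simp [symbol_of_notMem hx]

omit [T2Space G] [SecondCountableTopology G] in
lemma symbol_smul (c : ℂ) (k : G × G → ℂ) : symbol O (c • k) = c • symbol O k := by
  ext x
  by_cases hx : x.2 ∈ O
  · simp [symbol_of_mem hx]; ring
  · simp [symbol_of_notMem hx]

omit [SecondCountableTopology G] in
lemma lieExp_neg_half (X : E) :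
    lieExp G (-(1 / 2 : ℝ) • X) = (lieExp G ((1 / 2 : ℝ) • X))⁻¹ := by
  rw [neg_smul, lieExp_neg]

omit [SecondCountableTopology G] in
lemma weylMap_inv_mul (x : G × E) : (weylMap x).1⁻¹ * (weylMap x).2 = lieExp G x.2 := by
  simp only [weylMap, lieExp_neg_half]
  rw [mul_inv_rev, inv_inv, mul_assoc, inv_mul_cancel_left, lieExp_half_mul_half]

omit [SecondCountableTopology G] in
lemma weylMap_weylInv {p : G × G} (hp : p.1⁻¹ * p.2 ∈ lieExp G '' O) :
    weylMap (weylInv O p) = p := by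
  simp only [weylMap, weylInv, lieExp_neg_half, mul_inv_cancel_right]
  rw [mul_assoc, lieExp_half_mul_half, V, lieLog, Function.invFunOn_eq hp,
    mul_inv_cancel_left]

variable [MeasurableSpace G] {m : Measure G}

omit [SecondCountableTopology G] in
lemma IsWeaklyExponential.weylInv_weylMap (hO : IsWeaklyExponential G m O) {x : G × E}
    (hx : x.2 ∈ O) : weylInv O (weylMap x) = x := by
  have hV : V O (weylMap x).1 (weylMap x).2 = x.2 := by
    rw [V, weylMap_inv_mul, hO.lieLog_lieExp hx]
  rw [weylInv, hV]
  simp only [weylMap, lieExp_neg_half, inv_mul_cancel_right]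

variable [MeasurableSpace E] [BorelSpace E] [BorelSpace G]
  [IsTopologicalGroup G] [LocallyCompactSpace G]

namespace IsWeaklyExponential

variable (hO : IsWeaklyExponential G m O)
include hO

lemma continuous_weylMap : Continuous (weylMap : G × E → G × G) := by
  have h := hO.continuous_lieExp
  have h1 : Continuous fun x : G × E => lieExp G (-(1 / 2 : ℝ) • x.2) :=
    h.comp (by fun_prop)
  have h2 : Continuous fun x : G × E => lieExp G ((1 / 2 : ℝ) • x.2) :=
    h.comp (by fun_prop)
  exact (continuous_fst.mul h1).prodMk (continuous_fst.mul h2)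

lemma measurable_weylInv : Measurable (weylInv O : G × G → G × E) := by
  have hV : Measurable fun p : G × G => (V O p.1 p.2 : E) :=
    hO.measurable_lieLog.comp (measurable_fst.inv.mul measurable_snd)
  exact (measurable_fst.mul (hO.continuous_lieExp.measurable.comp
    (hV.const_smul (1 / 2 : ℝ)))).prodMk hV

lemma measurableSet_univ_prod : MeasurableSet ((Set.univ : Set G) ×ˢ O) :=
  MeasurableSet.univ.prod hO.measurableSet_O

lemma measurable_F : Measurable fun x : G × E => F G x.2 :=
  hO.continuous_F.measurable.comp measurable_snd

lemma measurable_weight {f : G × G → ℝ≥0∞} (hf : Measurable f) :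
    Measurable fun x : G × E => ENNReal.ofReal (F G x.2 ^ 2) * f (weylMap x) :=
  (ENNReal.measurable_ofReal.comp (hO.measurable_F.pow_const 2)).mul
    (hf.comp hO.continuous_weylMap.measurable)

/-- Put `b = a x` by left invariance, `x = exp X` with density `ρ(X)`, and `a = q exp(-X/2)`. The
last right translation contributes `δ(exp(X/2))`, and the product of the two factors is `F(X)²`. -/
lemma lintegral_prod_eq [SFinite m] [m.IsHaarMeasure] {f : G × G → ℝ≥0∞} (hf : Measurable f) :
    ∫⁻ p, f p ∂(m.prod m) =
      ∫⁻ x in Set.univ ×ˢ O, ENNReal.ofReal (F G x.2 ^ 2) * f (weylMap x) ∂(measN E m) := by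
  have hfm : Measurable fun p : G × G => f (p.1, p.1 * p.2) :=
    hf.comp (measurable_fst.prodMk (measurable_fst.mul measurable_snd))
  have hg := hO.measurable_weight hf
  have h1 : ∫⁻ p, f p ∂(m.prod m) = ∫⁻ x, ∫⁻ a, f (a, a * x) ∂m ∂m := by
    rw [lintegral_prod _ hf.aemeasurable, 
      ← lintegral_lintegral_swap (f := fun a x => f (a, a * x)) hfm.aemeasurable]
    refine lintegral_congr fun a => ?_
    exact (lintegral_mul_left_eq_self (fun b => f (a, b)) a).symm
  rw [h1, hO.lintegral_eq (hfm.lintegral_prod_left'), measN]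
  have h2 : (m.prod (measX E m)).restrict (Set.univ ×ˢ O) = m.prod ((measX E m).restrict O) := by
    rw [← Measure.prod_restrict, Measure.restrict_univ]
  rw [h2, lintegral_prod_symm' _ hg]
  refine lintegral_congr fun X => ?_
  have hX : Measurable fun a : G => f (a, a * lieExp G X) :=
    hf.comp (measurable_id.prodMk (measurable_mul_const _))
  have h3 := hO.lintegral_mul_right hX (lieExp G (-(1 / 2 : ℝ) • X))
  have h4 : ∀ q : G, (q * lieExp G (-(1 / 2 : ℝ) • X),
      q * lieExp G (-(1 / 2 : ℝ) • X) * lieExp G X) = weylMap (q, X) := by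
    intro q
    refine Prod.ext rfl ?_
    have := weylMap_inv_mul (q, X)
    rw [inv_mul_eq_iff_eq_mul] at this
    exact this.symm
  simp only [h4] at h3
  have h5 : Measurable fun q : G => f (weylMap (q, X)) :=
    hf.comp (hO.continuous_weylMap.measurable.comp (measurable_id.prodMk measurable_const))
  dsimp only
  rw [lintegral_const_mul _ h5, h3, F_sq, lieExp_neg_half, delta_inv, ← mul_assoc,
    ← ENNReal.ofReal_mul (mul_nonneg (rho_nonneg X) (delta_pos _).le), mul_assoc,
    mul_inv_cancel₀ (delta_pos _).ne', mul_one]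

lemma quasiMeasurePreserving_weylMap [SFinite m] [m.IsHaarMeasure] :
    Measure.QuasiMeasurePreserving (weylMap : G × E → G × G)
      ((measN E m).restrict (Set.univ ×ˢ O)) (m.prod m) := by
  refine ⟨hO.continuous_weylMap.measurable, Measure.AbsolutelyContinuous.mk fun s hs h0 => ?_⟩
  have hsm := hO.continuous_weylMap.measurable hs
  rw [Measure.map_apply hO.continuous_weylMap.measurable hs]
  rw [← lintegral_indicator_one hs, hO.lintegral_prod_eq (measurable_one.indicator hs),
    lintegral_eq_zero_iff (hO.measurable_weight (measurable_one.indicator hs))] at h0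
  rw [← compl_compl (weylMap ⁻¹' s), ← mem_ae_iff]
  filter_upwards [h0, ae_restrict_mem hO.measurableSet_univ_prod] with x hx hxO hxs
  have hF := hO.F_pos hxO.2
  simp only [Pi.zero_apply, mul_eq_zero] at hx
  rw [Set.indicator_of_mem (Set.mem_preimage.1 hxs)] at hx
  rcases hx with hx | hx
  · rw [ENNReal.ofReal_eq_zero] at hx
    exact absurd hx (not_le.2 (pow_pos hF 2))
  · exact one_ne_zero hx

/-- The integral formula evaluates a preimage under `weylInv` through `weylInv ∘ weylMap = id` on `G
× O`; the values of `weylInv` where `a⁻¹b` leaves `exp O` play no role. -/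
lemma quasiMeasurePreserving_weylInv [SFinite m] [m.IsHaarMeasure] :
    Measure.QuasiMeasurePreserving (weylInv O : G × G → G × E)
      (m.prod m) ((measN E m).restrict (Set.univ ×ˢ O)) := by
  refine ⟨hO.measurable_weylInv, Measure.AbsolutelyContinuous.mk fun s hs h0 => ?_⟩
  have hsm := hO.measurable_weylInv hs
  rw [Measure.map_apply hO.measurable_weylInv hs, ← lintegral_indicator_one hsm,
    hO.lintegral_prod_eq (measurable_one.indicator hsm)]
  rw [lintegral_eq_zero_iff (hO.measurable_weight (measurable_one.indicator hsm))]
  have h1 : ∀ᵐ x ∂((measN E m).restrict (Set.univ ×ˢ O)), x ∉ s := by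
    rw [ae_iff]; simpa using h0
  filter_upwards [h1, ae_restrict_mem hO.measurableSet_univ_prod] with x hx hxO
  have : weylMap x ∉ weylInv O ⁻¹' s := by
    rwa [Set.mem_preimage, hO.weylInv_weylMap hxO.2]
  simp [Set.indicator_of_notMem this]

lemma symbol_congr [SFinite m] [m.IsHaarMeasure] {k l : G × G → ℂ} (h : k =ᵐ[m.prod m] l) :
    symbol O k =ᵐ[measN E m] symbol O l := by
  have h1 := hO.quasiMeasurePreserving_weylMap.ae h
  rw [ae_restrict_iff' hO.measurableSet_univ_prod] at h1
  filter_upwards [h1] with x hx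
  by_cases hxO : x.2 ∈ O
  · rw [symbol_of_mem hxO, symbol_of_mem hxO, hx ⟨trivial, hxO⟩]
  · rw [symbol_of_notMem hxO, symbol_of_notMem hxO]

lemma measurable_symbol {k : G × G → ℂ} (hk : Measurable k) :
    Measurable (symbol O k) := by
  refine Measurable.ite (hO.measurableSet_O.preimage measurable_snd) ?_ measurable_const
  exact (Complex.measurable_ofReal.comp hO.measurable_F).mul
    (hk.comp hO.continuous_weylMap.measurable)

lemma aestronglyMeasurable_symbol [SFinite m] [m.IsHaarMeasure] {k : G × G → ℂ}
    (hk : AEStronglyMeasurable k (m.prod m)) : AEStronglyMeasurable (symbol O k) (measN E m) :=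
  (hO.measurable_symbol hk.stronglyMeasurable_mk.measurable).aestronglyMeasurable.congr
    (hO.symbol_congr hk.ae_eq_mk).symm

lemma eLpNorm_symbol [SFinite m] [m.IsHaarMeasure] {k : G × G → ℂ}
    (hk : AEStronglyMeasurable k (m.prod m)) :
    eLpNorm (symbol O k) 2 (measN E m) = eLpNorm k 2 (m.prod m) := by
  rw [eLpNorm_congr_ae hk.ae_eq_mk, eLpNorm_congr_ae (hO.symbol_congr hk.ae_eq_mk)]
  have hm : Measurable (hk.mk k) := hk.stronglyMeasurable_mk.measurable
  refine (ENNReal.pow_right_strictMono two_ne_zero).injective ?_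
  rw [eLpNorm_two_sq, eLpNorm_two_sq, hO.lintegral_prod_eq (hm.enorm.pow_const 2),
    ← lintegral_indicator hO.measurableSet_univ_prod]
  refine lintegral_congr fun x => ?_
  by_cases hxO : x.2 ∈ O
  · rw [symbol_of_mem hxO, Set.indicator_of_mem (by exact ⟨trivial, hxO⟩), enorm_mul, mul_pow,
      ENNReal.ofReal_pow (F_nonneg _)]
    congr 2
    rw [← ofReal_norm, Complex.norm_real, Real.norm_of_nonneg (F_nonneg _)]
  · rw [symbol_of_notMem hxO, Set.indicator_of_notMem (fun h => hxO h.2)]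
    simp

lemma memLp_symbol [SFinite m] [m.IsHaarMeasure] {k : G × G → ℂ}
    (hk : MemLp k 2 (m.prod m)) : MemLp (symbol O k) 2 (measN E m) :=
  ⟨hO.aestronglyMeasurable_symbol hk.1, by rw [hO.eLpNorm_symbol hk.1]; exact hk.2⟩

/-- The kernel is `φ` pulled back by `weylInv` and divided by `F`, which is positive on `O`. Its
square integrability is read off from the isometry. -/
lemma exists_symbol_eq [SFinite m] [m.IsHaarMeasure] {φ : G × E → ℂ}
    (hφ : MemLp φ 2 (measN E m)) (h0 : ∀ q X, X ∉ O → φ (q, X) = 0) :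
    ∃ k, MemLp k 2 (m.prod m) ∧ symbol O k = φ := by
  set k : G × G → ℂ := fun p => φ (weylInv O p) * ((F G (V O p.1 p.2) : ℝ) : ℂ)⁻¹
  have hk : symbol O k = φ := by
    ext x
    by_cases hx : x.2 ∈ O
    · have hF : ((F G x.2 : ℝ) : ℂ) ≠ 0 := by exact_mod_cast (hO.F_pos hx).ne'
      have hV : V O (weylMap x).1 (weylMap x).2 = x.2 := by
        rw [V, weylMap_inv_mul, hO.lieLog_lieExp hx]
      rw [symbol_of_mem hx]
      simp only [k, hO.weylInv_weylMap hx, hV]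
      field_simp
    · rw [symbol_of_notMem hx, h0 x.1 x.2 hx]
  have hm : AEStronglyMeasurable k (m.prod m) := by
    refine ((hφ.1.mono_measure Measure.restrict_le_self).comp_quasiMeasurePreserving
      hO.quasiMeasurePreserving_weylInv).mul ?_
    have : Measurable fun p : G × G => ((F G (weylInv O p).2 : ℝ) : ℂ)⁻¹ :=
      (Complex.measurable_ofReal.comp (hO.measurable_F.comp hO.measurable_weylInv)).inv
    exact this.aestronglyMeasurable
  exact ⟨k, ⟨hm, by rw [← hO.eLpNorm_symbol hm, hk]; exact hφ.2⟩, hk⟩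

end IsWeaklyExponential

end Symbol

/-! ### Composition and adjoints of square integrable kernels -/

section Kernel

variable {α : Type*} [MeasurableSpace α]

/-- Composition of integral kernels. -/
noncomputable def kcomp (m : Measure α) (k l : α × α → ℂ) (p : α × α) : ℂ :=
  ∫ c, k (p.1, c) * l (c, p.2) ∂m

/-- The adjoint kernel. -/
def kstar (k : α × α → ℂ) (p : α × α) : ℂ := starRingEnd ℂ (k p.swap)

variable {m : Measure α} [SFinite m] {k l h : α × α → ℂ}

lemma memLp_slice_left (hk : MemLp k 2 (m.prod m)) : ∀ᵐ a ∂m, MemLp (fun c => k (a, c)) 2 m := by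
  have h1 : Integrable (fun x => ‖k x‖ ^ 2) (m.prod m) := hk.integrable_norm_pow (by simp)
  filter_upwards [h1.prod_right_ae, hk.1.prodMk_left] with q hq hm
  exact (memLp_two_iff_integrable_sq_norm hm).2 hq

lemma memLp_swap (hk : MemLp k 2 (m.prod m)) : MemLp (fun p => k p.swap) 2 (m.prod m) :=
  hk.comp_measurePreserving Measure.measurePreserving_swap

lemma memLp_slice_right (hk : MemLp k 2 (m.prod m)) : ∀ᵐ b ∂m, MemLp (fun c => k (c, b)) 2 m :=
  memLp_slice_left (memLp_swap hk)

lemma ae_prod_of_ae {P Q : α → Prop} (hP : ∀ᵐ a ∂m, P a) (hQ : ∀ᵐ b ∂m, Q b) :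
    ∀ᵐ p ∂(m.prod m), P p.1 ∧ Q p.2 :=
  (Measure.quasiMeasurePreserving_fst.ae hP).and (Measure.quasiMeasurePreserving_snd.ae hQ)

lemma quasiMeasurePreserving_fst_right :
    Measure.QuasiMeasurePreserving (fun x : (α × α) × α => (x.1.1, x.2))
      ((m.prod m).prod m) (m.prod m) :=
  QuasiMeasurePreserving.prodMap Measure.quasiMeasurePreserving_fst
    (Measure.QuasiMeasurePreserving.id _)

lemma quasiMeasurePreserving_right_snd :
    Measure.QuasiMeasurePreserving (fun x : (α × α) × α => (x.2, x.1.2))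
      ((m.prod m).prod m) (m.prod m) :=
  Measure.measurePreserving_swap.quasiMeasurePreserving.comp
    (QuasiMeasurePreserving.prodMap Measure.quasiMeasurePreserving_snd
      (Measure.QuasiMeasurePreserving.id _))

lemma aestronglyMeasurable_kcomp (hk : AEStronglyMeasurable k (m.prod m))
    (hl : AEStronglyMeasurable l (m.prod m)) :
    AEStronglyMeasurable (kcomp m k l) (m.prod m) := by
  have h1 := hk.comp_quasiMeasurePreserving (quasiMeasurePreserving_fst_right (m := m))
  have h2 := hl.comp_quasiMeasurePreserving (quasiMeasurePreserving_right_snd (m := m))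
  exact (h1.mul h2).integral_prod_right'

lemma enorm_integral_mul_le {u v : α → ℂ} (hu : MemLp u 2 m) (hv : MemLp v 2 m) :
    ‖∫ c, u c * v c ∂m‖ₑ ≤ eLpNorm u 2 m * eLpNorm v 2 m := by
  refine (enorm_integral_le_lintegral_enorm _).trans ?_
  rw [← eLpNorm_one_eq_lintegral_enorm]
  have : (fun c => u c * v c) = u • v := rfl
  rw [this]
  exact eLpNorm_smul_le_mul_eLpNorm hv.1 hu.1

/-- The Hilbert-Schmidt estimate: Cauchy-Schwarz in the middle variable bounds the square at `(a,
b)` by a function of `a` times a function of `b`, and the integral of that product factors. -/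
lemma eLpNorm_kcomp_le (hk : MemLp k 2 (m.prod m)) (hl : MemLp l 2 (m.prod m)) :
    eLpNorm (kcomp m k l) 2 (m.prod m) ≤ eLpNorm k 2 (m.prod m) * eLpNorm l 2 (m.prod m) := by
  refine (ENNReal.pow_le_pow_left_iff two_ne_zero).1 ?_
  have hl' := memLp_swap hl
  have hA : AEMeasurable (fun a => ∫⁻ c, ‖k (a, c)‖ₑ ^ 2 ∂m) m :=
    (hk.1.enorm.pow_const 2).lintegral_prod_right'
  have hB : AEMeasurable (fun b => ∫⁻ c, ‖l (c, b)‖ₑ ^ 2 ∂m) m :=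
    (hl'.1.enorm.pow_const 2).lintegral_prod_right'
  have hA' : ∫⁻ a, ∫⁻ c, ‖k (a, c)‖ₑ ^ 2 ∂m ∂m = eLpNorm k 2 (m.prod m) ^ 2 := by
    rw [eLpNorm_two_sq, lintegral_prod _ (hk.1.enorm.pow_const 2)]
  have hB' : ∫⁻ b, ∫⁻ c, ‖l (c, b)‖ₑ ^ 2 ∂m ∂m = eLpNorm l 2 (m.prod m) ^ 2 := by
    rw [eLpNorm_two_sq, lintegral_prod_symm _ (hl.1.enorm.pow_const 2)]
  rw [mul_pow, ← hA', ← hB', ← lintegral_prod_mul hA hB, eLpNorm_two_sq]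
  refine lintegral_mono_ae ?_
  filter_upwards [ae_prod_of_ae (memLp_slice_left hk) (memLp_slice_right hl)] with p hp
  rw [← eLpNorm_two_sq, ← eLpNorm_two_sq, ← mul_pow]
  exact pow_le_pow_left' (enorm_integral_mul_le hp.1 hp.2) 2

lemma memLp_kcomp (hk : MemLp k 2 (m.prod m)) (hl : MemLp l 2 (m.prod m)) :
    MemLp (kcomp m k l) 2 (m.prod m) :=
  ⟨aestronglyMeasurable_kcomp hk.1 hl.1,
    (eLpNorm_kcomp_le hk hl).trans_lt (ENNReal.mul_lt_top hk.2 hl.2)⟩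

lemma kcomp_congr {k' l' : α × α → ℂ} (hk : k =ᵐ[m.prod m] k') (hl : l =ᵐ[m.prod m] l') :
    kcomp m k l =ᵐ[m.prod m] kcomp m k' l' := by
  have h1 := Measure.ae_ae_of_ae_prod hk
  have h2 := Measure.ae_ae_of_ae_prod
    ((Measure.measurePreserving_swap (μ := m) (ν := m)).quasiMeasurePreserving.ae hl)
  filter_upwards [ae_prod_of_ae h1 h2] with p hp
  refine integral_congr_ae ?_
  filter_upwards [hp.1, hp.2] with c hc1 hc2
  have hc2' : l (c, p.2) = l' (c, p.2) := hc2
  rw [hc1, hc2']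

lemma kcomp_add_left {k' : α × α → ℂ} (hk : MemLp k 2 (m.prod m)) (hk' : MemLp k' 2 (m.prod m))
    (hl : MemLp l 2 (m.prod m)) :
    kcomp m (k + k') l =ᵐ[m.prod m] kcomp m k l + kcomp m k' l := by
  filter_upwards [ae_prod_of_ae (memLp_slice_left hk) (memLp_slice_right hl),
    ae_prod_of_ae (memLp_slice_left hk') (memLp_slice_right hl)] with p h1 h2
  simp only [kcomp, Pi.add_apply, add_mul]
  exact integral_add (h1.1.integrable_mul h1.2) (h2.1.integrable_mul h2.2)

lemma kcomp_add_right {l' : α × α → ℂ} (hk : MemLp k 2 (m.prod m)) (hl : MemLp l 2 (m.prod m))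
    (hl' : MemLp l' 2 (m.prod m)) :
    kcomp m k (l + l') =ᵐ[m.prod m] kcomp m k l + kcomp m k l' := by
  filter_upwards [ae_prod_of_ae (memLp_slice_left hk) (memLp_slice_right hl),
    ae_prod_of_ae (memLp_slice_left hk) (memLp_slice_right hl')] with p h1 h2
  simp only [kcomp, Pi.add_apply, mul_add]
  exact integral_add (h1.1.integrable_mul h1.2) (h2.1.integrable_mul h2.2)

omit [SFinite m] in
lemma kcomp_smul_left (c : ℂ) : kcomp m (c • k) l = c • kcomp m k l := by
  ext p
  simp only [kcomp, Pi.smul_apply, smul_eq_mul, mul_assoc, integral_const_mul]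

omit [SFinite m] in
lemma kcomp_smul_right (c : ℂ) : kcomp m k (c • l) = c • kcomp m k l := by
  ext p
  simp only [kcomp, Pi.smul_apply, smul_eq_mul, mul_left_comm _ c, integral_const_mul]

lemma memLp_tensor {u v : α → ℂ} (hu : MemLp u 2 m) (hv : MemLp v 2 m) :
    MemLp (fun p : α × α => u p.1 * v p.2) 2 (m.prod m) := by
  refine ⟨hu.1.comp_fst.mul hv.1.comp_snd, ?_⟩
  have h : eLpNorm (fun p : α × α => u p.1 * v p.2) 2 (m.prod m) ^ 2 =
      (eLpNorm u 2 m * eLpNorm v 2 m) ^ 2 := by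
    rw [mul_pow, eLpNorm_two_sq, eLpNorm_two_sq, eLpNorm_two_sq,
      ← lintegral_prod_mul (hu.1.enorm.pow_const 2) (hv.1.enorm.pow_const 2)]
    simp only [enorm_mul, mul_pow]
  rw [(ENNReal.pow_right_strictMono two_ne_zero).injective h]
  exact ENNReal.mul_lt_top hu.2 hv.2

/-- Fubini applies because `u ⊗ v` and `k` are both in `L²` of the product. Applied to slices, it
yields both associativity and the adjoint relation. -/
lemma integral_mul_integral_swap {u v : α → ℂ} (hu : MemLp u 2 m) (hv : MemLp v 2 m)
    (hk : MemLp k 2 (m.prod m)) :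
    ∫ a, u a * ∫ c, k (a, c) * v c ∂m ∂m = ∫ c, (∫ a, u a * k (a, c) ∂m) * v c ∂m := by
  have hint : Integrable (fun p : α × α => (u p.1 * v p.2) * k p) (m.prod m) :=
    (memLp_tensor hu hv).integrable_mul hk
  have h := integral_integral_swap (f := fun a c => (u a * v c) * k (a, c)) hint
  calc ∫ a, u a * ∫ c, k (a, c) * v c ∂m ∂m = ∫ a, ∫ c, (u a * v c) * k (a, c) ∂m ∂m := by
        congr 1 with a
        rw [← integral_const_mul]
        congr 1 with c
        ring
    _ = ∫ c, (∫ a, u a * k (a, c) ∂m) * v c ∂m := by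
        rw [h]
        congr 1 with c
        rw [← integral_mul_const]
        congr 1 with a
        ring

lemma kcomp_assoc (hk : MemLp k 2 (m.prod m)) (hl : MemLp l 2 (m.prod m))
    (hh : MemLp h 2 (m.prod m)) :
    kcomp m (kcomp m k l) h =ᵐ[m.prod m] kcomp m k (kcomp m l h) := by
  filter_upwards [ae_prod_of_ae (memLp_slice_left hk) (memLp_slice_right hh)] with p hp
  exact (integral_mul_integral_swap hp.1 hp.2 hl).symm

omit [SFinite m] in
lemma kstar_kcomp : kstar (kcomp m k l) = kcomp m (kstar l) (kstar k) := by
  ext p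
  simp only [kstar, kcomp, Prod.swap_prod_mk, ← integral_conj, map_mul, Prod.fst_swap,
    Prod.snd_swap]
  congr 1 with c
  ring

omit [MeasurableSpace α] in
lemma kstar_kstar : kstar (kstar k) = k := by
  ext p; simp [kstar]

lemma memLp_kstar (hk : MemLp k 2 (m.prod m)) : MemLp (kstar k) 2 (m.prod m) :=
  (memLp_swap hk).star

lemma integral_kcomp_left (hk : MemLp k 2 (m.prod m)) (hl : MemLp l 2 (m.prod m))
    (hh : MemLp h 2 (m.prod m)) :
    ∫ p, starRingEnd ℂ (kcomp m k l p) * h p ∂(m.prod m) =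
      ∫ p, starRingEnd ℂ (l p) * kcomp m (kstar k) h p ∂(m.prod m) := by
  have h1 : Integrable (fun p => starRingEnd ℂ (kcomp m k l p) * h p) (m.prod m) :=
    (memLp_kcomp hk hl).star.integrable_mul hh
  have h2 : Integrable (fun p => starRingEnd ℂ (l p) * kcomp m (kstar k) h p) (m.prod m) :=
    hl.star.integrable_mul (memLp_kcomp (memLp_kstar hk) hh)
  rw [integral_prod_symm _ h1, integral_prod_symm _ h2]
  refine integral_congr_ae ?_
  filter_upwards [memLp_slice_right hl, memLp_slice_right hh] with b hb1 hb2
  have h3 := integral_mul_integral_swap hb1.star hb2 (memLp_kstar hk)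
  rw [eq_comm]
  simp only [kcomp]
  refine h3.trans (integral_congr_ae (Eventually.of_forall fun a => ?_))
  dsimp only
  rw [← integral_conj]
  congr 2 with c
  simp [kstar, mul_comm]

lemma integral_kstar :
    ∫ p, starRingEnd ℂ (k p) * l p ∂(m.prod m) =
      ∫ p, starRingEnd ℂ (kstar l p) * kstar k p ∂(m.prod m) := by
  rw [← integral_prod_swap]
  simp [kstar, mul_comm]

end Kernel

/-! ### The Hilbert algebra of square integrable kernels -/

section KernelAlgebra

variable {α : Type*} [MeasurableSpace α]

/-- Rectangles form a π-system generating the product σ-algebra, and the sets with vanishing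
integral are closed under complements and disjoint unions. -/
lemma ae_eq_zero_of_setIntegral_prod_eq_zero {μ : Measure α} [IsFiniteMeasure μ]
    {h : α × α → ℂ} (hh : Integrable h (μ.prod μ))
    (H : ∀ A B : Set α, MeasurableSet A → MeasurableSet B → ∫ p in A ×ˢ B, h p ∂(μ.prod μ) = 0) :
    h =ᵐ[μ.prod μ] 0 := by
  refine hh.ae_eq_zero_of_forall_setIntegral_eq_zero fun T hT _ => ?_
  have huniv : ∫ p, h p ∂(μ.prod μ) = 0 := by
    simpa using H Set.univ Set.univ MeasurableSet.univ MeasurableSet.univ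
  induction T, hT using MeasurableSpace.induction_on_inter generateFrom_prod.symm
    isPiSystem_prod with
  | empty => simp
  | basic t ht =>
    obtain ⟨A, hA, B, hB, rfl⟩ := ht
    exact H A B hA hB
  | compl t ht ih =>
    have h2 := integral_add_compl ht hh
    rwa [ih (measure_lt_top _ _), zero_add, huniv] at h2
  | iUnion f hd hm ih =>
    rw [integral_iUnion hm hd hh.integrableOn]
    simp [fun i => ih i (measure_lt_top _ _)]

lemma ae_eq_zero_of_setIntegral_prod_eq_zero_of_sigmaFinite {m : Measure α} [SigmaFinite m]
    {h : α × α → ℂ} (hh : MemLp h 2 (m.prod m))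
    (H : ∀ A B : Set α, MeasurableSet A → MeasurableSet B → m A ≠ ⊤ → m B ≠ ⊤ →
      ∫ p in A ×ˢ B, h p ∂(m.prod m) = 0) : h =ᵐ[m.prod m] 0 := by
  have hn : ∀ n, h =ᵐ[(m.prod m).restrict (spanningSets m n ×ˢ spanningSets m n)] 0 := by
    intro n
    have hf : IsFiniteMeasure (m.restrict (spanningSets m n)) :=
      ⟨by simpa using measure_spanningSets_lt_top m n⟩
    rw [← Measure.prod_restrict]
    refine ae_eq_zero_of_setIntegral_prod_eq_zero ?_ fun A B hA hB => ?_
    · rw [Measure.prod_restrict]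
      have : IsFiniteMeasure ((m.prod m).restrict (spanningSets m n ×ˢ spanningSets m n)) := by
        rw [← Measure.prod_restrict]; infer_instance
      exact (hh.restrict _).integrable (by norm_num)
    · rw [Measure.prod_restrict, Measure.restrict_restrict (hA.prod hB), Set.prod_inter_prod]
      have hS := measurableSet_spanningSets m n
      refine H _ _ (hA.inter hS) (hB.inter hS) ?_ ?_
      · exact ((measure_mono Set.inter_subset_right).trans_lt (measure_spanningSets_lt_top m n)).ne
      · exact ((measure_mono Set.inter_subset_right).trans_lt (measure_spanningSets_lt_top m n)).ne
  have hU : ⋃ n, spanningSets m n ×ˢ spanningSets m n = (Set.univ : Set (α × α)) := by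
    refine Set.eq_univ_of_forall fun p => ?_
    obtain ⟨i, hi⟩ := Set.mem_iUnion.1 (iUnion_spanningSets m ▸ Set.mem_univ p.1)
    obtain ⟨j, hj⟩ := Set.mem_iUnion.1 (iUnion_spanningSets m ▸ Set.mem_univ p.2)
    exact Set.mem_iUnion.2 ⟨max i j, monotone_spanningSets m (le_max_left i j) hi,
      monotone_spanningSets m (le_max_right i j) hj⟩
  have := (ae_restrict_iUnion_iff (μ := m.prod m)
    (fun n => spanningSets m n ×ˢ spanningSets m n) (fun p => h p = 0)).2 hn
  rwa [hU, Measure.restrict_univ] at this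

section

variable (m : Measure α) [SFinite m]

/-- Composition of square integrable kernels. -/
noncomputable def kmul : Lp ℂ 2 (m.prod m) →L[ℂ] Lp ℂ 2 (m.prod m) →L[ℂ] Lp ℂ 2 (m.prod m) :=
  LinearMap.mkContinuous₂
    (LinearMap.mk₂ ℂ (fun u v => (memLp_kcomp (Lp.memLp u) (Lp.memLp v)).toLp _)
      (fun u u' v => by
        rw [← MemLp.toLp_add, MemLp.toLp_eq_toLp_iff]
        exact (kcomp_congr (Lp.coeFn_add u u') ae_eq_rfl).trans
          (kcomp_add_left (Lp.memLp u) (Lp.memLp u') (Lp.memLp v)))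
      (fun c u v => by
        rw [← MemLp.toLp_const_smul, MemLp.toLp_eq_toLp_iff, ← kcomp_smul_left]
        exact kcomp_congr (Lp.coeFn_smul c u) ae_eq_rfl)
      (fun u v v' => by
        rw [← MemLp.toLp_add, MemLp.toLp_eq_toLp_iff]
        exact (kcomp_congr ae_eq_rfl (Lp.coeFn_add v v')).trans
          (kcomp_add_right (Lp.memLp u) (Lp.memLp v) (Lp.memLp v')))
      (fun c u v => by
        rw [← MemLp.toLp_const_smul, MemLp.toLp_eq_toLp_iff, ← kcomp_smul_right]
        exact kcomp_congr ae_eq_rfl (Lp.coeFn_smul c v)))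
    1 (fun u v => by
      rw [one_mul, LinearMap.mk₂_apply, Lp.norm_toLp, Lp.norm_def, Lp.norm_def,
        ← ENNReal.toReal_mul]
      exact ENNReal.toReal_mono (ENNReal.mul_ne_top (Lp.eLpNorm_ne_top u) (Lp.eLpNorm_ne_top v))
        (eLpNorm_kcomp_le (Lp.memLp u) (Lp.memLp v)))

variable {m}

lemma coeFn_kmul (u v : Lp ℂ 2 (m.prod m)) : kmul m u v =ᵐ[m.prod m] kcomp m u v :=
  (memLp_kcomp (Lp.memLp u) (Lp.memLp v)).coeFn_toLp

lemma norm_kmul_le (u v : Lp ℂ 2 (m.prod m)) : ‖kmul m u v‖ ≤ ‖u‖ * ‖v‖ := by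
  refine ((kmul m).le_opNorm₂ u v).trans ?_
  have h1 : ‖kmul m‖ ≤ 1 := LinearMap.mkContinuous₂_norm_le _ zero_le_one _
  calc ‖kmul m‖ * ‖u‖ * ‖v‖ ≤ 1 * ‖u‖ * ‖v‖ := by gcongr
    _ = ‖u‖ * ‖v‖ := by rw [one_mul]

variable (m) in
/-- The adjoint of a square integrable kernel. -/
noncomputable def kconj (u : Lp ℂ 2 (m.prod m)) : Lp ℂ 2 (m.prod m) :=
  (memLp_kstar (Lp.memLp u)).toLp _

lemma coeFn_kconj (u : Lp ℂ 2 (m.prod m)) : kconj m u =ᵐ[m.prod m] kstar u :=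
  (memLp_kstar (Lp.memLp u)).coeFn_toLp

lemma kstar_congr {k l : α × α → ℂ} (h : k =ᵐ[m.prod m] l) : kstar k =ᵐ[m.prod m] kstar l := by
  filter_upwards [Measure.measurePreserving_swap.quasiMeasurePreserving.ae h] with p hp
  rw [kstar, hp, kstar]

lemma inner_eq_integral (u v : Lp ℂ 2 (m.prod m)) :
    inner ℂ u v = ∫ p, starRingEnd ℂ (u p) * v p ∂(m.prod m) := by
  rw [L2.inner_def]
  congr 1 with p
  rw [RCLike.inner_apply, mul_comm]

lemma kmul_assoc (u v w : Lp ℂ 2 (m.prod m)) :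
    kmul m (kmul m u v) w = kmul m u (kmul m v w) := by
  refine Lp.ext ?_
  calc (kmul m (kmul m u v) w : α × α → ℂ) =ᵐ[m.prod m] kcomp m (kmul m u v) w := coeFn_kmul _ _
    _ =ᵐ[m.prod m] kcomp m (kcomp m u v) w := kcomp_congr (coeFn_kmul u v) ae_eq_rfl
    _ =ᵐ[m.prod m] kcomp m u (kcomp m v w) := kcomp_assoc (Lp.memLp u) (Lp.memLp v) (Lp.memLp w)
    _ =ᵐ[m.prod m] kcomp m u (kmul m v w) := kcomp_congr ae_eq_rfl (coeFn_kmul v w).symm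
    _ =ᵐ[m.prod m] kmul m u (kmul m v w) := (coeFn_kmul _ _).symm

lemma kconj_kconj (u : Lp ℂ 2 (m.prod m)) : kconj m (kconj m u) = u := by
  refine Lp.ext ?_
  have h := (coeFn_kconj (kconj m u)).trans (kstar_congr (coeFn_kconj u))
  rwa [kstar_kstar] at h

lemma kconj_add (u v : Lp ℂ 2 (m.prod m)) : kconj m (u + v) = kconj m u + kconj m v := by
  refine Lp.ext ?_
  refine (coeFn_kconj _).trans ((kstar_congr (Lp.coeFn_add u v)).trans ?_)
  filter_upwards [coeFn_kconj u, coeFn_kconj v, Lp.coeFn_add (kconj m u) (kconj m v)]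
    with p h1 h2 h3
  rw [h3, Pi.add_apply, h1, h2]
  simp [kstar]

lemma kconj_smul (c : ℂ) (u : Lp ℂ 2 (m.prod m)) :
    kconj m (c • u) = (starRingEnd ℂ c) • kconj m u := by
  refine Lp.ext ?_
  refine (coeFn_kconj _).trans ((kstar_congr (Lp.coeFn_smul c u)).trans ?_)
  filter_upwards [coeFn_kconj u, Lp.coeFn_smul (starRingEnd ℂ c) (kconj m u)] with p h1 h2
  rw [h2, Pi.smul_apply, h1]
  simp [kstar]

lemma kconj_kmul (u v : Lp ℂ 2 (m.prod m)) :
    kconj m (kmul m u v) = kmul m (kconj m v) (kconj m u) := by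
  refine Lp.ext ?_
  have h1 := (coeFn_kconj (kmul m u v)).trans (kstar_congr (coeFn_kmul u v))
  rw [kstar_kcomp] at h1
  exact h1.trans ((kcomp_congr (coeFn_kconj v).symm (coeFn_kconj u).symm).trans
    (coeFn_kmul _ _).symm)

lemma inner_kmul_left (u v w : Lp ℂ 2 (m.prod m)) :
    inner ℂ (kmul m u v) w = inner ℂ v (kmul m (kconj m u) w) := by
  rw [inner_eq_integral, inner_eq_integral]
  have h := integral_kcomp_left (Lp.memLp u) (Lp.memLp v) (Lp.memLp w)
  refine Eq.trans (integral_congr_ae ?_) (h.trans (integral_congr_ae ?_))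
  · filter_upwards [coeFn_kmul u v] with p hp
    rw [hp]
  · filter_upwards [(coeFn_kmul (kconj m u) w).trans (kcomp_congr (coeFn_kconj u) ae_eq_rfl)]
      with p hp
    rw [hp]

lemma inner_kconj (u v : Lp ℂ 2 (m.prod m)) :
    inner ℂ u v = inner ℂ (kconj m v) (kconj m u) := by
  rw [inner_eq_integral, inner_eq_integral, integral_kstar]
  refine integral_congr_ae ?_
  filter_upwards [coeFn_kconj u, coeFn_kconj v] with p h1 h2
  rw [h1, h2]

/-- Conjugation reverses products and inner products, so this reduces to the relation for left
multiplication. -/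
lemma inner_kmul_right (u v w : Lp ℂ 2 (m.prod m)) :
    inner ℂ (kmul m v u) w = inner ℂ v (kmul m w (kconj m u)) := by
  rw [inner_kconj, kconj_kmul, ← inner_conj_symm, inner_kmul_left, inner_conj_symm, kconj_kconj,
    inner_kconj v, kconj_kmul, kconj_kconj]

end

lemma kcomp_indicator {m : Measure α} {A B : Set α} (hA : MeasurableSet A) :
    kcomp m ((A ×ˢ A).indicator 1) ((A ×ˢ B).indicator 1) =
      fun p => (m.real A : ℂ) * (A ×ˢ B).indicator 1 p := by
  ext ⟨a, b⟩
  have h : ∀ c, (A ×ˢ A).indicator (1 : α × α → ℂ) (a, c) * (A ×ˢ B).indicator 1 (c, b) =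
      (A.indicator (fun _ => (A ×ˢ B).indicator (1 : α × α → ℂ) (a, b)) c) := by
    intro c
    by_cases h1 : a ∈ A <;> by_cases h2 : c ∈ A <;> by_cases h3 : b ∈ B <;>
      simp [h1, h2, h3]
  simp only [kcomp, h]
  rw [integral_indicator hA, setIntegral_const, Complex.real_smul]

/-- Composing the indicators of `A × A` and `A × B` gives `m(A)` times that of `A × B`. A kernel
orthogonal to all products therefore integrates to zero over every rectangle with sides of finite
measure. -/
lemma dense_kmul {m : Measure α} [SigmaFinite m] :
    Dense (Submodule.span ℂ {w | ∃ u v, w = kmul m u v} : Set (Lp ℂ 2 (m.prod m))) := by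
  rw [Submodule.dense_iff_topologicalClosure_eq_top, Submodule.topologicalClosure_eq_top_iff,
    Submodule.eq_bot_iff]
  intro w hw
  rw [Submodule.mem_orthogonal] at hw
  refine Lp.eq_zero_iff_ae_eq_zero.2
    (ae_eq_zero_of_setIntegral_prod_eq_zero_of_sigmaFinite (Lp.memLp w) fun A B hA hB hA' hB' => ?_)
  -- The factor `m(A)` can be cancelled only when nonzero; otherwise the rectangle itself is null.
  by_cases hA0 : m A = 0
  · refine setIntegral_measure_zero _ ?_
    rw [Measure.prod_prod, hA0, zero_mul]
  have hmem : ∀ C : Set α, MeasurableSet C → m C ≠ ⊤ →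
      MemLp ((A ×ˢ C).indicator (1 : α × α → ℂ)) 2 (m.prod m) := fun C hC hC' =>
    memLp_indicator_const 2 (hA.prod hC) (1 : ℂ)
      (Or.inr (by rw [Measure.prod_prod]; exact ENNReal.mul_ne_top hA' hC'))
  have h1 := hw _ (Submodule.subset_span ⟨(hmem A hA hA').toLp _, (hmem B hB hB').toLp _, rfl⟩)
  rw [inner_eq_integral] at h1
  have h2 : (kmul m ((hmem A hA hA').toLp _) ((hmem B hB hB').toLp _) : α × α → ℂ) =ᵐ[m.prod m]
      fun p => (m.real A : ℂ) * (A ×ˢ B).indicator 1 p := by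
    rw [← kcomp_indicator hA]
    exact (coeFn_kmul _ _).trans (kcomp_congr (MemLp.coeFn_toLp _) (MemLp.coeFn_toLp _))
  have h3 : ∫ p, starRingEnd ℂ
      ((kmul m ((hmem A hA hA').toLp _) ((hmem B hB hB').toLp _) : α × α → ℂ) p) * w p
        ∂(m.prod m) = (m.real A : ℂ) * ∫ p in A ×ˢ B, w p ∂(m.prod m) := by
    rw [← integral_const_mul, ← integral_indicator (hA.prod hB)]
    refine integral_congr_ae ?_
    filter_upwards [h2] with p hp
    rw [hp]
    by_cases hpA : p ∈ A ×ˢ B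
    · simp [Set.indicator_of_mem hpA]
    · simp [Set.indicator_of_notMem hpA]
  rw [h3, mul_eq_zero] at h1
  refine h1.resolve_left ?_
  rw [Complex.ofReal_eq_zero, measureReal_def, ENNReal.toReal_eq_zero_iff]
  tauto

theorem isHilbertAlgebra_kmul {m : Measure α} [SigmaFinite m] :
    IsHilbertAlgebra (ContinuousLinearMap.toLinearMap₁₂ (kmul m)) (kconj m) where
  mul_assoc := kmul_assoc
  conj_add := kconj_add
  conj_smul := kconj_smul
  conj_conj := kconj_kconj
  conj_mul := kconj_kmul
  bounded_left u := ⟨‖u‖, norm_kmul_le u⟩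
  bounded_right u := ⟨‖u‖, fun v => by
    rw [mul_comm]; exact norm_kmul_le v u⟩
  inner_mul_left := inner_kmul_left
  inner_mul_right u v w := inner_kmul_right u v w
  inner_conj := inner_kconj
  dense_mul := dense_kmul

end KernelAlgebra

/-! ### The Weyl correspondence between kernels and functions on `M` -/

section WeylIsometry

variable {E : Type*} [NormedAddCommGroup E] [NormedSpace ℝ E] [FiniteDimensional ℝ E]
  [MeasurableSpace E] [BorelSpace E]
variable {G : Type*} [TopologicalSpace G] [T2Space G] [SecondCountableTopology G]
  [ChartedSpace E G] [Group G] [LieGroup 𝓘(ℝ, E) ∞ G]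
  [MeasurableSpace G] [BorelSpace G] [IsTopologicalGroup G] [LocallyCompactSpace G]
  {m : Measure G} [SFinite m] [m.IsHaarMeasure] {O : Set E} {ħ : ℝ}

namespace IsWeaklyExponential

variable (hO : IsWeaklyExponential G m O) (hħ : ħ ≠ 0)
include hO

/-- The function whose symbol is the kernel `u`, as an element of `L²(M)`. -/
noncomputable def weylFun (hħ : ħ ≠ 0) (u : Lp ℂ 2 (m.prod m)) : Lp ℂ 2 (measL E ħ m) :=
  (exists_isInvFourierL2 hO.density_ne_zero hħ (hO.memLp_symbol (Lp.memLp u))).choose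

lemma isInvFourierL2_weylFun (u : Lp ℂ 2 (m.prod m)) :
    IsInvFourierL2 ħ m (symbol O u) (hO.weylFun hħ u) :=
  (exists_isInvFourierL2 hO.density_ne_zero hħ (hO.memLp_symbol (Lp.memLp u))).choose_spec.1

lemma enorm_weylFun (u : Lp ℂ 2 (m.prod m)) : ‖hO.weylFun hħ u‖ₑ = ‖u‖ₑ := by
  have h := (exists_isInvFourierL2 (ħ := ħ) hO.density_ne_zero hħ
    (hO.memLp_symbol (Lp.memLp u))).choose_spec.2
  refine h.trans ?_
  rw [hO.eLpNorm_symbol (Lp.aestronglyMeasurable u), ← Lp.enorm_def]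

/-- Since `weylFun` is obtained by choice, every identity for it goes through uniqueness of the `L²`
transform: linearity, conjugation and agreement with the integral on test kernels. -/
lemma weylFun_ae_eq {k : G × G → ℂ} (hk : MemLp k 2 (m.prod m)) {f : G × (E →L[ℝ] ℝ) → ℂ}
    (hf : AEStronglyMeasurable f (measL E ħ m)) (h : IsInvFourierL2 ħ m (symbol O k) f) :
    hO.weylFun hħ (hk.toLp k) =ᵐ[measL E ħ m] f := by
  refine isInvFourierL2_unique (hO.memLp_symbol hk) (Lp.aestronglyMeasurable _) hf ?_ h
  exact isInvFourierL2_congr hO.density_ne_zero hħ (hO.memLp_symbol (Lp.memLp _))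
    (hO.symbol_congr hk.coeFn_toLp) ae_eq_rfl (hO.isInvFourierL2_weylFun hħ _)

/-- The Weyl correspondence between square integrable kernels and square integrable functions
on `M`. -/
noncomputable def weylIsometry : Lp ℂ 2 (m.prod m) →ₗᵢ[ℂ] Lp ℂ 2 (measL E ħ m) where
  toFun := hO.weylFun hħ
  map_add' u v := by
    refine Lp.ext ?_
    have h := hO.weylFun_ae_eq hħ (k := (u : G × G → ℂ) + v) ((Lp.memLp u).add (Lp.memLp v))
      ((Lp.aestronglyMeasurable (hO.weylFun hħ u)).add
        (Lp.aestronglyMeasurable (hO.weylFun hħ v))) (by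
        rw [symbol_add]
        exact isInvFourierL2_add (hO.memLp_symbol (Lp.memLp u)) (hO.memLp_symbol (Lp.memLp v))
          (Lp.aestronglyMeasurable _) (Lp.aestronglyMeasurable _)
          (hO.isInvFourierL2_weylFun hħ u) (hO.isInvFourierL2_weylFun hħ v))
    rw [MemLp.toLp_add (Lp.memLp u) (Lp.memLp v), Lp.toLp_coeFn, Lp.toLp_coeFn] at h
    exact h.trans (Lp.coeFn_add _ _).symm
  map_smul' c u := by
    refine Lp.ext ?_
    have h := hO.weylFun_ae_eq hħ (k := c • (u : G × G → ℂ)) ((Lp.memLp u).const_smul c)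
      ((Lp.aestronglyMeasurable (hO.weylFun hħ u)).const_smul c) (by
        rw [symbol_smul]
        exact isInvFourierL2_smul (hO.isInvFourierL2_weylFun hħ u) c)
    rw [MemLp.toLp_const_smul c (Lp.memLp u), Lp.toLp_coeFn] at h
    exact h.trans (Lp.coeFn_smul _ _).symm
  norm_map' u := by
    have h := hO.enorm_weylFun hħ u
    rw [← ofReal_norm, ← ofReal_norm,
      ENNReal.ofReal_eq_ofReal_iff (norm_nonneg _) (norm_nonneg _)] at h
    exact h

lemma weylIsometry_ae_eq {k : G × G → ℂ} (hk : MemLp k 2 (m.prod m))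
    {f : G × (E →L[ℝ] ℝ) → ℂ} (hf : AEStronglyMeasurable f (measL E ħ m))
    (h : IsInvFourierL2 ħ m (symbol O k) f) :
    hO.weylIsometry hħ (hk.toLp k) =ᵐ[measL E ħ m] f :=
  hO.weylFun_ae_eq hħ hk hf h

lemma weylIsometry_mem (u : Lp ℂ 2 (m.prod m)) : hO.weylIsometry hħ u ∈ LSpace ħ m O :=
  ⟨symbol O u, hO.memLp_symbol (Lp.memLp u), fun _ _ hX => symbol_of_notMem hX,
    hO.isInvFourierL2_weylFun hħ u⟩

lemma exists_weylIsometry_eq {f : Lp ℂ 2 (measL E ħ m)} (hf : f ∈ LSpace ħ m O) :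
    ∃ u, hO.weylIsometry hħ u = f := by
  obtain ⟨φ, hφ, h0, h1⟩ := hf
  obtain ⟨k, hk, rfl⟩ := hO.exists_symbol_eq hφ h0
  exact ⟨hk.toLp k, Lp.ext (hO.weylIsometry_ae_eq hħ hk (Lp.aestronglyMeasurable f) h1)⟩

/-- The Weyl correspondence as an isometric isomorphism onto `LSpace`. -/
noncomputable def weylEquiv : Lp ℂ 2 (m.prod m) ≃ₗᵢ[ℂ] LSpace ħ m O :=
  LinearIsometryEquiv.ofSurjective
    { toLinearMap := (hO.weylIsometry hħ).toLinearMap.codRestrict (LSpace ħ m O)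
        (hO.weylIsometry_mem hħ)
      norm_map' := fun u => (hO.weylIsometry hħ).norm_map u }
    (fun f => by
      obtain ⟨u, hu⟩ := hO.exists_weylIsometry_eq hħ f.2
      exact ⟨u, Subtype.ext hu⟩)

lemma coe_weylEquiv (u : Lp ℂ 2 (m.prod m)) :
    ((hO.weylEquiv hħ u : LSpace ħ m O) : Lp ℂ 2 (measL E ħ m)) = hO.weylIsometry hħ u := rfl

/-- Exchanging the end points `q exp(∓X/2)` keeps the midpoint `q` and replaces `X` by `-X`; `F` is
even and `O` symmetric. -/
lemma symbol_kstar (k : G × G → ℂ) (q : G) (X : E) :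
    symbol O (kstar k) (q, X) = starRingEnd ℂ (symbol O k (q, -X)) := by
  by_cases hX : X ∈ O
  · rw [symbol_of_mem (x := (q, X)) hX, symbol_of_mem (x := (q, -X)) (hO.neg_mem hX)]
    have h : (weylMap (q, X) : G × G).swap = weylMap (q, -X) := by
      simp [weylMap]
    simp only [kstar, h, hO.F_neg, map_mul, Complex.conj_ofReal]
  · have hX' : -X ∉ O := fun h => hX (by simpa using hO.neg_mem h)
    rw [symbol_of_notMem (x := (q, X)) hX, symbol_of_notMem (x := (q, -X)) hX', map_zero]

omit [SFinite m] [m.IsHaarMeasure] hO in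
lemma integral_neg_measX (f : E → ℂ) : ∫ X, f (-X) ∂(measX E m) = ∫ X, f X ∂(measX E m) := by
  have h : ∀ g : E → ℂ, ∫ X, g X ∂(measX E m) =
      (density E m : ℝ) • ∫ X, g X ∂(Module.finBasis ℝ E).addHaar := fun g =>
    integral_smul_nnreal_measure g (density E m)
  rw [h, h, integral_neg_eq_self f]

lemma invFourier_trunc_symbol_kstar (k : G × G → ℂ) (R : ℝ) (x : G × (E →L[ℝ] ℝ)) :
    invFourier ħ m (trunc R (symbol O (kstar k))) x =
      starRingEnd ℂ (invFourier ħ m (trunc R (symbol O k)) x) := by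
  rw [invFourier, invFourier, ← integral_conj, ← integral_neg_measX]
  congr 1 with X
  have h1 : trunc R (symbol O (kstar k)) (x.1, -X) =
      starRingEnd ℂ (trunc R (symbol O k) (x.1, X)) := by
    by_cases hX : X ∈ Metric.closedBall (0 : E) R
    · have hX' : -X ∈ Metric.closedBall (0 : E) R := by simpa using hX
      rw [trunc, trunc, Set.indicator_of_mem (by exact ⟨trivial, hX'⟩),
        Set.indicator_of_mem (by exact ⟨trivial, hX⟩), hO.symbol_kstar, neg_neg]
    · have hX' : -X ∉ Metric.closedBall (0 : E) R := by simpa using hX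
      rw [trunc, trunc, Set.indicator_of_notMem (fun h => hX' h.2),
        Set.indicator_of_notMem (fun h => hX h.2), map_zero]
  rw [h1, map_mul, ← Complex.exp_conj]
  congr 2
  simp
  ring

lemma weylIsometry_kconj (u : Lp ℂ 2 (m.prod m)) :
    hO.weylIsometry hħ (kconj m u) =ᵐ[measL E ħ m]
      fun x => starRingEnd ℂ (hO.weylIsometry hħ u x) := by
  refine hO.weylIsometry_ae_eq hħ (memLp_kstar (Lp.memLp u)) ?_ ?_
  · exact (Lp.aestronglyMeasurable (hO.weylIsometry hħ u)).star
  · refine (hO.isInvFourierL2_weylFun hħ u).congr fun R => ?_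
    refine eLpNorm_congr_norm_ae (Eventually.of_forall fun x => ?_)
    simp only [Pi.sub_apply]
    rw [hO.invFourier_trunc_symbol_kstar, ← map_sub, RCLike.norm_conj]
    rfl

end IsWeaklyExponential

end WeylIsometry

/-! ### Transport of a Hilbert algebra along an isometric isomorphism -/

section Transfer

variable {H K : Type*} [NormedAddCommGroup H] [InnerProductSpace ℂ H]
  [NormedAddCommGroup K] [InnerProductSpace ℂ K]

/-- Transport of a bilinear multiplication along an isometric isomorphism. -/
noncomputable def transportMul (T : H ≃ₗᵢ[ℂ] K) (mul : H →L[ℂ] H →L[ℂ] H) : K →L[ℂ] K →L[ℂ] K :=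
  (ContinuousLinearMap.compL ℂ K H K (T.toContinuousLinearEquiv : H →L[ℂ] K)) ∘L
    (mul.bilinearComp (T.symm.toContinuousLinearEquiv : K →L[ℂ] H)
      (T.symm.toContinuousLinearEquiv : K →L[ℂ] H))

lemma transportMul_apply (T : H ≃ₗᵢ[ℂ] K) (mul : H →L[ℂ] H →L[ℂ] H) (u v : K) :
    transportMul T mul u v = T (mul (T.symm u) (T.symm v)) := rfl

theorem IsHilbertAlgebra.transport (T : H ≃ₗᵢ[ℂ] K) {mul : H →L[ℂ] H →L[ℂ] H} {conj : H → H}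
    (h : IsHilbertAlgebra (ContinuousLinearMap.toLinearMap₁₂ mul) conj) :
    IsHilbertAlgebra (ContinuousLinearMap.toLinearMap₁₂ (transportMul T mul))
      (fun u => T (conj (T.symm u))) := by
  have happ : ∀ u v : K, ContinuousLinearMap.toLinearMap₁₂ (transportMul T mul) u v =
      T (ContinuousLinearMap.toLinearMap₁₂ mul (T.symm u) (T.symm v)) := fun u v => rfl
  have hin : ∀ (u : H) (v : K), inner ℂ (T u) v = inner ℂ u (T.symm v) := fun u v => by
    conv_lhs => rw [← T.apply_symm_apply v]
    exact T.inner_map_map _ _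
  have hin' : ∀ (u : K) (v : H), inner ℂ u (T v) = inner ℂ (T.symm u) v := fun u v => by
    conv_lhs => rw [← T.apply_symm_apply u]
    exact T.inner_map_map _ _
  refine ⟨?_, ?_, ?_, ?_, ?_, ?_, ?_, ?_, ?_, ?_, ?_⟩
  · intro f g k
    simp only [happ, T.symm_apply_apply, h.mul_assoc]
  · intro f g
    simp only [map_add, h.conj_add]
  · intro c f
    simp only [map_smul, h.conj_smul]
  · intro f
    simp only [T.symm_apply_apply, h.conj_conj, T.apply_symm_apply]
  · intro f g
    simp only [happ, T.symm_apply_apply, h.conj_mul]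
  · intro f
    obtain ⟨C, hC⟩ := h.bounded_left (T.symm f)
    refine ⟨C, fun g => ?_⟩
    rw [happ, T.norm_map, ← T.symm.norm_map g]
    exact hC _
  · intro f
    obtain ⟨C, hC⟩ := h.bounded_right (T.symm f)
    refine ⟨C, fun g => ?_⟩
    rw [happ, T.norm_map, ← T.symm.norm_map g]
    exact hC _
  · intro f g k
    rw [happ, happ, hin, hin', h.inner_mul_left, T.symm_apply_apply]
  · intro f g k
    rw [happ, happ, hin, hin', h.inner_mul_right, T.symm_apply_apply]
  · intro f g
    rw [T.inner_map_map, ← h.inner_conj, T.symm.inner_map_map]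
  · have himg : (Submodule.span ℂ {k : K | ∃ f g,
        k = ContinuousLinearMap.toLinearMap₁₂ (transportMul T mul) f g} : Set K) =
        T '' (Submodule.span ℂ {k : H | ∃ f g,
          k = ContinuousLinearMap.toLinearMap₁₂ mul f g} : Set H) := by
      have h2 : {k : K | ∃ f g, k = ContinuousLinearMap.toLinearMap₁₂ (transportMul T mul) f g} =
          T.toLinearEquiv.toLinearMap '' {k : H | ∃ f g,
            k = ContinuousLinearMap.toLinearMap₁₂ mul f g} := by
        ext k
        constructor
        · rintro ⟨f, g, rfl⟩
          exact ⟨_, ⟨T.symm f, T.symm g, rfl⟩, rfl⟩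
        · rintro ⟨_, ⟨f, g, rfl⟩, rfl⟩
          refine ⟨T f, T g, ?_⟩
          rw [happ, T.symm_apply_apply, T.symm_apply_apply]
          rfl
      rw [h2, Submodule.span_image, Submodule.map_coe]
      rfl
    rw [himg]
    exact T.surjective.denseRange.dense_image T.continuous h.dense_mul

end Transfer

/-! ### Test kernels and the space `F(M)` -/

section TestKernels

variable {E : Type*} [NormedAddCommGroup E] [NormedSpace ℝ E] [FiniteDimensional ℝ E]
  [MeasurableSpace E] [BorelSpace E]
variable {G : Type*} [TopologicalSpace G] [T2Space G] [SecondCountableTopology G]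
  [ChartedSpace E G] [Group G] [LieGroup 𝓘(ℝ, E) ∞ G]
  [MeasurableSpace G] [BorelSpace G] [IsTopologicalGroup G] [LocallyCompactSpace G]
  {m : Measure G} [SFinite m] [m.IsHaarMeasure] {O : Set E} {ħ : ℝ}

variable (E) in
/-- Smooth compactly supported kernels on `G × G`. -/
structure IsTestKernel {G : Type*} [TopologicalSpace G] [ChartedSpace E G] (k : G × G → ℂ) :
    Prop where
  contMDiff : ContMDiff (𝓘(ℝ, E).prod 𝓘(ℝ, E)) 𝓘(ℝ, ℂ) ∞ k
  hasCompactSupport : HasCompactSupport k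

lemma IsTestKernel.continuous {k : G × G → ℂ} (hk : IsTestKernel E k) : Continuous k :=
  hk.contMDiff.continuous

lemma IsTestKernel.memLp {k : G × G → ℂ} (hk : IsTestKernel E k) : MemLp k 2 (m.prod m) :=
  hk.continuous.memLp_of_hasCompactSupport hk.hasCompactSupport

namespace IsWeaklyExponential

variable (hO : IsWeaklyExponential G m O) (hħ : ħ ≠ 0)
include hO

/-- This is where the precompactness hypothesis enters. The set `C ∩ exp O` need not be compact in
`exp O`, yet its logarithms stay bounded. -/
lemma exists_bound_of_isCompact {C : Set G} (hC : IsCompact C) :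
    ∃ R : ℝ, ∀ X ∈ O, lieExp G X ∈ C → ‖X‖ ≤ R := by
  have h1 : IsCompact (closure (C ∩ lieExp G '' O)) :=
    hC.of_isClosed_subset isClosed_closure
      (closure_minimal Set.inter_subset_left hC.isClosed)
  have h2 := hO.precompact (C ∩ lieExp G '' O) Set.inter_subset_right h1
  obtain ⟨R, hR⟩ := (h2.isBounded.subset subset_closure).exists_norm_le
  exact ⟨R, fun X hX hXC => hR X ⟨lieExp G X, ⟨hXC, X, hX, rfl⟩, hO.lieLog_lieExp hX⟩⟩

lemma symbol_mem_FTilde {k : G × G → ℂ} (hk : IsTestKernel E k) : symbol O k ∈ FTilde m O := by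
  refine ⟨hO.memLp_symbol hk.memLp, fun q X hX => symbol_of_notMem hX,
    k, hk.contMDiff, hk.hasCompactSupport, fun a b hab => ?_⟩
  have hV : V O a b ∈ O := lieLog_mem hab
  have h1 : weylMap (a * lieExp G ((1 / 2 : ℝ) • V O a b), V O a b) = (a, b) :=
    weylMap_weylInv (p := (a, b)) hab
  rw [symbol_of_mem (x := (_, V O a b)) hV, h1]
  have hF : ((F G (V O a b) : ℝ) : ℂ) ≠ 0 := by exact_mod_cast (hO.F_pos hV).ne'
  dsimp only
  field_simp

lemma exists_of_mem_FTilde {φ : G × E → ℂ} (hφ : φ ∈ FTilde m O) :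
    ∃ k, IsTestKernel E k ∧ φ = symbol O k := by
  obtain ⟨-, h0, k, hk1, hk2, hk⟩ := hφ
  refine ⟨k, ⟨hk1, hk2⟩, ?_⟩
  ext x
  by_cases hx : x.2 ∈ O
  · have hU : (weylMap x).1⁻¹ * (weylMap x).2 ∈ lieExp G '' O := by
      rw [weylMap_inv_mul]; exact Set.mem_image_of_mem _ hx
    have h1 := hk (weylMap x).1 (weylMap x).2 hU
    have hV : V O (weylMap x).1 (weylMap x).2 = x.2 := by
      rw [V, weylMap_inv_mul, hO.lieLog_lieExp hx]
    have h2 : ((weylMap x).1 * lieExp G ((1 / 2 : ℝ) • V O (weylMap x).1 (weylMap x).2),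
        V O (weylMap x).1 (weylMap x).2) = x := hO.weylInv_weylMap hx
    have hF : ((F G x.2 : ℝ) : ℂ) ≠ 0 := by exact_mod_cast (hO.F_pos hx).ne'
    rw [h2, hV] at h1
    rw [symbol_of_mem hx, ← Prod.mk.eta (p := weylMap x), h1]
    field_simp
  · rw [symbol_of_notMem hx, ← h0 x.1 x.2 hx]

/-- Where the symbol is nonzero, `exp X = a⁻¹b` with `(a, b)` in the support of `k`, so `X` is
bounded. Hence the `L²` transform of the symbol is the ordinary integral. -/
lemma exists_trunc_symbol_eq {k : G × G → ℂ} (hk : HasCompactSupport k) :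
    ∃ R₀ : ℝ, ∀ R ≥ R₀, trunc R (symbol O k) = symbol O k := by
  have hC : IsCompact ((fun p : G × G => p.1⁻¹ * p.2) '' tsupport k) :=
    hk.isCompact.image (by fun_prop)
  obtain ⟨R₀, hR₀⟩ := hO.exists_bound_of_isCompact hC
  refine ⟨R₀, fun R hR => Set.indicator_eq_self.2 fun x hx => ?_⟩
  refine ⟨trivial, ?_⟩
  have hxO : x.2 ∈ O := by
    by_contra h
    exact hx (symbol_of_notMem h)
  have hkx : k (weylMap x) ≠ 0 := by
    intro h
    refine hx ?_
    rw [symbol_of_mem hxO, h, mul_zero]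
  have := hR₀ x.2 hxO ⟨weylMap x, subset_tsupport k hkx, weylMap_inv_mul x⟩
  simpa using this.trans hR

lemma isInvFourierL2_invFourier {k : G × G → ℂ} (hk : HasCompactSupport k) :
    IsInvFourierL2 ħ m (symbol O k) (invFourier ħ m (symbol O k)) := by
  obtain ⟨R₀, hR₀⟩ := hO.exists_trunc_symbol_eq hk
  refine tendsto_const_nhds.congr' ?_
  filter_upwards [eventually_ge_atTop R₀] with R hR
  rw [hR₀ R hR, sub_self, eLpNorm_zero]

lemma aestronglyMeasurable_invFourier_symbol {k : G × G → ℂ} (hk : IsTestKernel E k) :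
    AEStronglyMeasurable (invFourier ħ m (symbol O k)) (measL E ħ m) := by
  obtain ⟨R₀, hR₀⟩ := hO.exists_trunc_symbol_eq hk.hasCompactSupport
  have := aestronglyMeasurable_invFourier ħ m (hO.memLp_symbol hk.memLp) R₀
  rwa [hR₀ R₀ le_rfl] at this

lemma weylEquiv_ae_eq {k : G × G → ℂ} (hk : IsTestKernel E k) :
    (hO.weylEquiv hħ (hk.memLp.toLp k) : LSpace ħ m O).1 =ᵐ[measL E ħ m]
      invFourier ħ m (symbol O k) :=
  hO.weylIsometry_ae_eq hħ hk.memLp (hO.aestronglyMeasurable_invFourier_symbol hk)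
    (hO.isInvFourierL2_invFourier hk.hasCompactSupport)

lemma eLpNorm_invFourier_symbol (hħ : ħ ≠ 0) {k : G × G → ℂ} (hk : IsTestKernel E k) :
    eLpNorm (invFourier ħ m (symbol O k)) 2 (measL E ħ m) = eLpNorm k 2 (m.prod m) := by
  rw [← eLpNorm_congr_ae (hO.weylEquiv_ae_eq hħ hk), ← Lp.enorm_def, hO.coe_weylEquiv]
  exact (hO.enorm_weylFun hħ _).trans (Lp.enorm_toLp hk.memLp)

lemma memLp_invFourier_symbol (hħ : ħ ≠ 0) {k : G × G → ℂ} (hk : IsTestKernel E k) :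
    MemLp (invFourier ħ m (symbol O k)) 2 (measL E ħ m) :=
  ⟨hO.aestronglyMeasurable_invFourier_symbol hk, by
    rw [hO.eLpNorm_invFourier_symbol hħ hk]; exact hk.memLp.2⟩

/-- The isometry makes the two kernels agree almost everywhere; they are continuous and Haar measure
charges open sets, so they agree everywhere. This makes the choice in `fourier` return the intended
symbol. -/
lemma injOn_invFourier (hħ : ħ ≠ 0) : Set.InjOn (invFourier ħ m) (FTilde m O) := by
  intro φ hφ ψ hψ h
  obtain ⟨k, hk, rfl⟩ := hO.exists_of_mem_FTilde hφ
  obtain ⟨l, hl, rfl⟩ := hO.exists_of_mem_FTilde hψ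
  have h1 : hO.weylEquiv hħ (hk.memLp.toLp k) = hO.weylEquiv hħ (hl.memLp.toLp l) := by
    refine Subtype.ext (Lp.ext ?_)
    refine (hO.weylEquiv_ae_eq hħ hk).trans ?_
    rw [h]
    exact (hO.weylEquiv_ae_eq hħ hl).symm
  have h2 := (MemLp.toLp_eq_toLp_iff _ _).1 ((hO.weylEquiv hħ).injective h1)
  rw [hk.continuous.ae_eq_iff_eq _ hl.continuous] at h2
  rw [h2]

lemma fourier_invFourier_symbol (hħ : ħ ≠ 0) {k : G × G → ℂ} (hk : IsTestKernel E k) :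
    fourier ħ m O (invFourier ħ m (symbol O k)) = symbol O k :=
  (hO.injOn_invFourier hħ).leftInvOn_invFunOn (hO.symbol_mem_FTilde hk)

lemma mem_FSpace_iff {f : G × (E →L[ℝ] ℝ) → ℂ} :
    f ∈ FSpace ħ m O ↔ ∃ k, IsTestKernel E k ∧ f = invFourier ħ m (symbol O k) := by
  constructor
  · rintro ⟨φ, hφ, rfl⟩
    obtain ⟨k, hk, rfl⟩ := hO.exists_of_mem_FTilde hφ
    exact ⟨k, hk, rfl⟩
  · rintro ⟨k, hk, rfl⟩
    exact ⟨_, hO.symbol_mem_FTilde hk, rfl⟩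

end IsWeaklyExponential

end TestKernels

/-! ### Density of test kernels in `L²(G × G)` -/

section Density

variable {E : Type*} [NormedAddCommGroup E] [NormedSpace ℝ E] [FiniteDimensional ℝ E]
  [MeasurableSpace E] [BorelSpace E]
variable {G : Type*} [TopologicalSpace G] [T2Space G] [SecondCountableTopology G]
  [ChartedSpace E G] [Group G] [LieGroup 𝓘(ℝ, E) ∞ G]
  [MeasurableSpace G] [BorelSpace G] [IsTopologicalGroup G] [LocallyCompactSpace G]
  {m : Measure G} [SFinite m] [m.IsHaarMeasure]

lemma exists_testKernel_eLpNorm_sub_le {g : G × G → ℂ} (hg : Continuous g)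
    (hgs : HasCompactSupport g) {ε : ℝ} (hε : 0 < ε) :
    ∃ k, IsTestKernel E k ∧ eLpNorm (g - k) 2 (m.prod m) ≤ ENNReal.ofReal ε := by
  set K := tsupport g
  have hK : MeasurableSet K := (isClosed_tsupport g).measurableSet
  have hKm : m.prod m K ≠ ⊤ := hgs.isCompact.measure_lt_top.ne
  set c : ℝ≥0∞ := (m.prod m K) ^ (1 / (2 : ℝ≥0∞).toReal)
  have hc : c ≠ ⊤ := ENNReal.rpow_ne_top_of_nonneg (by positivity) hKm
  -- A uniform error `δ` on `K` costs at most `δ c` in `L²`; the added `1` keeps the denominator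
  -- positive when `c = 0`.
  set δ : ℝ := ε / (1 + c.toReal)
  have hpos : 0 < 1 + c.toReal := by positivity
  have hδ : 0 < δ := div_pos hε hpos
  obtain ⟨k, hk1, hk2⟩ := hg.exists_contMDiff_approx (𝓘(ℝ, E).prod 𝓘(ℝ, E)) ⊤
    (ε := fun _ => δ) continuous_const (fun _ => hδ)
  refine ⟨k, ⟨k.contMDiff, hgs.mono hk2⟩, ?_⟩
  have h1 : ∀ p, ‖(g - k) p‖ ≤ ‖K.indicator (fun _ => δ) p‖ := by
    intro p
    by_cases hp : p ∈ K
    · rw [Set.indicator_of_mem hp, Real.norm_of_nonneg hδ.le, Pi.sub_apply, ← dist_eq_norm,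
        dist_comm]
      exact (hk1 p).le
    · have hg0 : g p = 0 := image_eq_zero_of_notMem_tsupport hp
      have hk0 : k p = 0 := by
        by_contra h
        exact hk2 h hg0
      simp [hg0, hk0]
  refine (eLpNorm_mono h1).trans ((eLpNorm_indicator_const_le δ 2).trans ?_)
  have h2 : ‖δ‖ₑ = ENNReal.ofReal δ := by rw [← ofReal_norm, Real.norm_of_nonneg hδ.le]
  change ‖δ‖ₑ * c ≤ _
  rw [h2, ← ENNReal.ofReal_toReal hc, ← ENNReal.ofReal_mul hδ.le]
  refine ENNReal.ofReal_le_ofReal ?_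
  rw [div_mul_eq_mul_div, div_le_iff₀ hpos]
  nlinarith

/-- Smooth compactly supported kernels are dense in `L²(G × G)`. -/
lemma dense_testKernels :
    Dense {u : Lp ℂ 2 (m.prod m) | ∃ (k : G × G → ℂ) (hk : IsTestKernel E k),
      u = hk.memLp.toLp k} := by
  refine Metric.dense_iff.2 fun u ε hε => ?_
  have hε' : ENNReal.ofReal (ε / 3) ≠ 0 := by simpa using hε
  obtain ⟨g, hgs, hgu, hg, hg2⟩ :=
    (Lp.memLp u).exists_hasCompactSupport_eLpNorm_sub_le (by norm_num) hε'
  obtain ⟨k, hk, hkg⟩ := exists_testKernel_eLpNorm_sub_le (E := E) (m := m) hg hgs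
    (show 0 < ε / 3 by positivity)
  refine ⟨hk.memLp.toLp k, ?_, k, hk, rfl⟩
  rw [Metric.mem_ball, dist_comm, ← Lp.toLp_coeFn u (Lp.memLp u), dist_edist,
    Lp.edist_toLp_toLp]
  have h1 : eLpNorm (⇑u - k) 2 (m.prod m) ≤ ENNReal.ofReal (ε / 3 + ε / 3) := by
    rw [ENNReal.ofReal_add (by positivity) (by positivity)]
    have : (⇑u - k : G × G → ℂ) = (⇑u - g) + (g - k) := by abel
    rw [this]
    exact (eLpNorm_add_le ((Lp.aestronglyMeasurable u).sub hg2.1)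
      (hg2.1.sub hk.memLp.1) (by norm_num)).trans (add_le_add hgu hkg)
  refine (ENNReal.toReal_mono ENNReal.ofReal_ne_top h1).trans_lt ?_
  rw [ENNReal.toReal_ofReal (by positivity)]
  linarith

end Density

/-! ### Composition preserves smooth compactly supported kernels -/

section Smooth

variable {E : Type*} [NormedAddCommGroup E] [NormedSpace ℝ E] [FiniteDimensional ℝ E]
  [MeasurableSpace E] [BorelSpace E]
variable {G : Type*} [TopologicalSpace G] [T2Space G] [SecondCountableTopology G]
  [ChartedSpace E G] [Group G] [LieGroup 𝓘(ℝ, E) ∞ G]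
  [MeasurableSpace G] [BorelSpace G] [IsTopologicalGroup G] [LocallyCompactSpace G]
  {m : Measure G} {O : Set E}

variable (E) in
/-- The measure `rho(X) dX` on `O`. -/
noncomputable def logMeasure (m : Measure G) (O : Set E) : Measure E :=
  ((measX E m).restrict O).withDensity fun X => ENNReal.ofReal (rho G X)

instance [SFinite m] : SFinite (logMeasure E m O) := by
  unfold logMeasure; infer_instance

namespace IsWeaklyExponential

variable (hO : IsWeaklyExponential G m O)
include hO

lemma contMDiff_lieExp : ContMDiff 𝓘(ℝ, E) 𝓘(ℝ, E) ∞ (lieExp G : E → G) := by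
  intro X
  have h1 : Tendsto (fun n : ℕ => ((1 : ℝ) / ((n : ℝ) + 1)) • X) atTop (𝓝 0) := by
    simpa using (tendsto_one_div_add_atTop_nhds_zero_nat (𝕜 := ℝ)).smul_const X
  obtain ⟨n, hn⟩ := (h1.eventually (hO.isOpen.mem_nhds hO.zero_mem)).exists
  have h2 : ContMDiffAt 𝓘(ℝ, E) 𝓘(ℝ, E) ∞
      (fun Y : E => lieExp G (((1 : ℝ) / ((n : ℝ) + 1)) • Y)) X := by
    refine (hO.contMDiffAt_lieExp hn).comp X ?_
    exact (contDiff_const_smul _).contMDiff.contMDiffAt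
  have h3 : (lieExp G : E → G) =
      fun Y => lieExp G (((1 : ℝ) / ((n : ℝ) + 1)) • Y) ^ (n + 1) := by
    ext Y
    rw [← lieExp_natCast_smul, smul_smul]
    congr 1
    have : (n : ℝ) + 1 ≠ 0 := by positivity
    push_cast
    rw [mul_one_div_cancel this, one_smul]
  rw [h3]
  exact ((contMDiff_pow (I := 𝓘(ℝ, E)) (n := ∞) (G := G) (n + 1)) _).comp X h2

variable [SFinite m] [m.IsHaarMeasure]

lemma measurePreserving_lieExp : MeasurePreserving (lieExp G) (logMeasure E m O) m := by
  refine ⟨hO.continuous_lieExp.measurable, ?_⟩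
  refine Measure.ext_of_lintegral _ fun f hf => ?_
  rw [hO.lintegral_eq hf]
  exact hO.lintegral_expMeasure _ hf

lemma integral_eq {f : G → ℂ} (hf : AEStronglyMeasurable f m) :
    ∫ x, f x ∂m = ∫ X in O, rho G X • f (lieExp G X) ∂(measX E m) := by
  have h := hO.measurePreserving_lieExp
  have h1 : ∫ X, f (lieExp G X) ∂(logMeasure E m O) = ∫ x, f x ∂m := by
    rw [← integral_map h.measurable.aemeasurable (by rwa [h.map_eq]), h.map_eq]
  rw [← h1, logMeasure, integral_withDensity_eq_integral_toReal_smul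
    hO.measurable_rho
    (Eventually.of_forall fun _ => ENNReal.ofReal_lt_top)]
  refine integral_congr_ae (Eventually.of_forall fun X => ?_)
  simp only [ENNReal.toReal_ofReal (rho_nonneg X)]

-- In exponential coordinates the composition is the integral of the merely locally integrable
-- weight `ρ · 1_O` against a smooth function with parameters. Read as a convolution at `0`, it is
-- covered by smoothness of convolutions with parameters; this is the origin of the signs `-X`.
open Convolution in
lemma contDiff_kcomp_exp {k l : G × G → ℂ} (hk : IsTestKernel E k) (hl : IsTestKernel E l)
    (a b : G) : ContDiff ℝ ∞ fun U : E × E => kcomp m k l (a * lieExp G U.1, b * lieExp G U.2) := by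
  have hC : IsCompact (Prod.snd '' tsupport k) := hk.hasCompactSupport.isCompact.image continuous_snd
  obtain ⟨R, hR⟩ := hO.exists_bound_of_isCompact hC
  -- The exponential map need not be injective or proper off `O`, so `k(·, exp X)` need not have
  -- compact support in `X`. The cutoff supplies it, and equals `1` at the points of `O` that
  -- contribute; `max R 1` keeps the radius positive.
  let χ : ContDiffBump (0 : E) := ⟨max R 1, max R 1 + 1, by positivity, by linarith⟩
  set g : E × E → E → ℂ := fun U X => χ (-X) • (k (a * lieExp G U.1, lieExp G (-X)) *
    l (lieExp G (-X), b * lieExp G U.2))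
  set f : E → ℝ := O.indicator (rho G)
  have hf : LocallyIntegrable f (measX E m) :=
    hO.continuous_rho.locallyIntegrable.indicator hO.measurableSet_O
  have he1 : ContMDiff 𝓘(ℝ, (E × E) × E) 𝓘(ℝ, E) ∞
      fun z : (E × E) × E => a * lieExp G z.1.1 :=
    (contMDiff_mul_left' a).comp (hO.contMDiff_lieExp.comp
      (contDiff_fst.comp contDiff_fst).contMDiff)
  have he2 : ContMDiff 𝓘(ℝ, (E × E) × E) 𝓘(ℝ, E) ∞
      fun z : (E × E) × E => b * lieExp G z.1.2 :=
    (contMDiff_mul_left' b).comp (hO.contMDiff_lieExp.comp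
      (contDiff_snd.comp contDiff_fst).contMDiff)
  have he3 : ContMDiff 𝓘(ℝ, (E × E) × E) 𝓘(ℝ, E) ∞
      fun z : (E × E) × E => lieExp G (-z.2) :=
    hO.contMDiff_lieExp.comp contDiff_snd.neg.contMDiff
  have hg : ContDiff ℝ ∞ ↿g := by
    have h1 : ContDiff ℝ ∞ fun z : (E × E) × E => χ (-z.2) := χ.contDiff.comp contDiff_snd.neg
    have h2 : ContDiff ℝ ∞ fun z : (E × E) × E => k (a * lieExp G z.1.1, lieExp G (-z.2)) :=
      (hk.contMDiff.comp (he1.prodMk he3)).contDiff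
    have h3 : ContDiff ℝ ∞ fun z : (E × E) × E => l (lieExp G (-z.2), b * lieExp G z.1.2) :=
      (hl.contMDiff.comp (he3.prodMk he2)).contDiff
    exact h1.smul (h2.mul h3)
  have hconv : ContDiff ℝ ∞ fun U : E × E =>
      (f ⋆[ContinuousLinearMap.lsmul ℝ ℝ, measX E m] g U) 0 := by
    rw [← contDiffOn_univ]
    refine contDiffOn_convolution_right_with_param_comp (n := ⊤)
      (ContinuousLinearMap.lsmul ℝ ℝ) (v := fun _ => (0 : E)) contDiffOn_const
      isOpen_univ (isCompact_closedBall (0 : E) (max R 1 + 1)) ?_ hf hg.contDiffOn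
    intro U X _ hX
    have : χ (-X) = 0 := by
      refine χ.zero_of_le_dist ?_
      have : max R 1 + 1 < ‖X‖ := by simpa using hX
      simpa using this.le
    simp only [g, this, zero_smul]
  suffices h : (fun U : E × E => kcomp m k l (a * lieExp G U.1, b * lieExp G U.2)) =
      fun U => (f ⋆[ContinuousLinearMap.lsmul ℝ ℝ, measX E m] g U) 0 by
    rw [h]; exact hconv
  funext U
  have hmeas : AEStronglyMeasurable (fun c => k (a * lieExp G U.1, c) *
      l (c, b * lieExp G U.2)) m := by
    have h1 := hk.continuous
    have h2 := hl.continuous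
    exact Continuous.aestronglyMeasurable (by fun_prop)
  rw [kcomp, hO.integral_eq hmeas, convolution_def, ← integral_indicator hO.measurableSet_O]
  congr 1 with X
  by_cases hX : X ∈ O
  · simp only [f, g, Set.indicator_of_mem hX, zero_sub, neg_neg, ContinuousLinearMap.lsmul_apply]
    by_cases hkX : k (a * lieExp G U.1, lieExp G X) = 0
    · simp [hkX]
    · have hXR : ‖X‖ ≤ R := hR X hX ⟨_, subset_tsupport k hkX, rfl⟩
      have hχ : χ X = 1 := χ.one_of_mem_closedBall (by
        rw [mem_closedBall_zero_iff]; exact hXR.trans (le_max_left _ _))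
      rw [hχ, one_smul]
  · simp only [f, Set.indicator_of_notMem hX, ContinuousLinearMap.lsmul_apply, zero_smul]

lemma isTestKernel_kcomp {k l : G × G → ℂ} (hk : IsTestKernel E k) (hl : IsTestKernel E l) :
    IsTestKernel E (kcomp m k l) := by
  refine ⟨fun p => ?_, ?_⟩
  · have hlog : ∀ a : G, ContMDiffAt 𝓘(ℝ, E) 𝓘(ℝ, E) ∞ (fun x : G => lieLog O (a⁻¹ * x)) a :=
      fun a => ContMDiffAt.comp a (hO.contMDiffAt_lieLog (by simpa using hO.one_mem_image))
        (contMDiff_mul_left' a⁻¹ a)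
    have h1 : ContMDiffAt (𝓘(ℝ, E).prod 𝓘(ℝ, E)) 𝓘(ℝ, E × E) ∞
        (fun x : G × G => (lieLog O (p.1⁻¹ * x.1), lieLog O (p.2⁻¹ * x.2))) p :=
      ContMDiffAt.prodMk_space ((hlog p.1).comp p contMDiffAt_fst)
        ((hlog p.2).comp p contMDiffAt_snd)
    refine ContMDiffAt.congr_of_eventuallyEq
      ((hO.contDiff_kcomp_exp hk hl p.1 p.2).contMDiff.contMDiffAt.comp p h1) ?_
    have hev : ∀ a : G, ∀ᶠ x in 𝓝 a, a⁻¹ * x ∈ lieExp G '' O := fun a =>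
      (continuous_const_mul a⁻¹).continuousAt.eventually
        (hO.isOpen_image.mem_nhds (by simpa using hO.one_mem_image))
    filter_upwards [(continuous_fst.continuousAt (x := p)).eventually (hev p.1),
      (continuous_snd.continuousAt (x := p)).eventually (hev p.2)] with x hx1 hx2
    simp only [Function.comp_apply]
    rw [lieExp_lieLog hx1, lieExp_lieLog hx2, mul_inv_cancel_left, mul_inv_cancel_left]
  · refine HasCompactSupport.intro ((hk.hasCompactSupport.isCompact.image continuous_fst).prod
      (hl.hasCompactSupport.isCompact.image continuous_snd)) fun p hp => ?_
    have h0 : ∀ c, k (p.1, c) * l (c, p.2) = 0 := by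
      intro c
      by_contra h
      have h1 := left_ne_zero_of_mul h
      have h2 := right_ne_zero_of_mul h
      exact hp ⟨⟨_, subset_tsupport k h1, rfl⟩, ⟨_, subset_tsupport l h2, rfl⟩⟩
    simp [kcomp, h0]

end IsWeaklyExponential

end Smooth

/-! ### The star-product as composition of kernels -/

section StarProduct

variable {E : Type*} [NormedAddCommGroup E] [NormedSpace ℝ E] [FiniteDimensional ℝ E]
  [MeasurableSpace E] [BorelSpace E]
variable {G : Type*} [TopologicalSpace G] [T2Space G] [SecondCountableTopology G]
  [ChartedSpace E G] [Group G] [LieGroup 𝓘(ℝ, E) ∞ G]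
  [MeasurableSpace G] [BorelSpace G] [IsTopologicalGroup G] [LocallyCompactSpace G]
  {m : Measure G} {O : Set E} {ħ : ℝ}

/-- The integrand of the kernel of the star-product at the point `x`, as a function of
`(c, Z) ∈ G × 𝔤`. -/
noncomputable def starIntegrand (ħ : ℝ) (k l : G × G → ℂ) (x : G × (E →L[ℝ] ℝ)) (y : G × E) : ℂ :=
  (F G y.2 : ℂ) * Complex.exp (-(Complex.I / (ħ : ℂ)) * ((x.2 y.2 : ℝ) : ℂ)) *
    (k ((weylMap (x.1, y.2)).1, (weylMap (x.1, y.2)).1 * y.1) *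
      l ((weylMap (x.1, y.2)).1 * y.1, (weylMap (x.1, y.2)).2))

open Classical in
/-- The integrand of the star-product at the point `x`, as a density on `G × G`. -/
noncomputable def starDensity (ħ : ℝ) (O : Set E) (k l : G × G → ℂ) (x : G × (E →L[ℝ] ℝ))
    (y : G × G) : ℂ :=
  if y.2 ∈ lieExp G '' O then
    ((rho G (lieLog O y.2))⁻¹ : ℂ) * starIntegrand ħ k l x (y.1, lieLog O y.2)
  else 0

namespace IsWeaklyExponential

variable (hO : IsWeaklyExponential G m O)
include hO

/-- From `F² = ρ δ(exp(·/2))` and `δ(exp(X/2)) δ(exp(Y/2)) = δ(exp(Z/2))`, which are positive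
numbers with equal squares. Thus the weights of the two symbols, together with `L`, are the
Jacobians for `exp X` and `exp Y`, the inverse Jacobian for `exp Z`, and the weight `F(Z)` of the
composed symbol. -/
lemma F_mul_F_div_F {X Y Z : E} (hZ : Z ∈ O)
    (h : lieExp G Z = lieExp G X * lieExp G Y) :
    F G X * F G Y * (F G X * F G Y / F G Z) = rho G X * rho G Y * ((rho G Z)⁻¹ * F G Z) := by
  have hd : delta E (lieExp G ((1 / 2 : ℝ) • X)) * delta E (lieExp G ((1 / 2 : ℝ) • Y)) =
      delta E (lieExp G ((1 / 2 : ℝ) • Z)) := by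
    refine (pow_left_inj₀ (mul_pos (delta_pos _) (delta_pos _)).le (delta_pos _).le
      two_ne_zero).1 ?_
    rw [mul_pow, sq_delta_half, sq_delta_half, sq_delta_half, h, delta_mul]
  have hF := (hO.F_pos hZ).ne'
  have hr := (hO.rho_pos hZ).ne'
  have hX2 := F_sq (G := G) X
  have hY2 := F_sq (G := G) Y
  have hZ2 := F_sq (G := G) Z
  rw [← hd] at hZ2
  field_simp
  rw [hX2, hY2, hZ2]
  ring

lemma continuous_starIntegrand {k l : G × G → ℂ} (hk : Continuous k) (hl : Continuous l)
    (x : G × (E →L[ℝ] ℝ)) : Continuous (starIntegrand ħ k l x : G × E → ℂ) := by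
  have h1 : Continuous fun y : G × E => weylMap (x.1, y.2) :=
    hO.continuous_weylMap.comp (by fun_prop)
  have h2 : Continuous fun y : G × E => F G y.2 := hO.continuous_F.comp continuous_snd
  have h3 : Continuous fun y : G × E => x.2 y.2 := x.2.continuous.comp continuous_snd
  have h4 : Continuous fun y : G × E => (weylMap (x.1, y.2)).1 * y.1 :=
    (continuous_fst.comp h1).mul continuous_fst
  exact ((Complex.continuous_ofReal.comp h2).mul (Complex.continuous_exp.comp
    (continuous_const.mul (Complex.continuous_ofReal.comp h3)))).mul
    ((hk.comp ((continuous_fst.comp h1).prodMk h4)).mul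
      (hl.comp (h4.prodMk (continuous_snd.comp h1))))

lemma measurable_starDensity {k l : G × G → ℂ} (hk : Continuous k) (hl : Continuous l)
    (x : G × (E →L[ℝ] ℝ)) : Measurable (starDensity ħ O k l x : G × G → ℂ) := by
  have h1 : Measurable fun y : G × G => lieLog O y.2 := hO.measurable_lieLog.comp measurable_snd
  refine Measurable.ite (measurable_snd hO.measurableSet_image) ?_ measurable_const
  exact (Complex.measurable_ofReal.comp (hO.continuous_rho.measurable.comp h1)).inv.mul
    ((hO.continuous_starIntegrand hk hl x).measurable.comp (measurable_fst.prodMk h1))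

lemma starDensity_lieExp {k l : G × G → ℂ} (x : G × (E →L[ℝ] ℝ)) (c : G) {Z : E} (hZ : Z ∈ O) :
    rho G Z • starDensity ħ O k l x (c, lieExp G Z) = starIntegrand ħ k l x (c, Z) := by
  have hr : ((rho G Z : ℝ) : ℂ) ≠ 0 := by exact_mod_cast (hO.rho_pos hZ).ne'
  rw [starDensity, if_pos (Set.mem_image_of_mem _ hZ)]
  simp only [hO.lieLog_lieExp hZ]
  rw [Complex.real_smul, mul_inv_cancel_left₀ hr]

open Classical in
lemma starProd_integrand_eq (k l : G × G → ℂ) (x : G × (E →L[ℝ] ℝ)) (Z : E × E) :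
    symbol O k (x.1 * lieExp G (-(1 / 2 : ℝ) • bch G O Z.1 Z.2) * lieExp G ((1 / 2 : ℝ) • Z.1), Z.1) *
      symbol O l
        (x.1 * lieExp G ((1 / 2 : ℝ) • bch G O Z.1 Z.2) * lieExp G (-(1 / 2 : ℝ) • Z.2), Z.2) *
      Complex.exp (-(Complex.I / (ħ : ℂ)) * ((x.2 (bch G O Z.1 Z.2) : ℝ) : ℂ)) *
      ((L G O Z.1 Z.2 : ℝ) : ℂ) =
    (O ×ˢ O).indicator (fun Z => (rho G Z.1 * rho G Z.2) •
      starDensity ħ O k l x (lieExp G Z.1, lieExp G Z.1 * lieExp G Z.2)) Z := by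
  obtain ⟨X, Y⟩ := Z
  by_cases hXY : (X, Y) ∈ O ×ˢ O
  swap
  · rw [Set.indicator_of_notMem hXY, L, if_neg fun h => hXY ⟨h.1, h.2.1⟩]
    simp
  rw [Set.indicator_of_mem hXY]
  obtain ⟨hX, hY⟩ := hXY
  dsimp only at hX hY ⊢
  by_cases hU : lieExp G X * lieExp G Y ∈ lieExp G '' O
  swap
  · rw [L, if_neg fun h => hU h.2.2, starDensity, if_neg hU]
    simp
  set W := bch G O X Y with hW
  have hWO : W ∈ O := lieLog_mem hU
  have hlog : lieLog O (lieExp G X * lieExp G Y) = W := rfl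
  have hexp : lieExp G W = lieExp G X * lieExp G Y := lieExp_lieLog hU
  -- With `a = q exp(-W/2)`, `b = q exp(W/2)` and `c = a exp X`, the arguments of the two symbols
  -- are the midpoints of `(a, c)` and `(c, b)`: a geodesic triangle with vertices `a`, `c`, `b`.
  have h1 : weylMap (x.1 * lieExp G (-(1 / 2 : ℝ) • W) * lieExp G ((1 / 2 : ℝ) • X), X) =
      ((weylMap (x.1, W)).1, (weylMap (x.1, W)).1 * lieExp G X) := by
    simp only [weylMap, lieExp_neg_half, mul_inv_cancel_right, Prod.mk.injEq, true_and]
    rw [mul_assoc (x.1 * _), lieExp_half_mul_half]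
  have h2 : weylMap (x.1 * lieExp G ((1 / 2 : ℝ) • W) * lieExp G (-(1 / 2 : ℝ) • Y), Y) =
      ((weylMap (x.1, W)).1 * lieExp G X, (weylMap (x.1, W)).2) := by
    simp only [weylMap, lieExp_neg_half, inv_mul_cancel_right, Prod.mk.injEq, and_true]
    rw [mul_assoc (x.1 * _), ← mul_inv_rev, lieExp_half_mul_half, mul_inv_eq_iff_eq_mul,
      mul_assoc (x.1 * _), ← hexp, ← lieExp_half_mul_half W]
    group
  rw [symbol_of_mem (x := (_, X)) hX, symbol_of_mem (x := (_, Y)) hY, h1, h2, L,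
    if_pos ⟨hX, hY, hU⟩, starDensity, if_pos hU, hlog]
  have h3 := congrArg (fun t : ℝ => (t : ℂ)) (hO.F_mul_F_div_F hWO hexp)
  push_cast at h3
  rw [Complex.real_smul]
  simp only [starIntegrand]
  push_cast
  linear_combination (Complex.exp (-(Complex.I / (ħ : ℂ)) * ((x.2 W : ℝ) : ℂ)) *
    (k ((weylMap (x.1, W)).1, (weylMap (x.1, W)).1 * lieExp G X) *
      l ((weylMap (x.1, W)).1 * lieExp G X, (weylMap (x.1, W)).2))) * h3

variable [SFinite m] [m.IsHaarMeasure]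

lemma integral_prod_logMeasure (f : E × E → ℂ) :
    ∫ Z, f Z ∂((logMeasure E m O).prod (logMeasure E m O)) =
      ∫ Z in O ×ˢ O, (rho G Z.1 * rho G Z.2) • f Z ∂((measX E m).prod (measX E m)) := by
  have hr := hO.measurable_rho
  have hr2 : Measurable fun Z : E × E =>
      ENNReal.ofReal (rho G Z.1) * ENNReal.ofReal (rho G Z.2) :=
    (hr.comp measurable_fst).mul (hr.comp measurable_snd)
  rw [logMeasure, prod_withDensity hr hr, Measure.prod_restrict,
    integral_withDensity_eq_integral_toReal_smul hr2
      (Eventually.of_forall fun _ => ENNReal.mul_lt_top ENNReal.ofReal_lt_top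
        ENNReal.ofReal_lt_top)]
  refine integral_congr_ae (Eventually.of_forall fun Z => ?_)
  simp only [ENNReal.toReal_mul, ENNReal.toReal_ofReal (rho_nonneg _)]

lemma integral_prod_logMeasure_right (f : G × E → ℂ) :
    ∫ y, f y ∂(m.prod (logMeasure E m O)) =
      ∫ y in Set.univ ×ˢ O, rho G y.2 • f y ∂(m.prod (measX E m)) := by
  have hr := hO.measurable_rho
  have hr2 : Measurable fun y : G × E => ENNReal.ofReal (rho G y.2) := hr.comp measurable_snd
  rw [logMeasure, prod_withDensity_right hr, ← Measure.prod_restrict, Measure.restrict_univ,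
    integral_withDensity_eq_integral_toReal_smul hr2
      (Eventually.of_forall fun _ => ENNReal.ofReal_lt_top)]
  refine integral_congr_ae (Eventually.of_forall fun Z => ?_)
  simp only [ENNReal.toReal_ofReal (rho_nonneg _)]

/-- Where the integrand is nonzero, the group variable is `p.1⁻¹ p.2` for a point of the support of
`k`, and `exp Z` is a quotient of end points of the two supports. Both range over compact sets, so
`Z ∈ O` is bounded. -/
lemma integrableOn_starIntegrand {k l : G × G → ℂ} (hk : IsTestKernel E k)
    (hl : IsTestKernel E l) (x : G × (E →L[ℝ] ℝ)) :
    IntegrableOn (starIntegrand ħ k l x) (Set.univ ×ˢ O) (m.prod (measX E m)) := by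
  have hC1 : IsCompact ((fun p : G × G => p.1⁻¹ * p.2) '' tsupport k) :=
    hk.hasCompactSupport.isCompact.image (by fun_prop)
  have hC2 : IsCompact ((fun p : (G × G) × (G × G) => p.1.1⁻¹ * p.2.2) ''
      (tsupport k ×ˢ tsupport l)) :=
    (hk.hasCompactSupport.isCompact.prod hl.hasCompactSupport.isCompact).image (by fun_prop)
  obtain ⟨R, hR⟩ := hO.exists_bound_of_isCompact hC2
  refine IntegrableOn.of_forall_sdiff_eq_zero
    ((hO.continuous_starIntegrand hk.continuous hl.continuous x).continuousOn.integrableOn_compact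
      (hC1.prod (isCompact_closedBall (0 : E) R)))
    (MeasurableSet.univ.prod hO.measurableSet_O) fun y hy => ?_
  by_contra h
  have hkl := right_ne_zero_of_mul h
  have h1 := subset_tsupport k (left_ne_zero_of_mul hkl)
  have h2 := subset_tsupport l (right_ne_zero_of_mul hkl)
  refine hy.2 ⟨⟨_, h1, inv_mul_cancel_left _ _⟩, ?_⟩
  rw [mem_closedBall_zero_iff]
  exact hR y.2 hy.1.2 ⟨(_, _), ⟨h1, h2⟩, weylMap_inv_mul (x.1, y.2)⟩

/-- The star-product of two functions in `F(M)` corresponds to the composition of kernels. -/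
lemma starProd_invFourier_symbol (hħ : ħ ≠ 0) {k l : G × G → ℂ} (hk : IsTestKernel E k)
    (hl : IsTestKernel E l) :
    starProd ħ m O (invFourier ħ m (symbol O k)) (invFourier ħ m (symbol O l)) =
      invFourier ħ m (symbol O (kcomp m k l)) := by
  ext x
  have hexp := hO.measurePreserving_lieExp
  have hmeas := hO.measurable_starDensity (ħ := ħ) hk.continuous hl.continuous x
  -- Left invariance makes the shear `(u, v) ↦ (u, uv)` measure preserving, so `(X, Y)` may be
  -- exchanged for `(exp X, exp X exp Y)`.
  have hmp := (measurePreserving_prod_mul m m).comp (hexp.prod hexp)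
  have hmp' := (MeasurePreserving.id m).prod hexp
  calc _ = ∫ Z in O ×ˢ O, (rho G Z.1 * rho G Z.2) •
          starDensity ħ O k l x (lieExp G Z.1, lieExp G Z.1 * lieExp G Z.2)
          ∂((measX E m).prod (measX E m)) := by
        rw [← integral_indicator (hO.measurableSet_O.prod hO.measurableSet_O), starProd,
          hO.fourier_invFourier_symbol hħ hk, hO.fourier_invFourier_symbol hħ hl]
        exact integral_congr_ae (Eventually.of_forall (hO.starProd_integrand_eq k l x))
    _ = ∫ y, starDensity ħ O k l x y ∂(m.prod m) := by
        rw [← hO.integral_prod_logMeasure, ← hmp.map_eq,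
          integral_map hmp.measurable.aemeasurable (by exact hmeas.aestronglyMeasurable)]
        rfl
    _ = ∫ y in Set.univ ×ˢ O, starIntegrand ħ k l x y ∂(m.prod (measX E m)) := by
        rw [← hmp'.map_eq,
          integral_map hmp'.measurable.aemeasurable (by exact hmeas.aestronglyMeasurable),
          hO.integral_prod_logMeasure_right]
        exact setIntegral_congr_fun (MeasurableSet.univ.prod hO.measurableSet_O)
          fun y hy => hO.starDensity_lieExp x y.1 hy.2
    _ = ∫ Z in O, ∫ c, starIntegrand ħ k l x (c, Z) ∂m ∂(measX E m) := by
        have h := hO.integrableOn_starIntegrand (ħ := ħ) hk hl x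
        rw [IntegrableOn, ← Measure.prod_restrict, Measure.restrict_univ] at h
        rw [← Measure.prod_restrict, Measure.restrict_univ, integral_prod_symm _ h]
    _ = _ := by
        rw [invFourier, ← integral_indicator hO.measurableSet_O]
        refine integral_congr_ae (Eventually.of_forall fun Z => ?_)
        dsimp only
        by_cases hZ : Z ∈ O
        · rw [Set.indicator_of_mem hZ, symbol_of_mem (x := (x.1, Z)) hZ]
          simp only [starIntegrand]
          -- Left invariance in `c` absorbs the base point `q exp(-Z/2)`, leaving the composed
          -- kernel.
          rw [integral_const_mul, integral_mul_left_eq_self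
            (fun c => k ((weylMap (x.1, Z)).1, c) * l (c, (weylMap (x.1, Z)).2)), kcomp]
          ring
        · rw [Set.indicator_of_notMem hZ, symbol_of_notMem (x := (x.1, Z)) hZ, zero_mul]

end IsWeaklyExponential

end StarProduct

/-! ### Extension of the star-product by density -/

section Extension

variable {E : Type*} [NormedAddCommGroup E] [NormedSpace ℝ E] [FiniteDimensional ℝ E]
  [MeasurableSpace E] [BorelSpace E]
variable {G : Type*} [TopologicalSpace G] [T2Space G] [SecondCountableTopology G]
  [ChartedSpace E G] [Group G] [LieGroup 𝓘(ℝ, E) ∞ G]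
  [MeasurableSpace G] [BorelSpace G] [IsTopologicalGroup G] [LocallyCompactSpace G]
  {m : Measure G} [SFinite m] [m.IsHaarMeasure] {O : Set E} {ħ : ℝ}

namespace IsWeaklyExponential

variable (hO : IsWeaklyExponential G m O) (hħ : ħ ≠ 0)
include hO

include hħ in
lemma completeSpace_LSpace : CompleteSpace (LSpace ħ m O) :=
  ((hO.weylEquiv hħ).isometry.isUniformInducing.completeSpace_congr
    (hO.weylEquiv hħ).surjective).1 inferInstance

include hħ in
lemma dense_FSpace :
    Dense {u : LSpace ħ m O | ∃ f ∈ FSpace ħ m O, u.1 =ᵐ[measL E ħ m] f} := by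
  refine ((hO.weylEquiv hħ).surjective.denseRange.dense_image (hO.weylEquiv hħ).continuous
    (dense_testKernels (E := E))).mono ?_
  rintro _ ⟨_, ⟨k, hk, rfl⟩, rfl⟩
  exact ⟨_, hO.mem_FSpace_iff.2 ⟨k, hk, rfl⟩, hO.weylEquiv_ae_eq hħ hk⟩

lemma eq_weylEquiv_of_ae_eq {k : G × G → ℂ} (hk : IsTestKernel E k) {u : LSpace ħ m O}
    (hu : u.1 =ᵐ[measL E ħ m] invFourier ħ m (symbol O k)) :
    u = hO.weylEquiv hħ (hk.memLp.toLp k) :=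
  Subtype.ext (Lp.ext (hu.trans (hO.weylEquiv_ae_eq hħ hk).symm))

lemma transportMul_ae_eq_starProd {f g : G × (E →L[ℝ] ℝ) → ℂ} (hf : f ∈ FSpace ħ m O)
    (hg : g ∈ FSpace ħ m O) {u v : LSpace ħ m O} (hu : u.1 =ᵐ[measL E ħ m] f)
    (hv : v.1 =ᵐ[measL E ħ m] g) :
    (transportMul (hO.weylEquiv hħ) (kmul m) u v).1 =ᵐ[measL E ħ m] starProd ħ m O f g := by
  obtain ⟨k, hk, rfl⟩ := hO.mem_FSpace_iff.1 hf
  obtain ⟨l, hl, rfl⟩ := hO.mem_FSpace_iff.1 hg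
  have hkl := hO.isTestKernel_kcomp hk hl
  have h : kmul m (hk.memLp.toLp k) (hl.memLp.toLp l) = hkl.memLp.toLp (kcomp m k l) :=
    Lp.ext ((coeFn_kmul _ _).trans ((kcomp_congr hk.memLp.coeFn_toLp hl.memLp.coeFn_toLp).trans
      hkl.memLp.coeFn_toLp.symm))
  rw [hO.eq_weylEquiv_of_ae_eq hħ hk hu, hO.eq_weylEquiv_of_ae_eq hħ hl hv, transportMul_apply,
    LinearIsometryEquiv.symm_apply_apply, LinearIsometryEquiv.symm_apply_apply, h,
    hO.starProd_invFourier_symbol hħ hk hl]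
  exact hO.weylEquiv_ae_eq hħ hkl

/-- Continuous maps that agree on a dense set coincide; the argument is applied to one variable at a
time, first to operators and then to their values. -/
lemma eq_transportMul {mul' : LSpace ħ m O →L[ℂ] LSpace ħ m O →L[ℂ] LSpace ħ m O}
    (h : ∀ f ∈ FSpace ħ m O, ∀ g ∈ FSpace ħ m O, ∀ u v : LSpace ħ m O,
      u.1 =ᵐ[measL E ħ m] f → v.1 =ᵐ[measL E ħ m] g →
        (mul' u v).1 =ᵐ[measL E ħ m] starProd ħ m O f g) :
    mul' = transportMul (hO.weylEquiv hħ) (kmul m) := by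
  refine ContinuousLinearMap.coeFn_injective
    (mul'.continuous.ext_on (hO.dense_FSpace hħ) (ContinuousLinearMap.continuous _) ?_)
  rintro u ⟨f, hf, hu⟩
  refine ContinuousLinearMap.coeFn_injective
    ((mul' u).continuous.ext_on (hO.dense_FSpace hħ) (ContinuousLinearMap.continuous _) ?_)
  rintro v ⟨g, hg, hv⟩
  exact Subtype.ext (Lp.ext ((h f hf g hg u v hu hv).trans
    (hO.transportMul_ae_eq_starProd hħ hf hg hu hv).symm))

end IsWeaklyExponential

end Extension

end LieStar

theorem mainTheorem4
    {E : Type*} [NormedAddCommGroup E] [NormedSpace ℝ E] [FiniteDimensional ℝ E]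
    [MeasurableSpace E] [BorelSpace E]
    {G : Type*} [TopologicalSpace G] [T2Space G] [SecondCountableTopology G]
    [ChartedSpace E G] [Group G] [LieGroup 𝓘(ℝ, E) ∞ G] [MeasurableSpace G] [BorelSpace G]
    (m : Measure G) [SFinite m] [m.IsHaarMeasure]
    (O : Set E) (hO : LieStar.IsWeaklyExponential G m O)
    (ħ : ℝ) (hħ : ħ ≠ 0) :
    -- the inequality for the star-product on `F(M)`
    (∀ f ∈ LieStar.FSpace ħ m O, ∀ g ∈ LieStar.FSpace ħ m O,
      MemLp f 2 (LieStar.measL E ħ m) ∧ MemLp g 2 (LieStar.measL E ħ m) ∧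
      LieStar.starProd ħ m O f g ∈ LieStar.FSpace ħ m O ∧
      MemLp (LieStar.starProd ħ m O f g) 2 (LieStar.measL E ħ m) ∧
      eLpNorm (LieStar.starProd ħ m O f g) 2 (LieStar.measL E ħ m) ≤
        eLpNorm f 2 (LieStar.measL E ħ m) * eLpNorm g 2 (LieStar.measL E ħ m)) ∧
    -- `𝓛(M)` is a Hilbert space which contains `F(M)` as a dense subspace
    CompleteSpace (LieStar.LSpace ħ m O) ∧
    (∀ f ∈ LieStar.FSpace ħ m O, ∃ u : LieStar.LSpace ħ m O, u.1 =ᵐ[LieStar.measL E ħ m] f) ∧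
    Dense {u : LieStar.LSpace ħ m O |
      ∃ f ∈ LieStar.FSpace ħ m O, u.1 =ᵐ[LieStar.measL E ħ m] f} ∧
    -- the star-product extends uniquely to a continuous bilinear multiplication on `𝓛(M)`,
    -- which satisfies the same inequality and makes `𝓛(M)`, with complex conjugation, a
    -- Hilbert algebra
    ∃ mul : LieStar.LSpace ħ m O →L[ℂ] LieStar.LSpace ħ m O →L[ℂ] LieStar.LSpace ħ m O,
    ∃ conj : LieStar.LSpace ħ m O → LieStar.LSpace ħ m O,
      (∀ f ∈ LieStar.FSpace ħ m O, ∀ g ∈ LieStar.FSpace ħ m O, ∀ u v : LieStar.LSpace ħ m O,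
        u.1 =ᵐ[LieStar.measL E ħ m] f → v.1 =ᵐ[LieStar.measL E ħ m] g →
          (mul u v).1 =ᵐ[LieStar.measL E ħ m] LieStar.starProd ħ m O f g) ∧
      (∀ mul' : LieStar.LSpace ħ m O →L[ℂ] LieStar.LSpace ħ m O →L[ℂ] LieStar.LSpace ħ m O,
        (∀ f ∈ LieStar.FSpace ħ m O, ∀ g ∈ LieStar.FSpace ħ m O, ∀ u v : LieStar.LSpace ħ m O,
          u.1 =ᵐ[LieStar.measL E ħ m] f → v.1 =ᵐ[LieStar.measL E ħ m] g →
            (mul' u v).1 =ᵐ[LieStar.measL E ħ m] LieStar.starProd ħ m O f g) → mul' = mul) ∧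
      (∀ u v, ‖mul u v‖ ≤ ‖u‖ * ‖v‖) ∧
      (∀ u, (conj u).1 =ᵐ[LieStar.measL E ħ m] fun x => starRingEnd ℂ (u.1 x)) ∧
      LieStar.IsHilbertAlgebra (ContinuousLinearMap.toLinearMap₁₂ mul) conj := by
  have : IsTopologicalGroup G := topologicalGroup_of_lieGroup 𝓘(ℝ, E) ∞
  have : LocallyCompactSpace G := Manifold.locallyCompact_of_finiteDimensional 𝓘(ℝ, E)
  refine ⟨fun f hf g hg => ?_, hO.completeSpace_LSpace hħ, fun f hf => ?_, hO.dense_FSpace hħ,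
    LieStar.transportMul (hO.weylEquiv hħ) (LieStar.kmul m),
    fun u => hO.weylEquiv hħ (LieStar.kconj m ((hO.weylEquiv hħ).symm u)),
    fun f hf g hg u v hu hv => hO.transportMul_ae_eq_starProd hħ hf hg hu hv,
    fun mul' h => hO.eq_transportMul hħ h, fun u v => ?_, fun u => ?_,
    LieStar.isHilbertAlgebra_kmul.transport _⟩
  · obtain ⟨k, hk, rfl⟩ := hO.mem_FSpace_iff.1 hf
    obtain ⟨l, hl, rfl⟩ := hO.mem_FSpace_iff.1 hg
    have hkl := hO.isTestKernel_kcomp hk hl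
    rw [hO.starProd_invFourier_symbol hħ hk hl, hO.eLpNorm_invFourier_symbol hħ hk,
      hO.eLpNorm_invFourier_symbol hħ hl, hO.eLpNorm_invFourier_symbol hħ hkl]
    exact ⟨hO.memLp_invFourier_symbol hħ hk, hO.memLp_invFourier_symbol hħ hl,
      hO.mem_FSpace_iff.2 ⟨_, hkl, rfl⟩, hO.memLp_invFourier_symbol hħ hkl,
      LieStar.eLpNorm_kcomp_le hk.memLp hl.memLp⟩
  · obtain ⟨k, hk, rfl⟩ := hO.mem_FSpace_iff.1 hf
    exact ⟨_, hO.weylEquiv_ae_eq hħ hk⟩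
  · rw [LieStar.transportMul_apply, LinearIsometryEquiv.norm_map]
    refine (LieStar.norm_kmul_le _ _).trans ?_
    rw [LinearIsometryEquiv.norm_map, LinearIsometryEquiv.norm_map]
  · have h := hO.weylIsometry_kconj hħ ((hO.weylEquiv hħ).symm u)
    rw [← hO.coe_weylEquiv, ← hO.coe_weylEquiv, LinearIsometryEquiv.apply_symm_apply] at h
    exact h
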